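/- **Setting.** Let $\mathbf E$ be the set of integrable, nonnegative, monotonically decreasing functions on $[0,\infty)$. For $u\in\mathbf E$, $u\not\equiv0$, let $\ell_u=\sup\{x\ge 0: u(x)>0\}\in(0,\infty]$ be the end of its support and $h(x)=\int_x^\infty u(x')\,dx'$. If $h$ is $C^2$ on $[0,\ell_u)$, the beta function of $u$ is $$\beta(x)=\frac{h''(x)\,h(x)}{h'(x)^2},\qquad 0\le x<\ell_u .$$ Also put $$L[u]^{1/3}=\frac13\int_0^\infty x^{-2/3}u(x)\,dx\Big/u(0),\qquad \Lambda[u]=\int_0^\infty x\,c(x)\,dx\Big/\int_0^\infty c(x)\,dx,\quad c=-u'.$$ A solution of the LSW system with initial data $w_0\in\mathbf E$ is a continuous function $w(x,t)\ge 0$ on $[0,\infty)\times[0,\infty)$ with $w(\cdot,0)=w_0$, with $w(\cdot,t)\in\mathbf E$ and $\int_0^\infty w(x,t)\,dx=1$ for all $t\ge 0$, which on the set $\{x>0,\ t>0,\ w(x,t)>0\}$ is differentiable and satisfies $$\frac{\partial w}{\partial t}(x,t)=\Big[1-\Big(\frac{x}{L(t)}\Big)^{1/3}\Big]\frac{\partial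 w}{\partial x}(x,t),\qquad L(t)=L[w(\cdot,t)].$$ Write $\Lambda(t)=\Lambda[w(\cdot,t)]$ for the mean cluster volume. **Proposition 5.1.** Let $w_0\in\mathbf E$ have beta function $\beta_0$ on $[0,\ell)$, where $\ell=\ell_{w_0}\in(0,\infty]$, let $L[w_0]=1$, and let $w$ be a solution of the LSW system with initial data $w_0$. Suppose that there is $r<\ell$ such that $\beta_0(z)\le 1$ for all $z\in[0,\ell)$ with $z\ge r$, and that $\liminf_{z\to\ell}\beta_0(z)>0$. Then there is a constant $C>0$, depending only on the function $\beta_0$ (with its domain $[0,\ell)$), such that $$\Lambda(T)\ge C\,T\qquad\text{for all } T\ge 1 .$$ -/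

import Mathlib

open Set Filter Topology MeasureTheory

noncomputable section

namespace LSW

/-- The space `E` of integrable, nonnegative, monotonically decreasing functions on `[0, ∞)`.
Functions on `[0, ∞)` are represented by functions on `ℝ` whose values at negative arguments
play no role. -/
structure MemE (u : ℝ → ℝ) : Prop where
  nonneg : ∀ x, 0 ≤ x → 0 ≤ u x
  antitone : AntitoneOn u (Ici 0)
  integrable : IntegrableOn u (Ioi 0)

/-- The right end `‖X‖_∞ ∈ (0, ∞]` of the support of `u`, that is, the essential supremum of the
random variable `X` with `P(X > x) = u x / u 0`. -/
def supportEnd (u : ℝ → ℝ) : EReal :=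
  ⨆ x ∈ {x : ℝ | 0 ≤ x ∧ 0 < u x}, (x : EReal)

/-- The interval `[0, ℓ)`, where `ℓ` may be infinite. -/
def interval (ℓ : EReal) : Set ℝ := {x : ℝ | 0 ≤ x ∧ (x : EReal) < ℓ}

/-- The filter of real numbers `x` tending to `ℓ` from the left (`x → ∞` when `ℓ = ∞`). -/
def towardsEnd (ℓ : EReal) : Filter ℝ := comap (fun x : ℝ => (x : EReal)) (𝓝[<] ℓ)

/-- `h(x) = ∫_x^∞ u(x') dx'`. -/
def tail (u : ℝ → ℝ) (x : ℝ) : ℝ := ∫ y in Ioi x, u y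

/-- The beta function `β = h'' h / (h')²` of `u`, with domain `[0, ‖X‖_∞)`. The derivatives are
taken within this interval, so they are one-sided at `0` and ordinary at interior points. -/
def beta (u : ℝ → ℝ) (x : ℝ) : ℝ :=
  derivWithin (derivWithin (tail u) (interval (supportEnd u))) (interval (supportEnd u)) x
      * tail u x
    / (derivWithin (tail u) (interval (supportEnd u)) x) ^ 2

/-- Functions in `E` which have a beta function: `h` is `C²` on `[0, ‖X‖_∞)`. -/
structure HasBeta (u : ℝ → ℝ) : Prop where
  memE : MemE u
  contDiffOn : ContDiffOn ℝ 2 (tail u) (interval (supportEnd u))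

/-- The typical cluster volume `L`, given by
`L^{1/3} = (1/3) ∫_0^∞ x^{-2/3} u(x) dx / u(0)`. -/
def typicalVolume (u : ℝ → ℝ) : ℝ :=
  ((1 / 3 : ℝ) * (∫ x in Ioi (0 : ℝ), x ^ (-(2 / 3) : ℝ) * u x) / u 0) ^ 3

/-- The mean cluster volume `Λ = ∫_0^∞ x c(x) dx / ∫_0^∞ c(x) dx`, where `c = -u'` is the cluster
density, so that `u(x) = ∫_x^∞ c(x') dx'`. -/
def meanVolume (u : ℝ → ℝ) : ℝ :=
  (∫ x in Ioi (0 : ℝ), x * (-deriv u x)) / ∫ x in Ioi (0 : ℝ), -deriv u x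

/-- `w(x, t)`, `x ≥ 0`, `t ≥ 0`, is a solution of the LSW system
`∂w/∂t = [1 - (x / L(t))^{1/3}] ∂w/∂x` for `x > 0`, `t > 0`, and `∫_0^∞ w(x, t) dx = 1`,
with initial data `w₀`, where `L(t)` is the typical cluster volume of `w(·, t)`.

The function `w` is continuous up to the boundary, and `w(·, t) ∈ E`, which expresses that
`c = -∂w/∂x` is a nonnegative density. The differential equation holds in the classical sense
where `w > 0`. Beyond the end of its support `w` vanishes, and at the end itself it need not be
differentiable, as for initial data behaving like `(a - x)^p`, `0 < p < 1`, near the end `a`. -/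
structure IsSolution (w₀ : ℝ → ℝ) (w : ℝ → ℝ → ℝ) : Prop where
  continuousOn : ContinuousOn (fun p : ℝ × ℝ => w p.1 p.2) (Ici 0 ×ˢ Ici 0)
  memE : ∀ t, 0 ≤ t → MemE (fun x => w x t)
  initial : ∀ x, 0 ≤ x → w x 0 = w₀ x
  mass : ∀ t, 0 ≤ t → ∫ x in Ioi (0 : ℝ), w x t = 1
  differentiableAt : ∀ x t, 0 < x → 0 < t → 0 < w x t →
    DifferentiableAt ℝ (fun p : ℝ × ℝ => w p.1 p.2) (x, t)
  equation : ∀ x t, 0 < x → 0 < t → 0 < w x t →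
    deriv (fun s => w x s) t =
      (1 - (x / typicalVolume (fun z => w z t)) ^ (1 / 3 : ℝ)) * deriv (fun z => w z t) x

end LSW

end

/-! The mass is one, so `Λ(t) = 1 / w(0,t)` (`lam`), and formally `Λ' = β(0,t)`, where `β(·,t)` is
the beta function of `w(·,t)`. Linear growth is thus a lower bound for `β(0,t)`.

Put `m = L^{-1/3}`. Since `w` is constant along the characteristics `z' = m z^{1/3} - 1`, the chain
rule gives `β(x,T) = β₀(Z) R`, where `Z` is the initial position of the characteristic ending at
`(x,T)` and `R` compares the stretching `J` of the flow with the growth of the tail `h`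
(`Sys.exists_deriv`). Concavity of the cube root makes `R ≤ 1`, so `β ≤ 1`, that is log-concavity of
`h`, is preserved. After a bounded time every cluster of initial volume at most `r` has vanished
(`Sys.exists_good_time`); from then on `h` is log-concave on the whole half-line, and `m` is
comparable to `Λ^{-1/3}`.

It remains to bound `R` from below near `x = 0`. The loss of `log R` is controlled by `h / w` along
the characteristic (`Sys.lossRate_le`). Backward in time, `h` decays there exponentially in `∫ dt /
Λ` while the characteristic stays below `27 Λ`. If `Λ` has also grown slowly compared with this
decay, the total loss is bounded by an absolute constant (`Sys.loss_slow`). If one of the two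
conditions fails, consider the last time at which it does. Just after it `Λ` grows at a definite
linear rate, which forces `R` to be bounded below at that time, whatever happened before
(`Sys.R_ge_of_growth`). The bounded loss afterwards then gives a uniform bound (`Sys.R_ge`), which
integrates to linear growth (`Sys.lam_linear`).

All constants depend on the initial data alone, and the initial data are determined by the beta
function with its domain, the unit mass and `L = 1` (`Datum.eqOn`). -/

noncomputable section

namespace LSW

/-! ### The cube root and the existence of characteristics -/

section

/-- The cube root. -/
def cb (x : ℝ) : ℝ := x ^ (1 / 3 : ℝ)

lemma cb_pow {x : ℝ} (hx : 0 ≤ x) : cb x ^ 3 = x := by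
  unfold cb
  rw [← Real.rpow_natCast, ← Real.rpow_mul hx]
  norm_num

lemma cb_pos {x : ℝ} (hx : 0 < x) : 0 < cb x := Real.rpow_pos_of_pos hx _

lemma cb_nonneg {x : ℝ} (hx : 0 ≤ x) : 0 ≤ cb x := Real.rpow_nonneg hx _

lemma cb_cube {x : ℝ} (hx : 0 ≤ x) : cb (x ^ 3) = x := by
  unfold cb
  rw [← Real.rpow_natCast, ← Real.rpow_mul hx]
  norm_num

lemma continuous_cb : Continuous cb := by
  unfold cb
  exact Real.continuous_rpow_const (by norm_num)

lemma cb_le {x y : ℝ} (hx : 0 ≤ x) (h : x ≤ y) : cb x ≤ cb y :=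
  Real.rpow_le_rpow hx h (by norm_num)

lemma rpow_neg_two_thirds {x : ℝ} (hx : 0 < x) : x ^ (-(2 / 3) : ℝ) = 1 / cb x ^ 2 := by
  unfold cb
  rw [← Real.rpow_natCast, ← Real.rpow_mul hx.le, Real.rpow_neg hx.le]
  norm_num

lemma hasDerivAt_cb {x : ℝ} (hx : 0 < x) : HasDerivAt cb (1 / (3 * cb x ^ 2)) x := by
  have h := Real.hasDerivAt_rpow_const (x := x) (p := 1 / 3) (Or.inl hx.ne')
  have e : (1 / 3 : ℝ) - 1 = -(2 / 3) := by norm_num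
  rw [e, rpow_neg_two_thirds hx] at h
  have e2 : 1 / (3 * cb x ^ 2) = 1 / 3 * (1 / cb x ^ 2) := by ring
  rw [e2]
  exact h

/-- The difference quotient of the cube root. -/
def cbSlope (u v : ℝ) : ℝ := 1 / (cb u ^ 2 + cb u * cb v + cb v ^ 2)

/-- This factorization makes the difference of two characteristics solve a linear equation. -/
lemma cb_sub {u v : ℝ} (hu : 0 < u) (hv : 0 < v) : cb u - cb v = (u - v) * cbSlope u v := by
  have h1 := cb_pow hu.le
  have h2 := cb_pow hv.le
  have := cb_pos hu
  have := cb_pos hv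
  unfold cbSlope
  have h : u - v = (cb u - cb v) * (cb u ^ 2 + cb u * cb v + cb v ^ 2) := by
    rw [← h1, ← h2, cb_cube (cb_pos hu).le, cb_cube (cb_pos hv).le]; ring
  rw [h]
  field_simp

lemma cbSlope_pos {u v : ℝ} (hu : 0 < u) (hv : 0 < v) : 0 < cbSlope u v := by
  have := cb_pos hu
  have := cb_pos hv
  unfold cbSlope
  positivity

lemma cbSlope_le {u v μ : ℝ} (hμ : 0 < μ) (hu : μ ≤ u) (hv : μ ≤ v) :
    cbSlope u v ≤ 1 / (3 * cb μ ^ 2) := by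
  have h0 := cb_pos hμ
  have h1 := cb_le hμ.le hu
  have h2 := cb_le hμ.le hv
  unfold cbSlope
  apply one_div_le_one_div_of_le (by positivity)
  nlinarith [mul_le_mul h1 h2 h0.le (h0.le.trans h1), mul_le_mul h1 h1 h0.le (h0.le.trans h1),
    mul_le_mul h2 h2 h0.le (h0.le.trans h2)]

lemma cbSlope_self (u : ℝ) : cbSlope u u = 1 / (3 * cb u ^ 2) := by
  unfold cbSlope
  ring_nf

lemma continuousAt_cbSlope {u v : ℝ} (hu : 0 < u) (hv : 0 < v) :
    ContinuousAt (fun p : ℝ × ℝ => cbSlope p.1 p.2) (u, v) := by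
  unfold cbSlope
  have c1 : Continuous fun p : ℝ × ℝ => cb p.1 ^ 2 + cb p.1 * cb p.2 + cb p.2 ^ 2 := by
    have := continuous_cb
    fun_prop
  refine ContinuousAt.div continuousAt_const c1.continuousAt ?_
  have := cb_pos hu
  have := cb_pos hv
  positivity

/-- `z` is a characteristic on `[0, T]`, staying positive. -/
def IsTraj (m : ℝ → ℝ) (T : ℝ) (z : ℝ → ℝ) : Prop :=
  ∀ s ∈ Icc 0 T, 0 < z s ∧ HasDerivAt z (m s * cb (z s) - 1) s

/-- The cube root is not Lipschitz at `0`, so below `μ` it is frozen at `cb μ`, and Picard–Lindelöf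
applies. The time interval exceeds `[0, T]` on both sides so that the derivatives on `[0, T]` are
two-sided. -/
lemma exists_floored_solution {m : ℝ → ℝ} (hm : Continuous m) (hpos : ∀ t, 0 < m t) {T x μ : ℝ}
    (hT : 0 ≤ T) (hμ : 0 < μ) (hx : μ ≤ x) :
    ∃ z : ℝ → ℝ, z T = x ∧ ∀ s ∈ Icc (-1) (T + 1),
      HasDerivWithinAt z (m s * cb (max (z s) μ) - 1) (Icc (-1) (T + 1)) s := by
  obtain ⟨M, hM⟩ := (isCompact_Icc (a := (-1 : ℝ)) (b := T + 1)).bddAbove_image hm.continuousOn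
  have hM' : ∀ s ∈ Icc (-1) (T + 1), m s ≤ M := fun s hs => hM (mem_image_of_mem _ hs)
  have hM0 : 0 < M := (hpos 0).trans_le (hM' 0 ⟨by norm_num, by linarith⟩)
  have hx0 : 0 < x := hμ.trans_le hx
  -- On the ball of radius `A ^ 3 - x` about `x` the speed is at most `M * A + 1`; `A` is so large
  -- that a solution cannot leave this ball within time `T + 1`.
  set A : ℝ := 1 + x + (T + 1) * M + (T + 1) with hA
  have hTM : 0 ≤ (T + 1) * M := by positivity
  have hA1 : 1 ≤ A := by rw [hA]; linarith
  have hA3 : x + (T + 1) * (M * A + 1) ≤ A ^ 3 := by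
    have h1 : A ^ 2 ≤ A ^ 3 := pow_le_pow_right₀ hA1 (by norm_num)
    have h2 : A ^ 2 = A * (1 + x + (T + 1) * M + (T + 1)) := by rw [sq]
    have h3 : x + (T + 1) * (M * A + 1) ≤ A * (1 + x + (T + 1) * M + (T + 1)) := by
      nlinarith
    linarith
  have ha0 : 0 ≤ A ^ 3 - x := by
    have : 0 ≤ (T + 1) * (M * A + 1) := by positivity
    linarith
  have hcμ := cb_pos hμ
  obtain ⟨a, ha⟩ : ∃ a : NNReal, (a : ℝ) = A ^ 3 - x := ⟨⟨_, ha0⟩, rfl⟩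
  obtain ⟨b, hb⟩ : ∃ b : NNReal, (b : ℝ) = M * A + 1 := ⟨⟨M * A + 1, by nlinarith⟩, rfl⟩
  obtain ⟨c, hc⟩ : ∃ c : NNReal, (c : ℝ) = M * (1 / (3 * cb μ ^ 2)) :=
    ⟨⟨M * (1 / (3 * cb μ ^ 2)), by positivity⟩, rfl⟩
  have key : IsPicardLindelof (fun s z => m s * cb (max z μ) - 1) (tmin := -1) (tmax := T + 1)
      ⟨T, by linarith, by linarith⟩ x a 0 b c := by
    constructor
    · intro t ht
      refine LipschitzWith.lipschitzOnWith (LipschitzWith.of_dist_le_mul fun u v => ?_)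
      rw [Real.dist_eq, Real.dist_eq, hc]
      have hu : μ ≤ max u μ := le_max_right _ _
      have hv : μ ≤ max v μ := le_max_right _ _
      have e : m t * cb (max u μ) - 1 - (m t * cb (max v μ) - 1)
          = m t * cbSlope (max u μ) (max v μ) * (max u μ - max v μ) := by
        have := cb_sub (hμ.trans_le hu) (hμ.trans_le hv)
        linear_combination m t * this
      rw [e, abs_mul, abs_mul, abs_of_pos (hpos t),
        abs_of_pos (cbSlope_pos (hμ.trans_le hu) (hμ.trans_le hv))]
      have h4 : |max u μ - max v μ| ≤ |u - v| := abs_max_sub_max_le_abs _ _ _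
      exact mul_le_mul (mul_le_mul (hM' t ht) (cbSlope_le hμ hu hv)
        (cbSlope_pos (hμ.trans_le hu) (hμ.trans_le hv)).le hM0.le) h4 (abs_nonneg _) (by positivity)
    · intro u _
      exact ((hm.mul continuous_const).sub continuous_const).continuousOn
    · intro t ht u hu
      rw [mem_closedBall_iff_norm, Real.norm_eq_abs, ha] at hu
      rw [Real.norm_eq_abs, hb]
      have hu' : u - x ≤ A ^ 3 - x := (le_abs_self _).trans hu
      have h5 : max u μ ≤ A ^ 3 := max_le (by linarith) (by linarith)
      have h6 : cb (max u μ) ≤ A := by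
        have := cb_le (hμ.le.trans (le_max_right u μ)) h5
        rwa [cb_cube (by linarith)] at this
      have h7 : 0 ≤ cb (max u μ) := cb_nonneg (hμ.le.trans (le_max_right u μ))
      have h8 : m t * cb (max u μ) ≤ M * A := mul_le_mul (hM' t ht) h6 h7 hM0.le
      have h9 : 0 ≤ m t * cb (max u μ) := mul_nonneg (hpos t).le h7
      rw [abs_le]
      constructor <;> linarith
    · rw [ha, hb, NNReal.coe_zero, sub_zero]
      have : max (T + 1 - T) (T - -1) = T + 1 := by
        rw [max_eq_right] <;> linarith
      simp only [this]
      linarith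
  obtain ⟨z, hz, hz'⟩ := key.exists_eq_forall_mem_Icc_hasDerivWithinAt₀
  exact ⟨z, hz, hz'⟩

/-- The floor `μ` is chosen so low that the speed there is negative. A solution which is below `μ`
could then never reach `x ≥ μ` at time `T`, so the floor is never active. -/
lemma exists_traj {m : ℝ → ℝ} (hm : Continuous m) (hpos : ∀ t, 0 < m t) {T x : ℝ}
    (hT : 0 ≤ T) (hx : 0 < x) : ∃ z : ℝ → ℝ, z T = x ∧ IsTraj m T z := by
  obtain ⟨M, hM⟩ := (isCompact_Icc (a := (-1 : ℝ)) (b := T + 1)).bddAbove_image hm.continuousOn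
  have hM' : ∀ s ∈ Icc (-1) (T + 1), m s ≤ M := fun s hs => hM (mem_image_of_mem _ hs)
  have hM0 : 0 < M := (hpos 0).trans_le (hM' 0 ⟨by norm_num, by linarith⟩)
  set μ : ℝ := min x ((1 / (2 * M)) ^ 3) with hμ
  have hμ0 : 0 < μ := lt_min hx (by positivity)
  have hcμ : M * cb μ ≤ 1 / 2 := by
    have h1 : cb μ ≤ 1 / (2 * M) := by
      have := cb_le hμ0.le (min_le_right x ((1 / (2 * M)) ^ 3))
      rwa [cb_cube (by positivity)] at this
    calc M * cb μ ≤ M * (1 / (2 * M)) := mul_le_mul_of_nonneg_left h1 hM0.le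
      _ = 1 / 2 := by field_simp
  obtain ⟨z, hzT, hz⟩ := exists_floored_solution hm hpos hT hμ0 (min_le_left x _)
  have hd : ∀ s ∈ Icc 0 T, HasDerivAt z (m s * cb (max (z s) μ) - 1) s := fun s hs =>
    (hz s ⟨by linarith [hs.1], by linarith [hs.2]⟩).hasDerivAt
      (Icc_mem_nhds (by linarith [hs.1]) (by linarith [hs.2]))
  have hge : ∀ s ∈ Icc 0 T, μ ≤ z s := by
    intro s hs
    -- At the level `z s < μ` the speed is at most `-1/2`, so this level is a barrier up to time
    -- `T`.
    by_contra! hlt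
    have hsub : Icc s T ⊆ Icc 0 T := Icc_subset_Icc_left hs.1
    have := image_le_of_deriv_right_lt_deriv_boundary' (f := z)
      (f' := fun s => m s * cb (max (z s) μ) - 1) (a := s) (b := T) (B := fun _ => z s)
      (B' := fun _ => 0) (fun u hu => (hd u (hsub hu)).continuousAt.continuousWithinAt)
      (fun u hu => (hd u (hsub ⟨hu.1, hu.2.le⟩)).hasDerivWithinAt) le_rfl continuousOn_const
      (fun u _ => hasDerivWithinAt_const _ _ _) (fun u hu heq => by
        rw [heq, max_eq_right hlt.le]
        have : m u * cb μ ≤ M * cb μ := mul_le_mul_of_nonneg_right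
          (hM' u ⟨by linarith [hu.1, hs.1], by linarith [hu.2]⟩) (cb_nonneg hμ0.le)
        linarith) (right_mem_Icc.2 hs.2)
    rw [hzT] at this
    exact absurd (min_le_left x ((1 / (2 * M)) ^ 3)) (by rw [← hμ]; linarith)
  refine ⟨z, hzT, fun s hs => ⟨hμ0.trans_le (hge s hs), ?_⟩⟩
  have := hd s hs
  rwa [max_eq_left (hge s hs)] at this

end

/-! ### The flow of characteristics and its space derivative -/

section

lemma le_of_hasDerivAt_nonneg {f f' : ℝ → ℝ} {a b : ℝ} (hab : a ≤ b)
    (hc : ContinuousOn f (Icc a b)) (hd : ∀ s ∈ Ioo a b, HasDerivAt f (f' s) s)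
    (h : ∀ s ∈ Ioo a b, 0 ≤ f' s) : f a ≤ f b := by
  have := monotoneOn_of_deriv_nonneg (convex_Icc a b) hc
    (by rw [interior_Icc]; exact fun s hs => (hd s hs).differentiableAt.differentiableWithinAt)
    (by rw [interior_Icc]; exact fun s hs => by rw [(hd s hs).deriv]; exact h s hs)
  exact this (left_mem_Icc.2 hab) (right_mem_Icc.2 hab) hab

lemma le_of_hasDerivAt_nonpos {f f' : ℝ → ℝ} {a b : ℝ} (hab : a ≤ b)
    (hc : ContinuousOn f (Icc a b)) (hd : ∀ s ∈ Ioo a b, HasDerivAt f (f' s) s)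
    (h : ∀ s ∈ Ioo a b, f' s ≤ 0) : f b ≤ f a := by
  have := le_of_hasDerivAt_nonneg (f := fun s => -f s) (f' := fun s => -f' s) hab hc.neg
    (fun s hs => (hd s hs).neg) (fun s hs => neg_nonneg.2 (h s hs))
  linarith

lemma continuousOn_integral_left {q : ℝ → ℝ} {a b : ℝ} (hq : ContinuousOn q (Icc a b)) :
    ContinuousOn (fun s => ∫ r in s..b, q r) (Icc a b) := by
  rcases le_or_gt a b with hab | hab
  · have h1 : IntegrableOn q (uIcc b a) := by
      rw [uIcc_of_ge hab]; exact hq.integrableOn_Icc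
    have := intervalIntegral.continuousOn_primitive_interval h1
    rw [uIcc_of_ge hab] at this
    refine this.neg.congr fun s _ => ?_
    simp only [Pi.neg_apply]
    exact intervalIntegral.integral_symm _ _
  · rw [Icc_eq_empty (not_le.2 hab)]; exact continuousOn_empty _

lemma hasDerivAt_integral_left {q : ℝ → ℝ} {a b s : ℝ} (hq : ContinuousOn q (Icc a b))
    (hs : s ∈ Ioo a b) : HasDerivAt (fun s => ∫ r in s..b, q r) (-q s) s := by
  have hn : Icc a b ∈ 𝓝 s := Icc_mem_nhds hs.1 hs.2
  refine intervalIntegral.integral_hasDerivAt_left ?_ ?_ (hq.continuousAt hn)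
  · exact (hq.mono (Icc_subset_Icc_left hs.1.le)).intervalIntegrable_of_Icc hs.2.le
  · exact (hq.mono Ioo_subset_Icc_self).stronglyMeasurableAtFilter isOpen_Ioo s hs

lemma eq_mul_exp_of_linear {f q : ℝ → ℝ} {a b : ℝ} (hq : ContinuousOn q (Icc a b))
    (hf : ∀ s ∈ Icc a b, HasDerivAt f (q s * f s) s) {s : ℝ} (hs : s ∈ Icc a b) :
    f s = f b * Real.exp (-∫ r in s..b, q r) := by
  set E : ℝ → ℝ := fun s => f s * Real.exp (∫ r in s..b, q r) with hE
  have hsub : Icc s b ⊆ Icc a b := Icc_subset_Icc_left hs.1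
  have hc : ContinuousOn E (Icc s b) := by
    refine ContinuousOn.mul (fun u hu => (hf u (hsub hu)).continuousAt.continuousWithinAt) ?_
    exact Real.continuous_exp.comp_continuousOn ((continuousOn_integral_left hq).mono hsub)
  have hd : ∀ u ∈ Ioo s b, HasDerivAt E 0 u := fun u hu => by
    have h1 := (hf u (hsub (Ioo_subset_Icc_self hu))).mul
      (hasDerivAt_integral_left hq ⟨hs.1.trans_lt hu.1, hu.2⟩).exp
    refine h1.congr_deriv ?_
    ring
  have h1 := le_of_hasDerivAt_nonneg hs.2 hc hd (fun _ _ => le_rfl)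
  have h2 := le_of_hasDerivAt_nonpos hs.2 hc hd (fun _ _ => le_rfl)
  have h3 : E s = f b := by
    have h4 : E b = f b := by simp [hE]
    linarith
  rw [← h3, hE]
  simp only [mul_assoc, ← Real.exp_add]
  simp

/-- The coefficient `L⁻¹ᐟ³` as a function of time. -/
structure Rate (m : ℝ → ℝ) : Prop where
  cont : Continuous m
  pos : ∀ t, 0 < m t

open Classical in
/-- The characteristic which at time `T` is at `x`. -/
def Z (m : ℝ → ℝ) (T x : ℝ) : ℝ → ℝ :=
  -- The fallback value only makes `Z` total; by `exists_traj` it does not occur for a `Rate`, `0 ≤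
  -- T` and `0 < x`.
  if h : ∃ z : ℝ → ℝ, z T = x ∧ IsTraj m T z then h.choose else fun _ => x

variable {m : ℝ → ℝ} {T T' x y s : ℝ}

lemma Z_spec (hm : Rate m) (hT : 0 ≤ T) (hx : 0 < x) : Z m T x T = x ∧ IsTraj m T (Z m T x) := by
  have h := exists_traj hm.cont hm.pos hT hx
  unfold Z
  rw [dif_pos h]
  exact h.choose_spec

lemma Z_end (hm : Rate m) (hT : 0 ≤ T) (hx : 0 < x) : Z m T x T = x := (Z_spec hm hT hx).1

lemma Z_pos (hm : Rate m) (hT : 0 ≤ T) (hx : 0 < x) (hs : s ∈ Icc 0 T) : 0 < Z m T x s :=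
  ((Z_spec hm hT hx).2 s hs).1

lemma Z_hasDerivAt_time (hm : Rate m) (hT : 0 ≤ T) (hx : 0 < x) (hs : s ∈ Icc 0 T) :
    HasDerivAt (Z m T x) (m s * cb (Z m T x s) - 1) s :=
  ((Z_spec hm hT hx).2 s hs).2

lemma Z_continuousOn (hm : Rate m) (hT : 0 ≤ T) (hx : 0 < x) :
    ContinuousOn (Z m T x) (Icc 0 T) :=
  fun _ hs => (Z_hasDerivAt_time hm hT hx hs).continuousAt.continuousWithinAt

lemma IsTraj.continuousOn {z : ℝ → ℝ} (hz : IsTraj m T z) : ContinuousOn z (Icc 0 T) :=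
  fun s hs => (hz s hs).2.continuousAt.continuousWithinAt

lemma IsTraj.continuousOn_slope (hm : Rate m) {z₁ z₂ : ℝ → ℝ} (h₁ : IsTraj m T z₁)
    (h₂ : IsTraj m T z₂) :
    ContinuousOn (fun r => m r * cbSlope (z₁ r) (z₂ r)) (Icc 0 T) := by
  refine hm.cont.continuousOn.mul fun r hr => ?_
  exact ContinuousAt.comp_continuousWithinAt (f := fun r => (z₁ r, z₂ r))
    (g := fun p : ℝ × ℝ => cbSlope p.1 p.2) (continuousAt_cbSlope (h₁ r hr).1 (h₂ r hr).1) ((h₁.continuousOn r hr).prodMk (h₂.continuousOn r hr))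

lemma IsTraj.sub_eq (hm : Rate m) {z₁ z₂ : ℝ → ℝ} (h₁ : IsTraj m T z₁) (h₂ : IsTraj m T z₂)
    (hs : s ∈ Icc 0 T) :
    z₁ s - z₂ s = (z₁ T - z₂ T) * Real.exp (-∫ r in s..T, m r * cbSlope (z₁ r) (z₂ r)) := by
  refine eq_mul_exp_of_linear (f := fun s => z₁ s - z₂ s) (h₁.continuousOn_slope hm h₂)
    (fun u hu => ?_) hs
  refine ((h₁ u hu).2.sub (h₂ u hu).2).congr_deriv ?_
  have := cb_sub (h₁ u hu).1 (h₂ u hu).1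
  linear_combination m u * this

/-- Order preservation, non-expansion backward in time and the space derivative of the flow are all
read off from this formula. -/
lemma Z_sub (hm : Rate m) (hT : 0 ≤ T) (hx : 0 < x) (hy : 0 < y) (hs : s ∈ Icc 0 T) :
    Z m T y s - Z m T x s
      = (y - x) * Real.exp (-∫ r in s..T, m r * cbSlope (Z m T y r) (Z m T x r)) := by
  have := (Z_spec hm hT hy).2.sub_eq hm (Z_spec hm hT hx).2 hs
  rwa [Z_end hm hT hx, Z_end hm hT hy] at this

lemma Z_lt (hm : Rate m) (hT : 0 ≤ T) (hx : 0 < x) (hxy : x < y) (hs : s ∈ Icc 0 T) :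
    Z m T x s < Z m T y s := by
  have := Z_sub hm hT hx (hx.trans hxy) hs
  have h2 : 0 < (y - x) * Real.exp (-∫ r in s..T, m r * cbSlope (Z m T y r) (Z m T x r)) :=
    mul_pos (sub_pos.2 hxy) (Real.exp_pos _)
  linarith

lemma Z_le (hm : Rate m) (hT : 0 ≤ T) (hx : 0 < x) (hxy : x ≤ y) (hs : s ∈ Icc 0 T) :
    Z m T x s ≤ Z m T y s := by
  rcases hxy.eq_or_lt with rfl | h
  · exact le_rfl
  · exact (Z_lt hm hT hx h hs).le

lemma abs_Z_sub_le (hm : Rate m) (hT : 0 ≤ T) (hx : 0 < x) (hy : 0 < y) (hs : s ∈ Icc 0 T) :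
    |Z m T y s - Z m T x s| ≤ |y - x| := by
  rw [Z_sub hm hT hx hy hs, abs_mul, abs_of_pos (Real.exp_pos _)]
  refine mul_le_of_le_one_right (abs_nonneg _) (Real.exp_le_one_iff.2 (neg_nonpos.2 ?_))
  refine intervalIntegral.integral_nonneg hs.2 fun r hr => ?_
  have hr' : r ∈ Icc 0 T := ⟨hs.1.trans hr.1, hr.2⟩
  exact mul_nonneg (hm.pos r).le
    (cbSlope_pos (Z_pos hm hT hy hr') (Z_pos hm hT hx hr')).le

lemma Z_restrict (hm : Rate m) (hT' : 0 ≤ T') (hTT : T' ≤ T) (hx : 0 < x) (hs : s ∈ Icc 0 T') :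
    Z m T' (Z m T x T') s = Z m T x s := by
  have hT : 0 ≤ T := hT'.trans hTT
  have hp : 0 < Z m T x T' := Z_pos hm hT hx ⟨hT', hTT⟩
  have h1 : IsTraj m T' (Z m T x) := fun u hu => (Z_spec hm hT hx).2 u ⟨hu.1, hu.2.trans hTT⟩
  have := (Z_spec hm hT' hp).2.sub_eq hm h1 hs
  rw [Z_end hm hT' hp, sub_self, zero_mul] at this
  linarith

/-- The derivative in space of the speed of the characteristics. -/
def speedDeriv (m : ℝ → ℝ) (s x : ℝ) : ℝ := m s * (1 / (3 * cb x ^ 2))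

lemma speedDeriv_pos (hm : Rate m) (hx : 0 < x) : 0 < speedDeriv m s x := by
  have := cb_pos hx
  have := hm.pos s
  unfold speedDeriv
  positivity

lemma speedDeriv_anti (hm : Rate m) (hx : 0 < x) (hxy : x ≤ y) :
    speedDeriv m s y ≤ speedDeriv m s x := by
  have h0 := cb_pos hx
  have h1 := cb_le hx.le hxy
  unfold speedDeriv
  refine mul_le_mul_of_nonneg_left ?_ (hm.pos s).le
  apply one_div_le_one_div_of_le (by positivity)
  have := pow_le_pow_left₀ h0.le h1 2
  linarith

lemma speedDeriv_continuousOn (hm : Rate m) {z : ℝ → ℝ} {a b : ℝ} (hz : ContinuousOn z (Icc a b))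
    (hp : ∀ s ∈ Icc a b, 0 < z s) : ContinuousOn (fun r => speedDeriv m r (z r)) (Icc a b) := by
  unfold speedDeriv
  refine hm.cont.continuousOn.mul (continuousOn_const.div ?_ ?_)
  · exact continuousOn_const.mul ((continuous_cb.comp_continuousOn hz).pow 2)
  · intro s hs
    have := cb_pos (hp s hs)
    positivity

lemma speedDeriv_Z_continuousOn (hm : Rate m) (hT : 0 ≤ T) (hx : 0 < x) :
    ContinuousOn (fun r => speedDeriv m r (Z m T x r)) (Icc 0 T) :=
  speedDeriv_continuousOn hm (Z_continuousOn hm hT hx) fun _ hs => Z_pos hm hT hx hs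

/-- The derivative of `Z m T x s` in `x`. -/
def J (m : ℝ → ℝ) (T x s : ℝ) : ℝ := Real.exp (-∫ r in s..T, speedDeriv m r (Z m T x r))

lemma J_pos : 0 < J m T x s := Real.exp_pos _

lemma J_end : J m T x T = 1 := by simp [J]

lemma J_le_one (hm : Rate m) (hT : 0 ≤ T) (hx : 0 < x) (hs : s ∈ Icc 0 T) : J m T x s ≤ 1 := by
  refine Real.exp_le_one_iff.2 (neg_nonpos.2 ?_)
  refine intervalIntegral.integral_nonneg hs.2 fun r hr => ?_
  exact (speedDeriv_pos hm (Z_pos hm hT hx ⟨hs.1.trans hr.1, hr.2⟩)).le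

lemma J_continuousOn (hm : Rate m) (hT : 0 ≤ T) (hx : 0 < x) :
    ContinuousOn (J m T x) (Icc 0 T) := by
  unfold J
  exact Real.continuous_exp.comp_continuousOn
    (continuousOn_integral_left (speedDeriv_Z_continuousOn hm hT hx)).neg

lemma J_hasDerivAt (hm : Rate m) (hT : 0 ≤ T) (hx : 0 < x) (hs : s ∈ Ioo 0 T) :
    HasDerivAt (J m T x) (J m T x s * speedDeriv m s (Z m T x s)) s := by
  have := (hasDerivAt_integral_left (speedDeriv_Z_continuousOn hm hT hx) hs).neg.exp
  rw [neg_neg] at this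
  exact this

lemma J_cocycle (hm : Rate m) (hT' : 0 ≤ T') (hTT : T' ≤ T) (hx : 0 < x) (hs : s ∈ Icc 0 T') :
    J m T x s = J m T' (Z m T x T') s * J m T x T' := by
  have hT : 0 ≤ T := hT'.trans hTT
  have hc := speedDeriv_Z_continuousOn hm hT hx
  unfold J
  rw [← Real.exp_add, ← neg_add]
  congr 2
  rw [← intervalIntegral.integral_add_adjacent_intervals (b := T')]
  · congr 1
    refine intervalIntegral.integral_congr fun r hr => ?_
    rw [uIcc_of_le hs.2] at hr
    rw [Z_restrict hm hT' hTT hx ⟨hs.1.trans hr.1, hr.2⟩]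
  · exact (hc.mono (Icc_subset_Icc hs.1 hTT)).intervalIntegrable_of_Icc hs.2
  · exact (hc.mono (Icc_subset_Icc hT' le_rfl)).intervalIntegrable_of_Icc hTT

lemma cbSlope_anti {u v u' : ℝ} (hu : 0 < u) (hv : 0 < v) (h : u ≤ u') :
    cbSlope u' v ≤ cbSlope u v := by
  have h1 := cb_pos hu
  have h2 := cb_pos hv
  have h3 := cb_le hu.le h
  unfold cbSlope
  apply one_div_le_one_div_of_le (by positivity)
  have := pow_le_pow_left₀ h1.le h3 2
  nlinarith

/-- Moving one argument of `cbSlope` up decreases it, so replacing the upper characteristic by the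
lower one only strengthens the contraction. -/
lemma Z_sub_ge (hm : Rate m) (hT : 0 ≤ T) (hx : 0 < x) (hxy : x ≤ y) (hs : s ∈ Icc 0 T) :
    (y - x) * J m T x s ≤ Z m T y s - Z m T x s := by
  have hy := hx.trans_le hxy
  rw [Z_sub hm hT hx hy hs]
  refine mul_le_mul_of_nonneg_left (Real.exp_le_exp.2 (neg_le_neg ?_)) (sub_nonneg.2 hxy)
  have hsub : Icc s T ⊆ Icc 0 T := Icc_subset_Icc_left hs.1
  refine intervalIntegral.integral_mono_on hs.2 ?_ ?_ fun r hr => ?_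
  · exact (((Z_spec hm hT hy).2.continuousOn_slope hm (Z_spec hm hT hx).2).mono
      hsub).intervalIntegrable_of_Icc hs.2
  · exact ((speedDeriv_Z_continuousOn hm hT hx).mono hsub).intervalIntegrable_of_Icc hs.2
  · have hr' := hsub hr
    unfold speedDeriv
    refine mul_le_mul_of_nonneg_left ?_ (hm.pos r).le
    rw [← cbSlope_self]
    exact cbSlope_anti (Z_pos hm hT hx hr') (Z_pos hm hT hx hr') (Z_le hm hT hx hxy hr')

lemma Z_continuousAt_space (hm : Rate m) (hT : 0 ≤ T) (hx : 0 < x) (hs : s ∈ Icc 0 T) :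
    ContinuousAt (fun y => Z m T y s) x := by
  rw [ContinuousAt, tendsto_iff_norm_sub_tendsto_zero]
  refine squeeze_zero' (g := fun y => |y - x|) (Eventually.of_forall fun y => norm_nonneg _) ?_ ?_
  · filter_upwards [lt_mem_nhds hx] with y hy
    exact abs_Z_sub_le hm hT hx hy hs
  · have : ContinuousAt (fun y : ℝ => |y - x|) x := by fun_prop
    simpa [ContinuousAt] using this

lemma exists_Z_lower (hm : Rate m) (hT : 0 ≤ T) (hx : 0 < x) :
    ∃ μ, 0 < μ ∧ ∀ s ∈ Icc 0 T, ∀ y, x ≤ y → μ ≤ Z m T y s := by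
  obtain ⟨u, hu, hmin⟩ := (isCompact_Icc (a := (0 : ℝ)) (b := T)).exists_isMinOn
    (nonempty_Icc.2 hT) (Z_continuousOn hm hT hx)
  exact ⟨Z m T x u, Z_pos hm hT hx hu, fun s hs y hy =>
    (hmin hs).trans (Z_le hm hT hx hy hs)⟩

lemma exists_rate_upper (hm : Rate m) (T : ℝ) : ∃ M, 0 < M ∧ ∀ s ∈ Icc 0 T, m s ≤ M := by
  obtain ⟨M, hM⟩ := (isCompact_Icc (a := (0 : ℝ)) (b := T)).bddAbove_image hm.cont.continuousOn
  exact ⟨max M 1, by positivity, fun s hs => (hM (mem_image_of_mem _ hs)).trans (le_max_left _ _)⟩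

/-- By `Z_sub` the difference quotient is an exponential of an integral, whose limit follows by
dominated convergence; `exists_Z_lower` keeps the integrand bounded. -/
lemma Z_hasDerivAt_space (hm : Rate m) (hT : 0 ≤ T) (hx : 0 < x) (hs : s ∈ Icc 0 T) :
    HasDerivAt (fun y => Z m T y s) (J m T x s) x := by
  rw [hasDerivAt_iff_tendsto_slope]
  set F : ℝ → ℝ → ℝ := fun y r => m r * cbSlope (Z m T y r) (Z m T x r) with hF
  have hcont : ContinuousAt (fun y => ∫ r in s..T, F y r) x := by
    obtain ⟨μ, hμ, hμ'⟩ := exists_Z_lower hm hT (half_pos hx)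
    obtain ⟨M, hM, hM'⟩ := exists_rate_upper hm T
    have hev : ∀ᶠ y in 𝓝 x, x / 2 < y := lt_mem_nhds (half_lt_self hx)
    refine intervalIntegral.continuousAt_of_dominated_interval
      (bound := fun _ => M * (1 / (3 * cb μ ^ 2))) ?_ ?_ ?_ ?_
    · filter_upwards [hev] with y hy
      have hy0 : 0 < y := (half_pos hx).trans hy
      rw [uIoc_of_le hs.2]
      refine ContinuousOn.aestronglyMeasurable ?_ measurableSet_Ioc
      exact ((Z_spec hm hT hy0).2.continuousOn_slope hm (Z_spec hm hT hx).2).mono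
        (Ioc_subset_Icc_self.trans (Icc_subset_Icc_left hs.1))
    · filter_upwards [hev] with y hy
      refine ae_of_all _ fun r hr => ?_
      rw [uIoc_of_le hs.2] at hr
      have hr' : r ∈ Icc 0 T := ⟨hs.1.trans hr.1.le, hr.2⟩
      have h1 := hμ' r hr' y hy.le
      have h2 := hμ' r hr' x (half_le_self hx.le)
      have h3 := cbSlope_pos (hμ.trans_le h1) (hμ.trans_le h2)
      rw [hF, Real.norm_eq_abs, abs_of_nonneg (mul_nonneg (hm.pos r).le h3.le)]
      exact mul_le_mul (hM' r hr') (cbSlope_le hμ h1 h2) h3.le hM.le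
    · exact intervalIntegrable_const
    · refine ae_of_all _ fun r hr => ?_
      rw [uIoc_of_le hs.2] at hr
      have hr' : r ∈ Icc 0 T := ⟨hs.1.trans hr.1.le, hr.2⟩
      have hp := Z_pos hm hT hx hr'
      refine continuousAt_const.mul ?_
      exact ContinuousAt.comp (f := fun y => (Z m T y r, Z m T x r))
        (g := fun p : ℝ × ℝ => cbSlope p.1 p.2) (continuousAt_cbSlope hp hp)
        ((Z_continuousAt_space hm hT hx hr').prodMk continuousAt_const)
  have hlim : Tendsto (fun y => Real.exp (-∫ r in s..T, F y r)) (𝓝[≠] x) (𝓝 (J m T x s)) := by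
    have h1 : ContinuousAt (fun y => Real.exp (-∫ r in s..T, F y r)) x :=
      Real.continuous_exp.continuousAt.comp hcont.neg
    have h2 : Real.exp (-∫ r in s..T, F x r) = J m T x s := by
      simp only [hF, cbSlope_self]; rfl
    rw [← h2]
    exact h1.tendsto.mono_left nhdsWithin_le_nhds
  refine hlim.congr' ?_
  filter_upwards [self_mem_nhdsWithin, nhdsWithin_le_nhds (lt_mem_nhds hx)] with y hne hy
  rw [slope_def_field, Z_sub hm hT hx hy hs]
  have : y - x ≠ 0 := sub_ne_zero.2 hne
  field_simp
  rfl

/-- Surjectivity comes from the linear lower bound `Z_sub_ge` and the intermediate value theorem. It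
makes the change of variables between two times exact. -/
lemma Z_image (hm : Rate m) (hT : 0 ≤ T) (hx : 0 < x) (hs : s ∈ Icc 0 T) :
    (fun y => Z m T y s) '' Ioi x = Ioi (Z m T x s) := by
  refine Subset.antisymm ?_ fun a ha => ?_
  · rintro _ ⟨y, hy, rfl⟩
    exact Z_lt hm hT hx hy hs
  · set d := (a - Z m T x s) / J m T x s with hd
    have ha' : 0 < a - Z m T x s := sub_pos.2 ha
    have hd0 : 0 < d := div_pos ha' J_pos
    have h1 := Z_sub_ge hm hT hx (y := x + d) (by linarith) hs
    have h2 : (x + d - x) * J m T x s = a - Z m T x s := by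
      rw [hd, add_sub_cancel_left, div_mul_cancel₀ _ J_pos.ne']
    have h3 : a ∈ Icc (Z m T x s) (Z m T (x + d) s) := ⟨by linarith, by linarith⟩
    obtain ⟨y, hy, hya⟩ := intermediate_value_Icc (f := fun y => Z m T y s)
      (by linarith : x ≤ x + d) (fun y hy =>
        (Z_continuousAt_space hm hT (hx.trans_le hy.1) hs).continuousWithinAt) h3
    refine ⟨y, lt_of_le_of_ne hy.1 ?_, hya⟩
    rintro rfl
    exact (ne_of_gt ha) hya.symm

lemma Z_le_add (hm : Rate m) (hT : 0 ≤ T) (hx : 0 < x) (hs : s ∈ Icc 0 T) :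
    Z m T x s ≤ x + (T - s) := by
  have hsub : Icc s T ⊆ Icc 0 T := Icc_subset_Icc_left hs.1
  have := le_of_hasDerivAt_nonneg (f := fun u => Z m T x u + u)
    (f' := fun u => m u * cb (Z m T x u) - 1 + 1) hs.2
    (((Z_continuousOn hm hT hx).mono hsub).add continuousOn_id)
    (fun u hu => (Z_hasDerivAt_time hm hT hx (hsub (Ioo_subset_Icc_self hu))).add (hasDerivAt_id u))
    (fun u hu => by
      have := mul_pos (hm.pos u) (cb_pos (Z_pos hm hT hx (hsub (Ioo_subset_Icc_self hu))))
      linarith)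
  simp only [Z_end hm hT hx] at this
  linarith

lemma J_mono (hm : Rate m) (hT : 0 ≤ T) (hx : 0 < x) (hxy : x ≤ y) (hs : s ∈ Icc 0 T) :
    J m T x s ≤ J m T y s := by
  have hsub : Icc s T ⊆ Icc 0 T := Icc_subset_Icc_left hs.1
  have hy := hx.trans_le hxy
  refine Real.exp_le_exp.2 (neg_le_neg ?_)
  refine intervalIntegral.integral_mono_on hs.2
    (((speedDeriv_Z_continuousOn hm hT hy).mono hsub).intervalIntegrable_of_Icc hs.2)
    (((speedDeriv_Z_continuousOn hm hT hx).mono hsub).intervalIntegrable_of_Icc hs.2)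
    fun r hr => speedDeriv_anti hm (Z_pos hm hT hx (hsub hr)) (Z_le hm hT hx hxy (hsub hr))

end

section

/-! ### Tails of functions in `E` -/

section Tail

variable {u : ℝ → ℝ} {x y : ℝ}

lemma MemE.integrableOn_Ioi (hu : MemE u) (hx : 0 ≤ x) : IntegrableOn u (Ioi x) :=
  hu.integrable.mono_set (Ioi_subset_Ioi hx)

lemma tail_nonneg (hu : MemE u) (hx : 0 ≤ x) : 0 ≤ tail u x :=
  setIntegral_nonneg measurableSet_Ioi fun y hy => hu.nonneg y (hx.trans (le_of_lt hy))

lemma tail_sub (hu : MemE u) (hx : 0 ≤ x) (hxy : x ≤ y) :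
    tail u x - tail u y = ∫ z in x..y, u z := by
  rw [intervalIntegral.integral_of_le hxy]
  have h := setIntegral_union (μ := volume) (f := u) (Ioc_disjoint_Ioi le_rfl) measurableSet_Ioi
    ((hu.integrableOn_Ioi hx).mono_set (fun z hz => hz.1))
    (hu.integrableOn_Ioi (hx.trans hxy))
  rw [Ioc_union_Ioi_eq_Ioi hxy] at h
  unfold tail
  linarith

lemma MemE.intervalIntegrable (hu : MemE u) (hx : 0 ≤ x) (hxy : x ≤ y) :
    IntervalIntegrable u volume x y := by
  rw [intervalIntegrable_iff_integrableOn_Ioc_of_le hxy]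
  exact (hu.integrableOn_Ioi hx).mono_set Ioc_subset_Ioi_self

lemma tail_anti (hu : MemE u) (hx : 0 ≤ x) (hxy : x ≤ y) : tail u y ≤ tail u x := by
  have h := tail_sub hu hx hxy
  have : 0 ≤ ∫ z in x..y, u z :=
    intervalIntegral.integral_nonneg hxy fun z hz => hu.nonneg z (hx.trans hz.1)
  linarith

lemma mul_le_tail_sub (hu : MemE u) (hx : 0 ≤ x) (hxy : x ≤ y) :
    (y - x) * u y ≤ tail u x - tail u y := by
  rw [tail_sub hu hx hxy]
  have h := intervalIntegral.integral_mono_on (f := fun _ => u y) (g := u) hxy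
    intervalIntegrable_const (hu.intervalIntegrable hx hxy)
    (fun z hz => hu.antitone (hx.trans hz.1) (hx.trans hxy) hz.2)
  simpa using h

lemma tail_sub_le_mul (hu : MemE u) (hx : 0 ≤ x) (hxy : x ≤ y) :
    tail u x - tail u y ≤ (y - x) * u x := by
  rw [tail_sub hu hx hxy]
  have h := intervalIntegral.integral_mono_on (f := u) (g := fun _ => u x) hxy
    (hu.intervalIntegrable hx hxy) intervalIntegrable_const
    (fun z hz => hu.antitone hx (hx.trans hz.1) hz.1)
  simpa using h

lemma mul_le_tail_zero (hu : MemE u) (hx : 0 ≤ x) : x * u x ≤ tail u 0 := by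
  have h1 := mul_le_tail_sub hu le_rfl hx
  have h2 := tail_nonneg hu hx
  linarith

lemma tendsto_tail_atTop (hu : MemE u) : Tendsto (tail u) atTop (𝓝 0) := by
  have h := intervalIntegral_tendsto_integral_Ioi 0 hu.integrable tendsto_id
  have h2 : Tendsto (fun y => tail u 0 - ∫ z in (0 : ℝ)..y, u z) atTop (𝓝 0) := by
    have := (tendsto_const_nhds (x := tail u 0)).sub h
    simpa [tail] using this
  refine h2.congr' ?_
  filter_upwards [eventually_ge_atTop 0] with y hy
  rw [← tail_sub hu le_rfl hy]
  ring

lemma tendsto_mul_atTop (hu : MemE u) : Tendsto (fun x => x * u x) atTop (𝓝 0) := by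
  have h1 : Tendsto (fun x : ℝ => 2 * tail u (x / 2)) atTop (𝓝 0) := by
    have := ((tendsto_tail_atTop hu).comp (tendsto_id.atTop_div_const (zero_lt_two' ℝ))).const_mul 2
    simpa using this
  refine squeeze_zero' ?_ ?_ h1
  · filter_upwards [eventually_ge_atTop 0] with x hx
    exact mul_nonneg hx (hu.nonneg x hx)
  · filter_upwards [eventually_ge_atTop 0] with x hx
    have h2 := mul_le_tail_sub hu (by linarith : 0 ≤ x / 2) (by linarith : x / 2 ≤ x)
    have h3 := tail_nonneg hu hx
    linarith

lemma hasDerivAt_tail (hu : MemE u) (hc : ContinuousOn u (Ici 0)) (hx : 0 < x) :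
    HasDerivAt (tail u) (-u x) x := by
  have h1 : HasDerivAt (fun y => tail u 0 - ∫ z in (0 : ℝ)..y, u z) (-u x) x := by
    refine (intervalIntegral.integral_hasDerivAt_right (hu.intervalIntegrable le_rfl hx.le) ?_
      (hc.continuousAt (Ici_mem_nhds hx))).const_sub _
    exact (hc.mono Ioi_subset_Ici_self).stronglyMeasurableAtFilter isOpen_Ioi x hx
  refine h1.congr_of_eventuallyEq ?_
  filter_upwards [lt_mem_nhds hx] with y hy
  rw [← tail_sub hu le_rfl hy.le]
  ring

lemma continuousOn_tail (hu : MemE u) : ContinuousOn (tail u) (Ici 0) := by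
  have key : ∀ a b, 0 ≤ a → a ≤ b → |tail u a - tail u b| ≤ u 0 * |a - b| := by
    intro a b ha hab
    rw [abs_of_nonneg (sub_nonneg.2 (tail_anti hu ha hab)), abs_sub_comm,
      abs_of_nonneg (sub_nonneg.2 hab)]
    have h1 := tail_sub_le_mul hu ha hab
    have h2 := hu.antitone (mem_Ici.2 le_rfl) (mem_Ici.2 ha) ha
    nlinarith
  have : LipschitzOnWith (Real.toNNReal (u 0)) (tail u) (Ici 0) := by
    refine LipschitzOnWith.of_dist_le_mul fun a ha b hb => ?_
    rw [Real.dist_eq, Real.dist_eq, Real.coe_toNNReal _ (hu.nonneg 0 le_rfl)]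
    rcases le_total a b with h | h
    · exact key a b ha h
    · rw [abs_sub_comm, abs_sub_comm a b]; exact key b a hb h
  exact this.continuousOn

lemma exists_gt_pos (hc : ContinuousOn u (Ici 0)) (hx : 0 ≤ x) (h : 0 < u x) :
    ∃ y, x < y ∧ 0 < u y := by
  have h1 : ContinuousWithinAt u (Ioi x) x :=
    (hc x hx).mono (Ioi_subset_Ici_self.trans (Ici_subset_Ici.2 hx))
  obtain ⟨y, hy, hy'⟩ := ((h1.eventually (lt_mem_nhds h)).and self_mem_nhdsWithin).exists
  exact ⟨y, hy', hy⟩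

lemma tail_pos (hu : MemE u) (hc : ContinuousOn u (Ici 0)) (hx : 0 ≤ x) (h : 0 < u x) :
    0 < tail u x := by
  obtain ⟨y, hy, hy'⟩ := exists_gt_pos hc hx h
  have h1 := mul_le_tail_sub hu hx hy.le
  have h2 := tail_nonneg hu (hx.trans hy.le)
  have h3 := mul_pos (sub_pos.2 hy) hy'
  linarith

lemma pos_of_tail_pos (hu : MemE u) (hx : 0 ≤ x) (h : 0 < tail u x) : 0 < u x := by
  by_contra! hle
  have h0 : ∀ y ∈ Ioi x, u y = 0 := fun y hy => le_antisymm
    ((hu.antitone hx (hx.trans (le_of_lt hy)) (le_of_lt hy)).trans hle)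
    (hu.nonneg y (hx.trans (le_of_lt hy)))
  have : tail u x = 0 := setIntegral_eq_zero_of_forall_eq_zero h0
  linarith

end Tail

/-- The differential equation is known only where `w > 0`. A continuity argument suffices: as long
as `f` keeps its positive initial value, it is positive and hence constant a little further. -/
lemma eq_of_deriv_zero_of_pos {f : ℝ → ℝ} {a b : ℝ} (hf : ContinuousOn f (Icc a b))
    (hd : ∀ s ∈ Ioo a b, 0 < f s → HasDerivAt f 0 s) (ha : 0 < f a) :
    ∀ s ∈ Icc a b, f s = f a := by
  have hcl : IsClosed ({s | f s = f a} ∩ Icc a b) := by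
    rw [inter_comm]
    exact hf.preimage_isClosed_of_isClosed isClosed_Icc isClosed_singleton
  refine hcl.Icc_subset_of_forall_exists_gt rfl ?_
  rintro x ⟨hx, hxab⟩ y hy
  have h1 : ContinuousWithinAt f (Icc x b) x :=
    (hf x ⟨hxab.1, hxab.2.le⟩).mono (Icc_subset_Icc_left hxab.1)
  have h2 : ∀ᶠ s in 𝓝[>] x, 0 < f s := by
    have : ∀ᶠ s in 𝓝[Icc x b] x, 0 < f s := h1.eventually (lt_mem_nhds (by rw [hx]; exact ha))
    exact nhdsWithin_le_of_mem (Icc_mem_nhdsGT hxab.2) this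
  obtain ⟨c, hc, hc'⟩ := (mem_nhdsGT_iff_exists_Ioo_subset' hxab.2).1 h2
  set d := min ((x + c) / 2) (min b y) with hdd
  have hxc : x < c := hc
  have hdx : x < d := lt_min (by linarith) (lt_min hxab.2 hy)
  have hdc : d < c := (min_le_left _ _).trans_lt (by linarith)
  have hdb : d ≤ b := (min_le_right _ _).trans (min_le_left _ _)
  have hdy : d ≤ y := (min_le_right _ _).trans (min_le_right _ _)
  have hcont : ContinuousOn f (Icc x d) := hf.mono (Icc_subset_Icc hxab.1 hdb)
  have hder : ∀ s ∈ Ioo x d, HasDerivAt f 0 s := fun s hs =>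
    hd s ⟨hxab.1.trans_lt hs.1, hs.2.trans_le hdb⟩ (hc' ⟨hs.1, hs.2.trans hdc⟩)
  have e1 := le_of_hasDerivAt_nonneg hdx.le hcont hder (fun _ _ => le_rfl)
  have e2 := le_of_hasDerivAt_nonpos hdx.le hcont hder (fun _ _ => le_rfl)
  exact ⟨d, (le_antisymm e2 e1).trans hx, hdx, hdy⟩

/-! ### The transport equation -/

/-- Solutions of the LSW system, with `m = L⁻¹ᐟ³`. -/
structure Sys (w : ℝ → ℝ → ℝ) (m : ℝ → ℝ) : Prop where
  rate : Rate m
  cont : ContinuousOn (fun p : ℝ × ℝ => w p.1 p.2) (Ici 0 ×ˢ Ici 0)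
  memE : ∀ t, 0 ≤ t → MemE (fun x => w x t)
  mass : ∀ t, 0 ≤ t → ∫ x in Ioi (0 : ℝ), w x t = 1
  m_eq : ∀ t, 0 ≤ t → m t * ∫ x in Ioi (0 : ℝ), x ^ (-(2 / 3) : ℝ) * w x t = 3 * w 0 t
  diff : ∀ x t, 0 < x → 0 < t → 0 < w x t →
    DifferentiableAt ℝ (fun p : ℝ × ℝ => w p.1 p.2) (x, t)
  eqn : ∀ x t, 0 < x → 0 < t → 0 < w x t →
    deriv (fun s => w x s) t = (1 - m t * cb x) * deriv (fun z => w z t) x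

variable {w : ℝ → ℝ → ℝ} {m : ℝ → ℝ} {T x y s t : ℝ}

lemma Sys.cont_space (S : Sys w m) (ht : 0 ≤ t) : ContinuousOn (fun x => w x t) (Ici 0) :=
  S.cont.comp (f := fun x => (x, t)) (by fun_prop) fun _ hx => ⟨hx, ht⟩

lemma Sys.cont_time (S : Sys w m) (hx : 0 ≤ x) : ContinuousOn (fun t => w x t) (Ici 0) :=
  S.cont.comp (f := fun t => (x, t)) (by fun_prop) fun _ ht => ⟨hx, ht⟩

lemma Sys.nonneg (S : Sys w m) (hx : 0 ≤ x) (ht : 0 ≤ t) : 0 ≤ w x t := (S.memE t ht).nonneg x hx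

lemma Sys.anti (S : Sys w m) (hx : 0 ≤ x) (hxy : x ≤ y) (ht : 0 ≤ t) : w y t ≤ w x t :=
  (S.memE t ht).antitone hx (hx.trans hxy) hxy

lemma Sys.hasDerivAt_traj (S : Sys w m) {z : ℝ → ℝ} (hz : IsTraj m T z) (hs : s ∈ Ioo 0 T)
    (hp : 0 < w (z s) s) : HasDerivAt (fun s => w (z s) s) 0 s := by
  obtain ⟨hz0, hzd⟩ := hz s (Ioo_subset_Icc_self hs)
  have hD := (S.diff _ _ hz0 hs.1 hp).hasFDerivAt
  set D := fderiv ℝ (fun p : ℝ × ℝ => w p.1 p.2) (z s, s) with hDdef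
  have h1 : HasDerivAt (fun s => w (z s) s) (D (m s * cb (z s) - 1, 1)) s :=
    HasFDerivAt.comp_hasDerivAt (f := fun s => (z s, s)) (l := fun p : ℝ × ℝ => w p.1 p.2) s hD
      (hzd.prodMk (hasDerivAt_id s))
  have h2 : HasDerivAt (fun a => w a s) (D (1, 0)) (z s) :=
    HasFDerivAt.comp_hasDerivAt (f := fun a => (a, s)) (l := fun p : ℝ × ℝ => w p.1 p.2) (z s) hD
      ((hasDerivAt_id (z s)).prodMk (hasDerivAt_const _ _))
  have h3 : HasDerivAt (fun r => w (z s) r) (D (0, 1)) s :=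
    HasFDerivAt.comp_hasDerivAt (f := fun r => (z s, r)) (l := fun p : ℝ × ℝ => w p.1 p.2) s hD
      ((hasDerivAt_const _ _).prodMk (hasDerivAt_id s))
  have h4 := S.eqn _ _ hz0 hs.1 hp
  rw [h2.deriv, h3.deriv] at h4
  have h5 : D (m s * cb (z s) - 1, 1) = 0 := by
    have e : ((m s * cb (z s) - 1, 1) : ℝ × ℝ) = (m s * cb (z s) - 1) • ((1, 0) : ℝ × ℝ) + (0, 1) := by
      ext <;> simp
    rw [e, map_add, map_smul, h4, smul_eq_mul]
    ring
  rwa [h5] at h1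

/-- Positivity at either time propagates to the other one, forward directly and backward after
reversing time; otherwise both values are zero. -/
lemma Sys.traj_const (S : Sys w m) {z : ℝ → ℝ} (hz : IsTraj m T z) (hs : s ∈ Icc 0 T) :
    w (z s) s = w (z T) T := by
  set f : ℝ → ℝ := fun s => w (z s) s with hf
  have hc : ContinuousOn f (Icc 0 T) :=
    S.cont.comp (f := fun s => (z s, s)) (hz.continuousOn.prodMk continuousOn_id)
      fun u hu => ⟨(hz u hu).1.le, hu.1⟩
  have hT : 0 ≤ T := hs.1.trans hs.2
  have fwd : 0 < f s → f T = f s := fun hp =>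
    eq_of_deriv_zero_of_pos (hc.mono (Icc_subset_Icc_left hs.1))
      (fun u hu hpu => S.hasDerivAt_traj hz ⟨hs.1.trans_lt hu.1, hu.2⟩ hpu) hp T
      (right_mem_Icc.2 hs.2)
  have bwd : 0 < f T → f s = f T := fun hp => by
    have hc' : ContinuousOn (fun r => f (-r)) (Icc (-T) (-s)) :=
      hc.comp continuousOn_neg fun r hr => ⟨by linarith [hr.2, hs.1], by linarith [hr.1]⟩
    have := eq_of_deriv_zero_of_pos hc'
      (fun u hu hpu => by
        have h1 : HasDerivAt f 0 (-u) :=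
          S.hasDerivAt_traj hz ⟨by linarith [hu.2, hs.1], by linarith [hu.1]⟩ hpu
        exact (HasDerivAt.comp u h1 (hasDerivAt_neg u)).congr_deriv (by simp)) (by simpa using hp) (-s)
      (right_mem_Icc.2 (by linarith [hs.2]))
    simpa using this
  have n1 : 0 ≤ f s := S.nonneg (hz s hs).1.le hs.1
  have n2 : 0 ≤ f T := S.nonneg (hz T (right_mem_Icc.2 hT)).1.le hT
  rcases n1.eq_or_lt with h | h
  · rcases n2.eq_or_lt with h' | h'
    · exact h.symm.trans h'
    · exact bwd h'
  · exact (fwd h).symm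

lemma Sys.w_Z (S : Sys w m) (hT : 0 ≤ T) (hx : 0 < x) (hs : s ∈ Icc 0 T) :
    w (Z m T x s) s = w x T := by
  have := S.traj_const (Z_spec S.rate hT hx).2 hs
  rwa [Z_end S.rate hT hx] at this

/-- The tail `h(x,t)`. -/
abbrev hh (w : ℝ → ℝ → ℝ) (t x : ℝ) : ℝ := tail (fun y => w y t) x

/-- The rate of change of `h` along a characteristic. -/
def hRate (w : ℝ → ℝ → ℝ) (m : ℝ → ℝ) (t x : ℝ) : ℝ :=
  ∫ y in Ioi x, speedDeriv m t y * w y t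

/-- Change of variables `a = Z m T y s`. The right-hand side depends on `s` only through the flow,
so it can be differentiated in time although `w` itself need not be differentiable everywhere. -/
lemma Sys.integral_Z (S : Sys w m) (hT : 0 ≤ T) (hx : 0 < x) (hs : s ∈ Icc 0 T) (φ : ℝ → ℝ) :
    ∫ a in Ioi (Z m T x s), φ a * w a s
      = ∫ y in Ioi x, φ (Z m T y s) * (J m T y s * w y T) := by
  rw [← Z_image S.rate hT hx hs, integral_image_eq_integral_abs_deriv_smul measurableSet_Ioi
    (f' := fun y => J m T y s)
    (fun y hy => (Z_hasDerivAt_space S.rate hT (hx.trans hy) hs).hasDerivWithinAt)]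
  · refine setIntegral_congr_fun measurableSet_Ioi fun y hy => ?_
    simp only [smul_eq_mul]
    rw [abs_of_pos J_pos, S.w_Z hT (hx.trans hy) hs]
    ring
  · intro a ha b hb hab
    simp only at hab
    by_contra hne
    rcases lt_or_gt_of_ne hne with h | h
    · exact absurd hab (Z_lt S.rate hT (hx.trans ha) h hs).ne
    · exact absurd hab (Z_lt S.rate hT (hx.trans hb) h hs).ne'

lemma Sys.hh_Z (S : Sys w m) (hT : 0 ≤ T) (hx : 0 < x) (hs : s ∈ Icc 0 T) :
    hh w s (Z m T x s) = ∫ y in Ioi x, J m T y s * w y T := by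
  have := S.integral_Z hT hx hs (fun _ => 1)
  simpa [hh, tail] using this

lemma Sys.measurable_Jw (S : Sys w m) (hT : 0 ≤ T) (hx : 0 < x) (hs : s ∈ Icc 0 T) :
    AEStronglyMeasurable (fun y => J m T y s * w y T) (volume.restrict (Ioi x)) := by
  refine AEStronglyMeasurable.mul ?_ ((S.memE T hT).integrableOn_Ioi hx.le).aestronglyMeasurable
  refine (aemeasurable_restrict_of_monotoneOn measurableSet_Ioi
    fun a ha b _ hab => ?_).aestronglyMeasurable
  exact J_mono S.rate hT (hx.trans ha) hab hs

lemma Sys.norm_Jw_le (S : Sys w m) (hT : 0 ≤ T) (hx : 0 < x) (hs : s ∈ Icc 0 T) :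
    ‖J m T x s * w x T‖ ≤ w x T := by
  have h1 := S.nonneg hx.le hT
  rw [Real.norm_eq_abs, abs_of_nonneg (mul_nonneg J_pos.le h1)]
  exact mul_le_of_le_one_left h1 (J_le_one S.rate hT hx hs)

lemma Sys.hh_Z_continuousOn (S : Sys w m) (hT : 0 ≤ T) (hx : 0 < x) :
    ContinuousOn (fun s => hh w s (Z m T x s)) (Icc 0 T) := by
  have : ContinuousOn (fun s => ∫ y in Ioi x, J m T y s * w y T) (Icc 0 T) := by
    refine continuousOn_of_dominated (bound := fun y => w y T)
      (fun s hs => S.measurable_Jw hT hx hs) (fun s hs => ?_)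
      ((S.memE T hT).integrableOn_Ioi hx.le) ?_
    · filter_upwards [ae_restrict_mem measurableSet_Ioi] with y hy
      exact S.norm_Jw_le hT (hx.trans hy) hs
    · filter_upwards [ae_restrict_mem measurableSet_Ioi] with y hy
      exact (J_continuousOn S.rate hT (hx.trans hy)).mul continuousOn_const
  exact this.congr fun s hs => S.hh_Z hT hx hs

/-- Differentiation under the integral in `Sys.hh_Z`, where only `J` depends on time; the result is
transported back by `Sys.integral_Z`. -/
lemma Sys.hh_Z_hasDerivAt (S : Sys w m) (hT : 0 ≤ T) (hx : 0 < x) (hs : s ∈ Ioo 0 T) :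
    HasDerivAt (fun s => hh w s (Z m T x s)) (hRate w m s (Z m T x s)) s := by
  obtain ⟨μ, hμ, hμ'⟩ := exists_Z_lower S.rate hT hx
  obtain ⟨M, hM, hM'⟩ := exists_rate_upper S.rate T
  have hs' := Ioo_subset_Icc_self hs
  have hcμ := cb_pos hμ
  have key := (hasDerivAt_integral_of_dominated_loc_of_deriv_le (μ := volume.restrict (Ioi x))
    (F := fun s y => J m T y s * w y T)
    (F' := fun s y => speedDeriv m s (Z m T y s) * (J m T y s * w y T))
    (bound := fun y => M * (1 / (3 * cb μ ^ 2)) * w y T) (Ioo_mem_nhds hs.1 hs.2) ?_ ?_ ?_ ?_ ?_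
    ?_).2
  · rw [← S.integral_Z hT hx hs'] at key
    refine key.congr_of_eventuallyEq ?_
    filter_upwards [Ioo_mem_nhds hs.1 hs.2] with r hr
    exact S.hh_Z hT hx (Ioo_subset_Icc_self hr)
  · filter_upwards [Ioo_mem_nhds hs.1 hs.2] with r hr
    exact S.measurable_Jw hT hx (Ioo_subset_Icc_self hr)
  · refine Integrable.mono' ((S.memE T hT).integrableOn_Ioi hx.le) (S.measurable_Jw hT hx hs') ?_
    filter_upwards [ae_restrict_mem measurableSet_Ioi] with y hy
    exact S.norm_Jw_le hT (hx.trans hy) hs'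
  · refine AEStronglyMeasurable.mul ?_ (S.measurable_Jw hT hx hs')
    refine (aemeasurable_restrict_of_antitoneOn measurableSet_Ioi
      fun a ha b _ hab => ?_).aestronglyMeasurable
    exact speedDeriv_anti S.rate (Z_pos S.rate hT (hx.trans ha) hs')
      (Z_le S.rate hT (hx.trans ha) hab hs')
  · filter_upwards [ae_restrict_mem measurableSet_Ioi] with y hy r hr
    have hr' := Ioo_subset_Icc_self hr
    have hy0 : 0 < y := hx.trans hy
    rw [norm_mul]
    refine mul_le_mul ?_ (S.norm_Jw_le hT hy0 hr') (norm_nonneg _) (by positivity)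
    have h1 := hμ' r hr' y (le_of_lt hy)
    rw [Real.norm_eq_abs, abs_of_pos (speedDeriv_pos S.rate (hμ.trans_le h1))]
    refine (speedDeriv_anti S.rate hμ h1).trans ?_
    exact mul_le_mul_of_nonneg_right (hM' r hr') (by positivity)
  · exact ((S.memE T hT).integrableOn_Ioi hx.le).const_mul _
  · filter_upwards [ae_restrict_mem measurableSet_Ioi] with y hy r hr
    refine ((J_hasDerivAt S.rate hT (hx.trans hy) hr).mul_const _).congr_deriv ?_
    ring

end

/-! ### The beta factor along characteristics and its rate of loss -/

section

variable {w : ℝ → ℝ → ℝ} {m : ℝ → ℝ} {T T' x y s t z : ℝ}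

lemma Sys.hh_pos (S : Sys w m) (ht : 0 ≤ t) (hx : 0 ≤ x) (h : 0 < w x t) : 0 < hh w t x :=
  tail_pos (S.memE t ht) (S.cont_space ht) hx h

lemma Sys.hh_hasDerivAt (S : Sys w m) (ht : 0 ≤ t) (hx : 0 < x) :
    HasDerivAt (hh w t) (-w x t) x :=
  hasDerivAt_tail (S.memE t ht) (S.cont_space ht) hx

lemma Sys.hh_nonneg (S : Sys w m) (ht : 0 ≤ t) (hx : 0 ≤ x) : 0 ≤ hh w t x :=
  tail_nonneg (S.memE t ht) hx

lemma Sys.hh_eq_zero (S : Sys w m) (ht : 0 ≤ t) (hx : 0 ≤ x) (h : w x t = 0) : hh w t x = 0 := by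
  refine le_antisymm ?_ (S.hh_nonneg ht hx)
  by_contra! hp
  have : 0 < w x t := pos_of_tail_pos (u := fun y => w y t) (S.memE t ht) hx hp
  linarith

lemma Sys.integrable_speedDeriv_mul (S : Sys w m) (ht : 0 ≤ t) (hx : 0 < x) :
    IntegrableOn (fun y => speedDeriv m t y * w y t) (Ioi x) := by
  refine Integrable.mono' (((S.memE t ht).integrableOn_Ioi hx.le).const_mul (speedDeriv m t x)) ?_ ?_
  · refine AEStronglyMeasurable.mul ?_ ((S.memE t ht).integrableOn_Ioi hx.le).aestronglyMeasurable
    refine (aemeasurable_restrict_of_antitoneOn measurableSet_Ioi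
      fun a ha b _ hab => ?_).aestronglyMeasurable
    exact speedDeriv_anti S.rate (hx.trans ha) hab
  · filter_upwards [ae_restrict_mem measurableSet_Ioi] with y hy
    have hw := S.nonneg (hx.le.trans (le_of_lt hy)) ht
    rw [Real.norm_eq_abs, abs_of_nonneg (mul_nonneg (speedDeriv_pos S.rate (hx.trans hy)).le hw)]
    exact mul_le_mul_of_nonneg_right (speedDeriv_anti S.rate hx (le_of_lt hy)) hw

lemma Sys.hRate_nonneg (S : Sys w m) (ht : 0 ≤ t) (hx : 0 < x) : 0 ≤ hRate w m t x :=
  setIntegral_nonneg measurableSet_Ioi fun _ hy => mul_nonneg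
    (speedDeriv_pos S.rate (hx.trans hy)).le (S.nonneg (hx.le.trans (le_of_lt hy)) ht)

lemma Sys.hRate_le (S : Sys w m) (ht : 0 ≤ t) (hx : 0 < x) :
    hRate w m t x ≤ speedDeriv m t x * hh w t x := by
  unfold hRate
  rw [show speedDeriv m t x * hh w t x = ∫ y in Ioi x, speedDeriv m t x * w y t from
    (integral_const_mul _ _).symm]
  refine setIntegral_mono_on (S.integrable_speedDeriv_mul ht hx)
    (((S.memE t ht).integrableOn_Ioi hx.le).const_mul _) measurableSet_Ioi fun y hy => ?_
  exact mul_le_mul_of_nonneg_right (speedDeriv_anti S.rate hx (le_of_lt hy))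
    (S.nonneg (hx.le.trans (le_of_lt hy)) ht)

/-- The rate at which the beta function decreases along a characteristic. -/
def lossRate (w : ℝ → ℝ → ℝ) (m : ℝ → ℝ) (t x : ℝ) : ℝ :=
  speedDeriv m t x - hRate w m t x / hh w t x

/-- The subtracted term is the average of the decreasing function `speedDeriv` over `(x, ∞)` with
weight `w`, hence at most its value at `x`. -/
lemma Sys.lossRate_nonneg (S : Sys w m) (ht : 0 ≤ t) (hx : 0 < x) (hw : 0 < w x t) :
    0 ≤ lossRate w m t x := by
  unfold lossRate
  rw [sub_nonneg, div_le_iff₀ (S.hh_pos ht hx.le hw)]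
  exact S.hRate_le ht hx

lemma Sys.lossRate_le_speedDeriv (S : Sys w m) (ht : 0 ≤ t) (hx : 0 < x) :
    lossRate w m t x ≤ speedDeriv m t x := by
  unfold lossRate
  have := div_nonneg (S.hRate_nonneg ht hx) (S.hh_nonneg ht hx.le)
  linarith

/-- The factor by which the beta function changes along the characteristic through `(x, T)` from
time `s` to time `T`. -/
def R (w : ℝ → ℝ → ℝ) (m : ℝ → ℝ) (T x s : ℝ) : ℝ :=
  J m T x s * hh w T x / hh w s (Z m T x s)

lemma Sys.w_Z_pos (S : Sys w m) (hT : 0 ≤ T) (hx : 0 < x) (hw : 0 < w x T) (hs : s ∈ Icc 0 T) :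
    0 < w (Z m T x s) s := by rwa [S.w_Z hT hx hs]

lemma Sys.hh_Z_pos (S : Sys w m) (hT : 0 ≤ T) (hx : 0 < x) (hw : 0 < w x T) (hs : s ∈ Icc 0 T) :
    0 < hh w s (Z m T x s) :=
  S.hh_pos hs.1 (Z_pos S.rate hT hx hs).le (S.w_Z_pos hT hx hw hs)

lemma Sys.R_pos (S : Sys w m) (hT : 0 ≤ T) (hx : 0 < x) (hw : 0 < w x T) (hs : s ∈ Icc 0 T) :
    0 < R w m T x s :=
  div_pos (mul_pos J_pos (S.hh_pos hT hx.le hw)) (S.hh_Z_pos hT hx hw hs)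

lemma Sys.R_end (S : Sys w m) (hT : 0 ≤ T) (hx : 0 < x) (hw : 0 < w x T) : R w m T x T = 1 := by
  unfold R
  rw [J_end, Z_end S.rate hT hx, one_mul, div_self (S.hh_pos hT hx.le hw).ne']

lemma Sys.R_cocycle (S : Sys w m) (hT' : 0 ≤ T') (hTT : T' ≤ T) (hx : 0 < x) (hw : 0 < w x T)
    (hs : s ∈ Icc 0 T') : R w m T x s = R w m T' (Z m T x T') s * R w m T x T' := by
  have hT := hT'.trans hTT
  have h1 := S.hh_Z_pos hT hx hw ⟨hT', hTT⟩
  have h2 := S.hh_Z_pos hT hx hw ⟨hs.1, hs.2.trans hTT⟩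
  unfold R
  rw [J_cocycle S.rate hT' hTT hx hs, Z_restrict S.rate hT' hTT hx hs]
  field_simp

lemma Sys.logR_continuousOn (S : Sys w m) (hT : 0 ≤ T) (hx : 0 < x) (hw : 0 < w x T) :
    ContinuousOn (fun s => Real.log (R w m T x s)) (Icc 0 T) := by
  refine ContinuousOn.log ?_ fun s hs => (S.R_pos hT hx hw hs).ne'
  exact ((J_continuousOn S.rate hT hx).mul continuousOn_const).div
    (S.hh_Z_continuousOn hT hx) fun s hs => (S.hh_Z_pos hT hx hw hs).ne'

lemma Sys.logR_hasDerivAt (S : Sys w m) (hT : 0 ≤ T) (hx : 0 < x) (hw : 0 < w x T)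
    (hs : s ∈ Ioo 0 T) :
    HasDerivAt (fun s => Real.log (R w m T x s)) (lossRate w m s (Z m T x s)) s := by
  have hs' := Ioo_subset_Icc_self hs
  have hp := S.hh_Z_pos hT hx hw hs'
  have h1 := ((J_hasDerivAt S.rate hT hx hs).mul_const (hh w T x)).div
    (S.hh_Z_hasDerivAt hT hx hs) hp.ne'
  have h2 := h1.log (S.R_pos hT hx hw hs').ne'
  refine h2.congr_deriv ?_
  have hJ : 0 < J m T x s := J_pos
  have hh0 := S.hh_pos hT hx.le hw
  simp only [Pi.div_apply]
  unfold lossRate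
  field_simp

lemma Sys.R_le_one (S : Sys w m) (hT : 0 ≤ T) (hx : 0 < x) (hw : 0 < w x T) (hs : s ∈ Icc 0 T) :
    R w m T x s ≤ 1 := by
  have hsub : Icc s T ⊆ Icc 0 T := Icc_subset_Icc_left hs.1
  have h := le_of_hasDerivAt_nonneg hs.2 ((S.logR_continuousOn hT hx hw).mono hsub)
    (fun u hu => S.logR_hasDerivAt hT hx hw ⟨hs.1.trans_lt hu.1, hu.2⟩)
    (fun u hu => by
      have hu' := hsub (Ioo_subset_Icc_self hu)
      exact S.lossRate_nonneg hu'.1 (Z_pos S.rate hT hx hu') (S.w_Z_pos hT hx hw hu'))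
  rw [S.R_end hT hx hw, Real.log_one] at h
  exact (Real.log_nonpos_iff (S.R_pos hT hx hw hs).le).1 h

/-! ### Log-concavity of the tail and its consequences -/

/-- `h / w` is decreasing at time `t` beyond `x`. -/
def LogConcaveFrom (w : ℝ → ℝ → ℝ) (t x : ℝ) : Prop :=
  ∀ a b, x ≤ a → a ≤ b → hh w t b * w a t ≤ hh w t a * w b t

/-- The second derivative in space of the speed of the characteristics, up to sign. -/
def speedDeriv₂ (m : ℝ → ℝ) (s x : ℝ) : ℝ := m s * (2 / (9 * cb x ^ 5))

lemma speedDeriv₂_pos (hm : Rate m) (hx : 0 < x) : 0 < speedDeriv₂ m s x := by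
  have := cb_pos hx
  have := hm.pos s
  unfold speedDeriv₂
  positivity

lemma speedDeriv₂_anti (hm : Rate m) (hx : 0 < x) (hxy : x ≤ y) :
    speedDeriv₂ m s y ≤ speedDeriv₂ m s x := by
  have h0 := cb_pos hx
  have h1 := cb_le hx.le hxy
  unfold speedDeriv₂
  refine mul_le_mul_of_nonneg_left ?_ (hm.pos s).le
  have := pow_le_pow_left₀ h0.le h1 5
  apply div_le_div_of_nonneg_left (by norm_num) (by positivity)
  linarith

lemma hasDerivAt_speedDeriv (hx : 0 < x) :
    HasDerivAt (speedDeriv m s) (-speedDeriv₂ m s x) x := by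
  have hc := cb_pos hx
  have h1 : HasDerivAt (fun y => 3 * cb y ^ 2) (3 * (2 * cb x * (1 / (3 * cb x ^ 2)))) x := by
    have := ((hasDerivAt_cb hx).pow 2).const_mul 3
    refine this.congr_deriv ?_
    norm_num
  have h2 := ((h1.fun_inv (by positivity)).const_mul (m s))
  unfold speedDeriv speedDeriv₂
  simp only [one_div]
  refine h2.congr_deriv ?_
  field_simp
  norm_num

/-- Obtained by integrating the derivative of `speedDeriv * h` over `(x, ∞)`. The loss becomes an
integral of a product of positive decreasing factors. -/
lemma Sys.by_parts (S : Sys w m) (ht : 0 ≤ t) (hx : 0 < x) :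
    IntegrableOn (fun y => speedDeriv₂ m t y * hh w t y) (Ioi x) ∧
    speedDeriv m t x * hh w t x - hRate w m t x
      = ∫ y in Ioi x, speedDeriv₂ m t y * hh w t y := by
  have hd : ∀ y ∈ Ici x, HasDerivAt (fun y => speedDeriv m t y * hh w t y)
      (-speedDeriv₂ m t y * hh w t y + speedDeriv m t y * -w y t) y := fun y hy =>
    (hasDerivAt_speedDeriv (hx.trans_le hy)).mul (S.hh_hasDerivAt ht (hx.trans_le hy))
  have hneg : ∀ y ∈ Ioi x, -speedDeriv₂ m t y * hh w t y + speedDeriv m t y * -w y t ≤ 0 := by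
    intro y hy
    have hy0 : 0 < y := hx.trans hy
    have h1 := mul_nonneg (speedDeriv₂_pos (s := t) S.rate hy0).le (S.hh_nonneg ht hy0.le)
    have h2 := mul_nonneg (speedDeriv_pos (s := t) S.rate hy0).le (S.nonneg hy0.le ht)
    linarith
  have hlim : Tendsto (fun y => speedDeriv m t y * hh w t y) atTop (𝓝 0) := by
    have h1 : Tendsto (fun y => speedDeriv m t x * hh w t y) atTop (𝓝 0) := by
      simpa using (tendsto_tail_atTop (S.memE t ht)).const_mul (speedDeriv m t x)
    refine squeeze_zero' ?_ ?_ h1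
    · filter_upwards [eventually_ge_atTop x] with y hy
      exact mul_nonneg (speedDeriv_pos S.rate (hx.trans_le hy)).le
        (S.hh_nonneg ht (hx.le.trans hy))
    · filter_upwards [eventually_ge_atTop x] with y hy
      exact mul_le_mul_of_nonneg_right (speedDeriv_anti S.rate hx hy)
        (S.hh_nonneg ht (hx.le.trans hy))
  have i1 := integrableOn_Ioi_deriv_of_nonpos' hd hneg hlim
  have i2 := S.integrable_speedDeriv_mul ht hx
  have i3 : IntegrableOn (fun y => speedDeriv₂ m t y * hh w t y) (Ioi x) := by
    have := (i1.add i2).neg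
    refine this.congr_fun (fun y _ => ?_) measurableSet_Ioi
    simp only [Pi.neg_apply, Pi.add_apply]
    ring
  refine ⟨i3, ?_⟩
  have e := integral_Ioi_of_hasDerivAt_of_nonpos' hd hneg hlim
  have e2 : ∫ y in Ioi x, (-speedDeriv₂ m t y * hh w t y + speedDeriv m t y * -w y t)
      = -(∫ y in Ioi x, speedDeriv₂ m t y * hh w t y)
        - ∫ y in Ioi x, speedDeriv m t y * w y t := by
    have i4 : IntegrableOn (fun y => -(speedDeriv₂ m t y * hh w t y)) (Ioi x) := i3.neg
    rw [← integral_neg, ← integral_sub i4 i2]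
    refine integral_congr_ae (ae_of_all _ fun y => ?_)
    ring
  rw [e2] at e
  unfold hRate
  linarith

lemma Sys.lossRate_eq (S : Sys w m) (ht : 0 ≤ t) (hx : 0 < x) (hw : 0 < w x t) :
    lossRate w m t x = (∫ y in Ioi x, speedDeriv₂ m t y * hh w t y) / hh w t x := by
  have := S.hh_pos ht hx.le hw
  rw [← (S.by_parts ht hx).2]
  unfold lossRate
  field_simp

/-- Log-concavity gives `h(y) ≤ (h(x) / w(x)) w(y)` for `y ≥ x`, and `w` integrates to `h(x)` over
`(x, ∞)`. -/
lemma Sys.lossRate_le (S : Sys w m) (ht : 0 ≤ t) (hx : 0 < x) (hw : 0 < w x t)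
    (hlc : LogConcaveFrom w t x) :
    lossRate w m t x ≤ speedDeriv₂ m t x * (hh w t x / w x t) := by
  have hp := S.hh_pos ht hx.le hw
  rw [S.lossRate_eq ht hx hw, div_le_iff₀ hp]
  have h1 : ∫ y in Ioi x, speedDeriv₂ m t y * hh w t y
      ≤ ∫ y in Ioi x, speedDeriv₂ m t x * (hh w t x / w x t) * w y t := by
    refine setIntegral_mono_on (S.by_parts ht hx).1
      (((S.memE t ht).integrableOn_Ioi hx.le).const_mul _) measurableSet_Ioi fun y hy => ?_
    rw [mul_assoc]
    refine mul_le_mul (speedDeriv₂_anti S.rate hx (le_of_lt hy)) ?_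
      (S.hh_nonneg ht (hx.le.trans (le_of_lt hy))) (speedDeriv₂_pos S.rate hx).le
    rw [div_mul_eq_mul_div, le_div_iff₀ hw]
    exact hlc x y le_rfl (le_of_lt hy)
  rw [integral_const_mul] at h1
  exact h1

lemma Sys.hh_mul_le (S : Sys w m) (ht : 0 ≤ t) (hx : 0 < x) (hlc : LogConcaveFrom w t x)
    (hxy : x ≤ y) {v : ℝ} (hv : 0 ≤ v) :
    hh w t (y + v) * hh w t x ≤ hh w t (x + v) * hh w t y := by
  have hy : 0 < y := hx.trans_le hxy
  rcases (S.hh_nonneg ht (add_nonneg hy.le hv)).eq_or_lt with h0 | h0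
  · rw [← h0, zero_mul]
    exact mul_nonneg (S.hh_nonneg ht (by linarith)) (S.hh_nonneg ht hy.le)
  have hpos : ∀ a, 0 < a → a ≤ y + v → 0 < hh w t a := fun a ha hav =>
    h0.trans_le (tail_anti (S.memE t ht) ha.le hav)
  have hd : ∀ a ∈ Icc x y, HasDerivAt (fun a => Real.log (hh w t (a + v)) - Real.log (hh w t a))
      (-w (a + v) t / hh w t (a + v) - -w a t / hh w t a) a := fun a ha => by
    have ha0 : 0 < a := hx.trans_le ha.1
    have h1 := (S.hh_hasDerivAt ht (by linarith : 0 < a + v)).comp_add_const a v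
    exact (h1.log (hpos _ (by linarith) (by linarith [ha.2])).ne').sub
      ((S.hh_hasDerivAt ht ha0).log (hpos _ ha0 (by linarith [ha.2])).ne')
  have key := le_of_hasDerivAt_nonpos hxy
    (fun a ha => (hd a ha).continuousAt.continuousWithinAt)
    (fun a ha => hd a (Ioo_subset_Icc_self ha)) (fun a ha => by
      have ha0 : 0 < a := hx.trans ha.1
      have p1 := hpos (a + v) (by linarith) (by linarith [ha.2])
      have p2 := hpos a ha0 (by linarith [ha.2])
      rw [sub_nonpos, div_le_div_iff₀ p1 p2]
      have := hlc a (a + v) ha.1.le (by linarith)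
      linarith)
  have p1 := hpos (x + v) (by linarith) (by linarith)
  have p2 := hpos x hx (by linarith)
  have p3 := hpos y hy (by linarith)
  rw [← Real.log_div h0.ne' p3.ne', ← Real.log_div p1.ne' p2.ne',
    Real.log_le_log_iff (div_pos h0 p3) (div_pos p1 p2), div_le_div_iff₀ p3 p2] at key
  exact key

/-- After the shift `y = x + v` the integrand is `speedDeriv₂(x + v)` times `h(x + v) / h(x)`. Both
factors decrease in `x`, the second by log-concavity (`Sys.hh_mul_le`). -/
lemma Sys.lossRate_anti (S : Sys w m) (ht : 0 ≤ t) (hx : 0 < x) (hlc : LogConcaveFrom w t x)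
    (hxy : x ≤ y) (hw : 0 < w y t) : lossRate w m t y ≤ lossRate w m t x := by
  have hy : 0 < y := hx.trans_le hxy
  have hwx : 0 < w x t := hw.trans_le (S.anti hx.le hxy ht)
  have hpx := S.hh_pos ht hx.le hwx
  have hpy := S.hh_pos ht hy.le hw
  rw [S.lossRate_eq ht hx hwx, S.lossRate_eq ht hy hw, div_le_div_iff₀ hpy hpx,
    ← integral_mul_const, ← integral_mul_const]
  have ix := (S.by_parts ht hx).1
  have iy := (S.by_parts ht hy).1
  have e : ∀ f : ℝ → ℝ, ∀ a, ∫ u in Ioi a, f u = ∫ v in Ioi 0, f (v + a) := fun f a => by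
    have := (measurePreserving_add_right volume a).setIntegral_preimage_emb
      (measurableEmbedding_addRight a) f (Ioi a)
    simpa using this.symm
  have ei : ∀ f : ℝ → ℝ, ∀ a, IntegrableOn f (Ioi a) →
      IntegrableOn (fun v => f (v + a)) (Ioi 0) := fun f a hf => by
    have := ((measurePreserving_add_right volume a).integrableOn_comp_preimage
      (measurableEmbedding_addRight a)).2 hf
    simpa [Function.comp_def] using this
  rw [e _ x, e _ y]
  refine setIntegral_mono_on (ei _ y (iy.mul_const _)) (ei _ x (ix.mul_const _))
    measurableSet_Ioi fun v hv => ?_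
  have hv : 0 < v := hv
  have h1 := S.hh_mul_le ht hx hlc hxy hv.le
  rw [add_comm v y, add_comm v x, mul_assoc, mul_assoc]
  refine mul_le_mul (speedDeriv₂_anti S.rate (by linarith) (by linarith)) h1 ?_
    (speedDeriv₂_pos S.rate (by linarith)).le
  exact mul_nonneg (S.hh_nonneg ht (by linarith)) hpx.le

/-- With `γ = h / w` at `x`, log-concavity and monotonicity of `w` give `h(x + γ) ≤ γ w(x + γ) ≤
h(x) - h(x + γ)`. -/
lemma Sys.hh_half (S : Sys w m) (ht : 0 ≤ t) (hx : 0 ≤ x) (hw : 0 < w x t)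
    (hlc : LogConcaveFrom w t x) : hh w t (x + hh w t x / w x t) ≤ hh w t x / 2 := by
  set γ := hh w t x / w x t with hγ
  have hp := S.hh_pos ht hx hw
  have hγ0 : 0 < γ := div_pos hp hw
  have h1 := hlc x (x + γ) le_rfl (by linarith)
  have h2 := mul_le_tail_sub (S.memE t ht) hx (by linarith : x ≤ x + γ)
  have h3 : hh w t (x + γ) ≤ γ * w (x + γ) t := by
    rw [hγ, div_mul_eq_mul_div, le_div_iff₀ hw]
    exact h1
  have h4 : (x + γ - x) * w (x + γ) t = γ * w (x + γ) t := by ring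
  change (x + γ - x) * w (x + γ) t ≤ hh w t x - hh w t (x + γ) at h2
  linarith

lemma Sys.hRate_ge (S : Sys w m) (ht : 0 ≤ t) (hx : 0 < x) (hw : 0 < w x t)
    (hlc : LogConcaveFrom w t x) :
    1 / 2 * speedDeriv m t (x + hh w t x / w x t) ≤ hRate w m t x / hh w t x := by
  have hp := S.hh_pos ht hx.le hw
  have hhalf := S.hh_half ht hx.le hw hlc
  set γ := hh w t x / w x t with hγ
  have hγ0 : 0 < γ := div_pos hp hw
  rw [le_div_iff₀ hp]
  have hi := S.integrable_speedDeriv_mul ht hx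
  have h1 : ∫ y in Ioc x (x + γ), speedDeriv m t (x + γ) * w y t ≤ hRate w m t x := by
    refine le_trans (setIntegral_mono_on
      ((((S.memE t ht).integrableOn_Ioi hx.le).mono_set Ioc_subset_Ioi_self).const_mul _)
      (hi.mono_set Ioc_subset_Ioi_self) measurableSet_Ioc fun y hy => ?_)
      (setIntegral_mono_set hi ?_ (ae_of_all _ Ioc_subset_Ioi_self))
    · exact mul_le_mul_of_nonneg_right (speedDeriv_anti S.rate (hx.trans hy.1) hy.2)
        (S.nonneg (hx.trans hy.1).le ht)
    · filter_upwards [ae_restrict_mem measurableSet_Ioi] with y hy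
      exact mul_nonneg (speedDeriv_pos S.rate (hx.trans hy)).le (S.nonneg (hx.trans hy).le ht)
  have h2 := tail_sub (S.memE t ht) hx.le (by linarith : x ≤ x + γ)
  rw [intervalIntegral.integral_of_le (by linarith)] at h2
  rw [integral_const_mul, ← h2] at h1
  have h3 := speedDeriv_pos (s := t) S.rate (by linarith : 0 < x + γ)
  have h4 : hh w t x / 2 ≤ hh w t x - hh w t (x + γ) := by linarith
  have h5 := mul_le_mul_of_nonneg_left h4 h3.le
  calc 1 / 2 * speedDeriv m t (x + γ) * hh w t x
      = speedDeriv m t (x + γ) * (hh w t x / 2) := by ring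
    _ ≤ _ := h5
    _ ≤ _ := h1

/-! ### The beta function along characteristics -/

/-- The initial beta function is between `δ` and `1` beyond `r`. -/
def BetaBounds (w : ℝ → ℝ → ℝ) (r δ : ℝ) : Prop :=
  ∀ a, r < a → 0 < w a 0 → ∃ c, HasDerivAt (fun x => w x 0) (-c) a ∧
    δ * w a 0 ^ 2 ≤ c * hh w 0 a ∧ c * hh w 0 a ≤ w a 0 ^ 2

variable {r δ : ℝ}

/-- Chain rule for `w(x,T) = w(Z,0)`: the slope is multiplied by `J`, so `c h / w ^ 2`, the beta
function, is multiplied by `R`. -/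
lemma Sys.exists_deriv (S : Sys w m) (hβ : BetaBounds w r δ) (hT : 0 ≤ T) (hx : 0 < x)
    (hw : 0 < w x T) (hr : r < Z m T x 0) :
    ∃ c, HasDerivAt (fun y => w y T) (-c) x ∧
      δ * R w m T x 0 * w x T ^ 2 ≤ c * hh w T x ∧ c * hh w T x ≤ R w m T x 0 * w x T ^ 2 := by
  have h0 : (0 : ℝ) ∈ Icc 0 T := left_mem_Icc.2 hT
  have hw0 := S.w_Z_pos hT hx hw h0
  have hh0 := S.hh_Z_pos hT hx hw h0
  obtain ⟨c, hc, hc1, hc2⟩ := hβ _ hr hw0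
  refine ⟨c * J m T x 0, ?_, ?_, ?_⟩
  · have h1 := HasDerivAt.comp x hc (Z_hasDerivAt_space S.rate hT hx h0)
    refine (h1.congr_deriv (by ring)).congr_of_eventuallyEq ?_
    filter_upwards [lt_mem_nhds hx] with y hy
    exact (S.w_Z hT hy h0).symm
  all_goals
    have e : c * J m T x 0 * hh w T x = c * hh w 0 (Z m T x 0) * R w m T x 0 := by
      unfold R; field_simp
    have hR := S.R_pos hT hx hw h0
    rw [S.w_Z hT hx h0] at hc1 hc2
    rw [e]
    nlinarith

/-- The derivative of `h / w` is `β - 1`, which is nonpositive because `β₀ ≤ 1` beyond `r` and `R ≤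
1`. -/
lemma Sys.logConcaveFrom (S : Sys w m) (hβ : BetaBounds w r δ) (hT : 0 ≤ T) (hx : 0 < x)
    (hr : r < Z m T x 0) : LogConcaveFrom w T x := by
  intro a b ha hab
  have ha0 : 0 < a := hx.trans_le ha
  rcases (S.nonneg (ha0.le.trans hab) hT).eq_or_lt with h0 | h0
  · rw [S.hh_eq_zero hT (ha0.le.trans hab) h0.symm, ← h0]; simp
  have hp : ∀ y ∈ Icc a b, 0 < y ∧ 0 < w y T ∧ r < Z m T y 0 := fun y hy => by
    have hy0 := ha0.trans_le hy.1
    exact ⟨hy0, h0.trans_le (S.anti hy0.le hy.2 hT), hr.trans_le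
      (Z_le S.rate hT hx (ha.trans hy.1) (left_mem_Icc.2 hT))⟩
  choose! c hc _ hc2 using fun y (hy : y ∈ Icc a b) =>
    S.exists_deriv hβ hT (hp y hy).1 (hp y hy).2.1 (hp y hy).2.2
  have hd : ∀ y ∈ Icc a b, HasDerivAt (fun y => hh w T y / w y T)
      ((-w y T * w y T - hh w T y * -c y) / w y T ^ 2) y := fun y hy =>
    (S.hh_hasDerivAt hT (hp y hy).1).div (hc y hy) (hp y hy).2.1.ne'
  have key := le_of_hasDerivAt_nonpos hab (fun y hy => (hd y hy).continuousAt.continuousWithinAt)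
    (fun y hy => hd y (Ioo_subset_Icc_self hy)) (fun y hy => by
      obtain ⟨hy0, hwy, -⟩ := hp y (Ioo_subset_Icc_self hy)
      have h1 := hc2 y (Ioo_subset_Icc_self hy)
      have h2 := S.R_le_one hT hy0 hwy (left_mem_Icc.2 hT)
      refine div_nonpos_of_nonpos_of_nonneg ?_ (by positivity)
      nlinarith [sq_nonneg (w y T)])
  rwa [div_le_div_iff₀ h0 (hp a ⟨le_rfl, hab⟩).2.1] at key

lemma Sys.logConcaveFrom_zero (S : Sys w m) (hβ : BetaBounds w r δ) (hT : 0 ≤ T)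
    (hr : ∀ x, 0 < x → r < Z m T x 0) : LogConcaveFrom w T 0 := by
  intro a b ha hab
  rcases ha.eq_or_lt with rfl | ha'
  · rcases hab.eq_or_lt with rfl | hb
    · exact le_rfl
    have c1 : Tendsto (fun x => hh w T b * w x T) (𝓝[>] 0) (𝓝 (hh w T b * w 0 T)) :=
      (((S.cont_space hT) 0 self_mem_Ici).mono_left
        (nhdsWithin_mono _ Ioi_subset_Ici_self)).const_mul _
    have c2 : Tendsto (fun x => hh w T x * w b T) (𝓝[>] 0) (𝓝 (hh w T 0 * w b T)) :=
      ((continuousOn_tail (S.memE T hT) 0 self_mem_Ici).mono_left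
        (nhdsWithin_mono _ Ioi_subset_Ici_self)).mul_const _
    refine le_of_tendsto_of_tendsto c1 c2 ?_
    filter_upwards [Ioo_mem_nhdsGT hb] with x hx
    exact S.logConcaveFrom hβ hT hx.1 (hr x hx.1) x b le_rfl hx.2.le
  · exact S.logConcaveFrom hβ hT ha' (hr a ha') a b le_rfl hab

/-- Characteristics stay ordered and, at each time, the one further right loses at a smaller rate.
-/
lemma Sys.R_mono (S : Sys w m) (hβ : BetaBounds w r δ) (hT : 0 ≤ T) (hx : 0 < x) (hxy : x ≤ y)
    (hw : 0 < w y T) (hr : r < Z m T x 0) : R w m T x 0 ≤ R w m T y 0 := by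
  have hy : 0 < y := hx.trans_le hxy
  have hwx : 0 < w x T := hw.trans_le (S.anti hx.le hxy hT)
  have h0 : (0 : ℝ) ∈ Icc 0 T := left_mem_Icc.2 hT
  have key := le_of_hasDerivAt_nonpos hT
    ((S.logR_continuousOn hT hy hw).sub (S.logR_continuousOn hT hx hwx))
    (fun s hs => (S.logR_hasDerivAt hT hy hw hs).sub (S.logR_hasDerivAt hT hx hwx hs))
    (fun s hs => by
      have hs' := Ioo_subset_Icc_self hs
      rw [sub_nonpos]
      have hz := Z_pos S.rate hT hx hs'
      refine S.lossRate_anti hs'.1 hz (S.logConcaveFrom hβ hs'.1 hz ?_)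
        (Z_le S.rate hT hx hxy hs') (S.w_Z_pos hT hy hw hs')
      rwa [Z_restrict S.rate hs'.1 hs'.2 hx ⟨le_rfl, hs'.1⟩])
  rw [Pi.sub_apply, Pi.sub_apply, S.R_end hT hx hwx, S.R_end hT hy hw, sub_self] at key
  have := sub_nonneg.1 key
  rwa [Real.log_le_log_iff (S.R_pos hT hx hwx h0) (S.R_pos hT hy hw h0)] at this

end

/-! ### The rate `m` in terms of `w(0,t)` -/

section

lemma integrableOn_rpow_mul {u : ℝ → ℝ} (hu : MemE u) :
    IntegrableOn (fun x => x ^ (-(2 / 3) : ℝ) * u x) (Ioi 0) := by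
  have hm : AEStronglyMeasurable (fun x => x ^ (-(2 / 3) : ℝ) * u x) (volume.restrict (Ioi 0)) :=
    (by fun_prop : Measurable fun x : ℝ => x ^ (-(2 / 3) : ℝ)).aestronglyMeasurable.mul
      hu.integrable.aestronglyMeasurable
  have h1 : IntegrableOn (fun x => x ^ (-(2 / 3) : ℝ) * u x) (Ioc 0 1) := by
    have hi : IntegrableOn (fun x : ℝ => x ^ (-(2 / 3) : ℝ)) (Ioc 0 1) :=
      (intervalIntegrable_iff_integrableOn_Ioc_of_le zero_le_one).1
        (intervalIntegral.intervalIntegrable_rpow' (by norm_num))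
    refine Integrable.mono' (hi.mul_const (u 0)) (hm.mono_set Ioc_subset_Ioi_self) ?_
    filter_upwards [ae_restrict_mem measurableSet_Ioc] with x hx
    have h2 := Real.rpow_nonneg hx.1.le (-(2 / 3) : ℝ)
    rw [Real.norm_eq_abs, abs_of_nonneg (mul_nonneg h2 (hu.nonneg x hx.1.le))]
    exact mul_le_mul_of_nonneg_left (hu.antitone self_mem_Ici hx.1.le hx.1.le) h2
  have h2 : IntegrableOn (fun x => x ^ (-(2 / 3) : ℝ) * u x) (Ioi 1) := by
    refine Integrable.mono' (hu.integrableOn_Ioi zero_le_one)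
      (hm.mono_set (Ioi_subset_Ioi zero_le_one)) ?_
    filter_upwards [ae_restrict_mem measurableSet_Ioi] with x hx
    have hx1 : (1 : ℝ) < x := hx
    have h2 := Real.rpow_nonneg (by linarith : (0 : ℝ) ≤ x) (-(2 / 3) : ℝ)
    have h3 : x ^ (-(2 / 3) : ℝ) ≤ 1 := Real.rpow_le_one_of_one_le_of_nonpos hx1.le (by norm_num)
    have h4 := hu.nonneg x (by linarith)
    rw [Real.norm_eq_abs, abs_of_nonneg (mul_nonneg h2 h4)]
    exact mul_le_of_le_one_left h4 h3
  rw [← Ioc_union_Ioi_eq_Ioi (zero_le_one' ℝ)]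
  exact h1.union h2

lemma rpow_anti {x y : ℝ} (hx : 0 < x) (hxy : x ≤ y) :
    y ^ (-(2 / 3) : ℝ) ≤ x ^ (-(2 / 3) : ℝ) :=
  Real.rpow_le_rpow_of_nonpos hx hxy (by norm_num)

lemma rpow_integral_ge {u : ℝ → ℝ} (hu : MemE u) {X : ℝ} (hX : 0 < X) :
    X ^ (-(2 / 3) : ℝ) * (tail u 0 - tail u X) ≤ ∫ x in Ioi (0 : ℝ), x ^ (-(2 / 3) : ℝ) * u x := by
  have hi := integrableOn_rpow_mul hu
  rw [tail_sub hu le_rfl hX.le, intervalIntegral.integral_of_le hX.le, ← integral_const_mul]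
  refine le_trans (setIntegral_mono_on ((hu.integrable.mono_set Ioc_subset_Ioi_self).const_mul _)
    (hi.mono_set Ioc_subset_Ioi_self) measurableSet_Ioc fun y hy => ?_)
    (setIntegral_mono_set hi ?_ (ae_of_all _ Ioc_subset_Ioi_self))
  · exact mul_le_mul_of_nonneg_right (rpow_anti hy.1 hy.2) (hu.nonneg y hy.1.le)
  · filter_upwards [ae_restrict_mem measurableSet_Ioi] with y hy
    exact mul_nonneg (Real.rpow_nonneg (le_of_lt hy) _) (hu.nonneg y (le_of_lt hy))

lemma rpow_integral_tail_le {u : ℝ → ℝ} (hu : MemE u) {X : ℝ} (hX : 0 < X) :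
    ∫ x in Ioi X, x ^ (-(2 / 3) : ℝ) * u x ≤ X ^ (-(2 / 3) : ℝ) * tail u X := by
  rw [tail, ← integral_const_mul]
  refine setIntegral_mono_on ((integrableOn_rpow_mul hu).mono_set (Ioi_subset_Ioi hX.le))
    ((hu.integrableOn_Ioi hX.le).const_mul _) measurableSet_Ioi fun y hy => ?_
  exact mul_le_mul_of_nonneg_right (rpow_anti hX (le_of_lt hy)) (hu.nonneg y (hX.le.trans
    (le_of_lt hy)))

lemma rpow_integral_le {u : ℝ → ℝ} (hu : MemE u) {X : ℝ} (hX : 0 < X) :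
    ∫ x in Ioi (0 : ℝ), x ^ (-(2 / 3) : ℝ) * u x
      ≤ 3 * cb X * u 0 + X ^ (-(2 / 3) : ℝ) * tail u X := by
  have hi := integrableOn_rpow_mul hu
  have h := setIntegral_union (μ := volume) (Ioc_disjoint_Ioi le_rfl) measurableSet_Ioi
    (hi.mono_set (fun y hy => hy.1 : Ioc 0 X ⊆ Ioi 0)) (hi.mono_set (Ioi_subset_Ioi hX.le))
  rw [Ioc_union_Ioi_eq_Ioi hX.le] at h
  rw [h]
  refine add_le_add ?_ (rpow_integral_tail_le hu hX)
  have hr : IntegrableOn (fun x : ℝ => x ^ (-(2 / 3) : ℝ)) (Ioc 0 X) :=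
    (intervalIntegrable_iff_integrableOn_Ioc_of_le hX.le).1
      (intervalIntegral.intervalIntegrable_rpow' (by norm_num))
  have h1 : ∫ x in Ioc 0 X, x ^ (-(2 / 3) : ℝ) = 3 * cb X := by
    rw [← intervalIntegral.integral_of_le hX.le, integral_rpow (Or.inl (by norm_num))]
    have e : (-(2 / 3) : ℝ) + 1 = 1 / 3 := by norm_num
    rw [e, Real.zero_rpow (by norm_num)]
    unfold cb
    ring
  rw [← h1, ← integral_mul_const]
  refine setIntegral_mono_on (hi.mono_set Ioc_subset_Ioi_self) (hr.mul_const _)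
    measurableSet_Ioc fun y hy => ?_
  exact mul_le_mul_of_nonneg_left (hu.antitone self_mem_Ici hy.1.le hy.1.le)
    (Real.rpow_nonneg hy.1.le _)

variable {w : ℝ → ℝ → ℝ} {m : ℝ → ℝ} {T T' x y s t z r δ : ℝ}

lemma Sys.hh_zero (S : Sys w m) (ht : 0 ≤ t) : hh w t 0 = 1 := S.mass t ht

lemma Sys.w_zero_pos (S : Sys w m) (ht : 0 ≤ t) : 0 < w 0 t :=
  pos_of_tail_pos (u := fun y => w y t) (S.memE t ht) le_rfl (by
    have := S.hh_zero ht
    rw [hh] at this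
    rw [this]; exact one_pos)

lemma cb_inv {a : ℝ} (ha : 0 < a) : cb (1 / a) = 1 / cb a := by
  unfold cb
  rw [Real.div_rpow zero_le_one ha.le, Real.one_rpow]

/-- The moment integral is split at the mean volume `1 / w(0,t)`. The two pieces are at most `3` and
`1` times `w(0,t)^{2/3}`, whence the constant `3/4`. -/
lemma Sys.m_ge (S : Sys w m) (ht : 0 ≤ t) : 3 / 4 * cb (w 0 t) ≤ m t := by
  have h0 := S.w_zero_pos ht
  have hc := cb_pos h0
  have h1 := rpow_integral_le (S.memE t ht) (one_div_pos.2 h0)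
  have h2 := tail_anti (S.memE t ht) le_rfl (one_div_pos.2 h0).le
  change hh w t (1 / w 0 t) ≤ hh w t 0 at h2
  rw [S.hh_zero ht] at h2
  rw [rpow_neg_two_thirds (one_div_pos.2 h0), cb_inv h0] at h1
  have h3 := S.m_eq t ht
  have h4 := cb_pow h0.le
  have hm := S.rate.pos t
  set c := cb (w 0 t)
  have h5 : ∫ x in Ioi (0 : ℝ), x ^ (-(2 / 3) : ℝ) * w x t ≤ 4 * c ^ 2 := by
    refine h1.trans ?_
    have e1 : 3 * (1 / c) * w 0 t = 3 * c ^ 2 := by rw [← h4]; field_simp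
    have e2 : 1 / (1 / c) ^ 2 = c ^ 2 := by field_simp
    rw [e1, e2]
    change 3 * c ^ 2 + c ^ 2 * hh w t (1 / w 0 t) ≤ _
    nlinarith [sq_nonneg c]
  have h6 : 3 * c ^ 3 ≤ m t * (4 * c ^ 2) := by
    rw [h4, ← h3]
    exact mul_le_mul_of_nonneg_left h5 hm.le
  have h7 : 0 < c ^ 2 := by positivity
  by_contra! hlt
  nlinarith

lemma Sys.m_mul_le (S : Sys w m) (ht : 0 ≤ t) {X : ℝ} (hX : 0 < X) :
    m t * (1 - hh w t X) ≤ 3 * cb X ^ 2 * w 0 t := by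
  have h1 := rpow_integral_ge (S.memE t ht) hX
  rw [rpow_neg_two_thirds hX] at h1
  have hc := cb_pos hX
  have h3 := S.m_eq t ht
  have hm := S.rate.pos t
  change 1 / cb X ^ 2 * (hh w t 0 - hh w t X) ≤ _ at h1
  rw [S.hh_zero ht] at h1
  have h4 := mul_le_mul_of_nonneg_left h1 hm.le
  rw [h3] at h4
  have h5 := mul_le_mul_of_nonneg_left h4 (sq_nonneg (cb X))
  have e : cb X ^ 2 * (m t * (1 / cb X ^ 2 * (1 - hh w t X))) = m t * (1 - hh w t X) := by
    field_simp
  rw [e] at h5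
  linarith

/-- By log-concavity at least half of the mass lies below `1 / w(0,t)`, which bounds the moment from
below. -/
lemma Sys.m_le (S : Sys w m) (ht : 0 ≤ t) (hlc : LogConcaveFrom w t 0) :
    m t ≤ 6 * cb (w 0 t) := by
  have h0 := S.w_zero_pos ht
  have hc := cb_pos h0
  have h1 := S.hh_half ht le_rfl h0 hlc
  rw [S.hh_zero ht, zero_add] at h1
  have h2 := S.m_mul_le ht (one_div_pos.2 h0)
  have h4 := cb_pow h0.le
  rw [cb_inv h0] at h2
  have hm := S.rate.pos t
  have e : 3 * (1 / cb (w 0 t)) ^ 2 * w 0 t = 3 * cb (w 0 t) := by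
    nth_rewrite 2 [← h4]
    field_simp
  rw [e] at h2
  nlinarith

/-! ### The left end point -/

lemma Sys.tendsto_zero (S : Sys w m) (ht : 0 ≤ t) :
    Tendsto (fun x => w x t) (𝓝[>] 0) (𝓝 (w 0 t)) :=
  ((S.cont_space ht) 0 self_mem_Ici).mono_left (nhdsWithin_mono _ Ioi_subset_Ici_self)

lemma Sys.w_zero_anti (S : Sys w m) (hs : 0 ≤ s) (hst : s ≤ t) : w 0 t ≤ w 0 s := by
  have ht := hs.trans hst
  refine le_of_tendsto (S.tendsto_zero ht) ?_
  filter_upwards [self_mem_nhdsWithin] with x hx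
  rw [← S.w_Z ht hx ⟨hs, hst⟩]
  exact S.anti le_rfl (Z_pos S.rate ht hx ⟨hs, hst⟩).le hs

/-- Volumes shrink at speed at most `1`, so what vanishes at time `t` had volume at most `t - s` at
time `s`. With `Sys.w_zero_le` this replaces `Λ' = β(0,t)`, since the equation is not available at
`x = 0`. -/
lemma Sys.w_zero_ge (S : Sys w m) (hs : 0 ≤ s) (hst : s ≤ t) : w (t - s) s ≤ w 0 t := by
  have ht := hs.trans hst
  have h0 : (0 : ℝ) ≤ t - s := sub_nonneg.2 hst
  have h1 : Tendsto (fun x => w (x + (t - s)) s) (𝓝[>] 0) (𝓝 (w (t - s) s)) := by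
    have hc : ContinuousWithinAt (fun x => w (x + (t - s)) s) (Ici 0) 0 := by
      refine ContinuousWithinAt.comp (t := Ici 0) (f := fun x => x + (t - s))
        (g := fun x => w x s) (S.cont_space hs _ (by simpa using hst)) (by fun_prop) ?_
      intro x hx
      exact add_nonneg hx h0
    have := hc.mono Ioi_subset_Ici_self
    simpa [ContinuousWithinAt] using this
  refine le_of_tendsto_of_tendsto h1 (S.tendsto_zero ht) ?_
  filter_upwards [self_mem_nhdsWithin] with x hx
  have hx : 0 < x := hx
  rw [← S.w_Z ht hx ⟨hs, hst⟩]
  exact S.anti (Z_pos S.rate ht hx ⟨hs, hst⟩).le (Z_le_add S.rate ht hx ⟨hs, hst⟩) hs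

lemma Z_ge_half (hm : Rate m) (hs : 0 ≤ s) (hst : s ≤ t) (hx : 0 < x)
    (h : ∀ u ∈ Icc s t, m u * cb (Z m t x u) ≤ 1 / 2) : x + (t - s) / 2 ≤ Z m t x s := by
  have ht := hs.trans hst
  have hsub : Icc s t ⊆ Icc 0 t := Icc_subset_Icc_left hs
  have := le_of_hasDerivAt_nonpos (f := fun u => Z m t x u + u / 2)
    (f' := fun u => m u * cb (Z m t x u) - 1 + 1 / 2) hst
    (((Z_continuousOn hm ht hx).mono hsub).add (by fun_prop))
    (fun u hu => (Z_hasDerivAt_time hm ht hx (hsub (Ioo_subset_Icc_self hu))).add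
      ((hasDerivAt_id u).div_const 2))
    (fun u hu => by linarith [h u (Ioo_subset_Icc_self hu)])
  simp only [Z_end hm ht hx] at this
  linarith

/-- Very small clusters shrink at speed at least `1/2`, so what vanishes at time `t` had volume at
least `(t - s) / 2` at time `s`. -/
lemma Sys.w_zero_le (S : Sys w m) (hs : 0 ≤ s) :
    ∀ᶠ t in 𝓝[>] s, w 0 t ≤ w ((t - s) / 2) s := by
  obtain ⟨M, hM, hM'⟩ := exists_rate_upper S.rate (s + 1)
  set η : ℝ := (1 / (2 * M)) ^ 3 with hη
  have hη0 : 0 < η := by positivity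
  filter_upwards [Ioo_mem_nhdsGT (show s < s + min 1 (η / 2) by
    have := lt_min one_pos (half_pos hη0); linarith)] with t ht
  have ht1 : t < s + 1 := ht.2.trans_le (by linarith [min_le_left (1 : ℝ) (η / 2)])
  have ht2 : t - s < η / 2 := by linarith [ht.2, min_le_right (1 : ℝ) (η / 2)]
  have ht0 : 0 ≤ t := hs.trans ht.1.le
  refine le_of_tendsto (S.tendsto_zero ht0) ?_
  filter_upwards [Ioo_mem_nhdsGT (half_pos hη0)] with x hx
  have hst : s ∈ Icc 0 t := ⟨hs, ht.1.le⟩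
  rw [← S.w_Z ht0 hx.1 hst]
  refine S.anti (by linarith [ht.1]) ?_ hs
  have := Z_ge_half S.rate hs ht.1.le hx.1 fun u hu => by
    have hu' : u ∈ Icc 0 t := ⟨hs.trans hu.1, hu.2⟩
    have h1 := Z_le_add S.rate ht0 hx.1 hu'
    have h2 : cb (Z m t x u) ≤ 1 / (2 * M) := by
      have := cb_le (Z_pos S.rate ht0 hx.1 hu').le (show Z m t x u ≤ η by linarith [hu.1, hx.2])
      rwa [hη, cb_cube (by positivity)] at this
    calc m u * cb (Z m t x u) ≤ M * (1 / (2 * M)) :=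
          mul_le_mul (hM' u ⟨hu'.1, by linarith [hu.2]⟩) h2
            (cb_nonneg (Z_pos S.rate ht0 hx.1 hu').le) hM.le
      _ = 1 / 2 := by field_simp
  linarith [hx.1]

/-- The mean volume, which is `1 / w(0,t)` for solutions of mass one. -/
def lam (w : ℝ → ℝ → ℝ) (t : ℝ) : ℝ := 1 / w 0 t

lemma Sys.lam_pos (S : Sys w m) (ht : 0 ≤ t) : 0 < lam w t := one_div_pos.2 (S.w_zero_pos ht)

lemma Sys.lam_mono (S : Sys w m) (hs : 0 ≤ s) (hst : s ≤ t) : lam w s ≤ lam w t :=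
  one_div_le_one_div_of_le (S.w_zero_pos (hs.trans hst)) (S.w_zero_anti hs hst)

lemma Sys.lam_continuousOn (S : Sys w m) : ContinuousOn (lam w) (Ici 0) :=
  continuousOn_const.div (S.cont_time le_rfl) fun _ ht => (S.w_zero_pos ht).ne'

lemma Sys.cb_w_zero (S : Sys w m) (ht : 0 ≤ t) : cb (w 0 t) = 1 / cb (lam w t) := by
  unfold lam
  rw [cb_inv (S.w_zero_pos ht), one_div_one_div]

end

/-! ### Bounds for the loss during slow growth -/

section

variable {w : ℝ → ℝ → ℝ} {m : ℝ → ℝ} {T T' x y s t z r δ κ t₁ : ℝ}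

/-- A bound for the total loss along a characteristic during a period of slow growth. -/
def lossBound : ℝ := 331776 * 256 * Real.exp 1 + 1

/-- The time `∫ dt / Λ` between `s` and `T`. -/
def remaining (w : ℝ → ℝ → ℝ) (T s : ℝ) : ℝ := ∫ u in s..T, w 0 u

lemma Sys.cont_w_zero (S : Sys w m) (hs : 0 ≤ s) : ContinuousOn (fun u => w 0 u) (Icc s T) :=
  (S.cont_time le_rfl).mono fun _ hu => hs.trans hu.1

lemma Sys.remaining_nonneg (S : Sys w m) (hs : 0 ≤ s) (hsT : s ≤ T) : 0 ≤ remaining w T s :=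
  intervalIntegral.integral_nonneg hsT fun _ hu => (S.w_zero_pos (hs.trans hu.1)).le

lemma Sys.m_cb_lam_le (S : Sys w m) (ht : 0 ≤ t) (hlc : LogConcaveFrom w t 0) :
    m t * cb (lam w t) ≤ 6 := by
  have h1 := S.m_le ht hlc
  have h2 := cb_pos (S.lam_pos ht)
  rw [S.cb_w_zero ht] at h1
  calc m t * cb (lam w t) ≤ 6 * (1 / cb (lam w t)) * cb (lam w t) :=
        mul_le_mul_of_nonneg_right h1 h2.le
    _ = 6 := by field_simp

lemma Sys.m_cb_lam_ge (S : Sys w m) (ht : 0 ≤ t) : 3 / 4 ≤ m t * cb (lam w t) := by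
  have h1 := S.m_ge ht
  have h2 := cb_pos (S.lam_pos ht)
  rw [S.cb_w_zero ht] at h1
  calc 3 / 4 = 3 / 4 * (1 / cb (lam w t)) * cb (lam w t) := by field_simp
    _ ≤ _ := mul_le_mul_of_nonneg_right h1 h2.le

lemma Sys.speed_small (S : Sys w m) (ht : 0 ≤ t) (hlc : LogConcaveFrom w t 0) (hx : 0 ≤ x)
    (h : 1728 * x ≤ lam w t) : m t * cb x ≤ 1 / 2 := by
  have h1 := S.m_cb_lam_le ht hlc
  have h2 : cb x ≤ cb (lam w t) / 12 := by
    have h3 := cb_pow (S.lam_pos ht).le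
    have h4 := cb_nonneg (S.lam_pos ht).le
    have h5 := cb_le hx (show x ≤ (cb (lam w t) / 12) ^ 3 by
      rw [div_pow, h3]; norm_num; linarith)
    rwa [cb_cube (by positivity)] at h5
  have := mul_le_mul_of_nonneg_left h2 (S.rate.pos t).le
  linarith

lemma Sys.gamma_le (S : Sys w m) (ht : 0 ≤ t) (hlc : LogConcaveFrom w t 0) (hx : 0 ≤ x)
    (hw : 0 < w x t) : hh w t x / w x t ≤ lam w t := by
  have h1 := hlc 0 x le_rfl hx
  rw [S.hh_zero ht, one_mul] at h1
  have h0 := S.w_zero_pos ht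
  unfold lam
  rw [div_le_div_iff₀ hw h0]
  linarith

lemma LogConcaveFrom.mono (h : LogConcaveFrom w t x) (hxy : x ≤ y) : LogConcaveFrom w t y :=
  fun a b ha hab => h a b (hxy.trans ha) hab

/-- Here `x + h / w ≤ 28 Λ ≤ 64 Λ`, and `64 = 4 ^ 3` gives `speedDeriv ≥ (3/4) / 48 * w(0,t)`; half
of this enters through `Sys.hRate_ge`. -/
lemma Sys.growth (S : Sys w m) (ht : 0 ≤ t) (hlc : LogConcaveFrom w t 0) (hx : 0 < x)
    (hw : 0 < w x t) (h : x ≤ 27 * lam w t) : w 0 t / 128 ≤ hRate w m t x / hh w t x := by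
  have h1 := S.hRate_ge ht hx hw (hlc.mono hx.le)
  have h2 := S.gamma_le ht hlc hx.le hw
  have hp := S.hh_pos ht hx.le hw
  have hg : 0 < hh w t x / w x t := div_pos hp hw
  have hl := S.lam_pos ht
  refine le_trans ?_ h1
  have h3 : speedDeriv m t (64 * lam w t) ≤ speedDeriv m t (x + hh w t x / w x t) :=
    speedDeriv_anti S.rate (by linarith) (by linarith)
  have h4 : cb (64 * lam w t) = 4 * cb (lam w t) := by
    have e : 64 * lam w t = (4 * cb (lam w t)) ^ 3 := by
      rw [mul_pow, cb_pow hl.le]; norm_num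
    rw [e, cb_cube (by have := cb_pos hl; positivity)]
  have h5 : w 0 t / 64 ≤ speedDeriv m t (64 * lam w t) := by
    have h6 := S.m_cb_lam_ge ht
    have h7 := cb_pos hl
    have h8 : w 0 t = 1 / cb (lam w t) ^ 3 := by rw [cb_pow hl.le, lam, one_div_one_div]
    unfold speedDeriv
    rw [h4, h8]
    have e : m t * (1 / (3 * (4 * cb (lam w t)) ^ 2))
        = m t * cb (lam w t) / (48 * cb (lam w t) ^ 3) := by field_simp; ring
    rw [e, div_div, div_le_div_iff₀ (by positivity) (by positivity)]
    have : 0 < cb (lam w t) ^ 3 := by positivity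
    nlinarith
  linarith

/-- The bounds `x ≥ Λ / 12 ^ 3` and `m Λ^{1/3} ≤ 6` produce the constant `6 * (2/9) * 12 ^ 5 =
331776`. -/
lemma Sys.loss_early (S : Sys w m) (ht : 0 ≤ t) (hlc : LogConcaveFrom w t 0) (hx : 0 < x)
    (hw : 0 < w x t) (h : lam w t ≤ 1728 * x) :
    lossRate w m t x ≤ 331776 * w 0 t ^ 2 * (hh w t x / w x t) := by
  refine (S.lossRate_le ht hx hw (hlc.mono hx.le)).trans ?_
  have hp := S.hh_pos ht hx.le hw
  refine mul_le_mul_of_nonneg_right ?_ (div_pos hp hw).le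
  have hl := S.lam_pos ht
  have h1 := S.m_cb_lam_le ht hlc
  have h2 : cb (lam w t) / 12 ≤ cb x := by
    have h3 := cb_pow hl.le
    have h4 := cb_pos hl
    have h5 := cb_le (by positivity) (show (cb (lam w t) / 12) ^ 3 ≤ x by
      rw [div_pow, h3]; norm_num; linarith)
    rwa [cb_cube (by positivity)] at h5
  have h7 := cb_pos hl
  have h8 : w 0 t = 1 / cb (lam w t) ^ 3 := by rw [cb_pow hl.le, lam, one_div_one_div]
  have h9 := pow_le_pow_left₀ (by positivity) h2 5
  unfold speedDeriv₂
  rw [h8]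
  have e1 : 2 / (9 * cb x ^ 5) ≤ 2 / (9 * (cb (lam w t) / 12) ^ 5) :=
    div_le_div_of_nonneg_left (by norm_num) (by positivity) (by linarith)
  calc m t * (2 / (9 * cb x ^ 5)) ≤ m t * (2 / (9 * (cb (lam w t) / 12) ^ 5)) :=
        mul_le_mul_of_nonneg_left e1 (S.rate.pos t).le
    _ = m t * cb (lam w t) * (55296 * (1 / cb (lam w t) ^ 6)) := by field_simp; ring
    _ ≤ 6 * (55296 * (1 / cb (lam w t) ^ 6)) := mul_le_mul_of_nonneg_right h1 (by positivity)
    _ = 331776 * (1 / cb (lam w t) ^ 3) ^ 2 := by field_simp; norm_num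

lemma Sys.stays_small (S : Sys w m) (hlc : ∀ s, t₁ ≤ s → LogConcaveFrom w s 0)
    (h₁ : 0 ≤ t₁) (hT : t₁ ≤ T) (hx : 0 < x) (hs : s ∈ Icc t₁ T)
    (h : 1728 * Z m T x s ≤ lam w s) : ∀ u ∈ Icc s T, 1728 * Z m T x u ≤ lam w u := by
  have hT0 := h₁.trans hT
  have hsub : Icc s T ⊆ Icc 0 T := Icc_subset_Icc_left (h₁.trans hs.1)
  have := image_le_of_deriv_right_lt_deriv_boundary' (f := Z m T x)
    (f' := fun u => m u * cb (Z m T x u) - 1) (a := s) (b := T) (B := fun _ => lam w s / 1728)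
    (B' := fun _ => 0) ((Z_continuousOn S.rate hT0 hx).mono hsub)
    (fun u hu => (Z_hasDerivAt_time S.rate hT0 hx
      (hsub (Ico_subset_Icc_self hu))).hasDerivWithinAt) (by linarith) continuousOn_const
    (fun u _ => hasDerivWithinAt_const _ _ _) (fun u hu heq => by
      have hu' := hsub (Ico_subset_Icc_self hu)
      have hl := S.lam_mono (h₁.trans hs.1) hu.1
      have := S.speed_small hu'.1 (hlc u (hs.1.trans hu.1)) (Z_pos S.rate hT0 hx hu').le
        (by linarith)
      linarith)
  intro u hu
  have h1 := this hu
  have h2 := S.lam_mono (h₁.trans hs.1) hu.1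
  linarith

/-- Below `Λ / 1728` a cluster shrinks at speed at least `1/2`, so the loss, at most `speedDeriv`,
is absorbed by the decrease of `2 * M * cb Z`. At time `s` this quantity is at most `2 * (6 /
Λ^{1/3}) * (Λ^{1/3} / 12) = 1`. -/
lemma Sys.loss_late (S : Sys w m) (hlc : ∀ s, t₁ ≤ s → LogConcaveFrom w s 0)
    (h₁ : 0 ≤ t₁) (hT : t₁ ≤ T) (hx : 0 < x) (hw : 0 < w x T) (hs : s ∈ Icc t₁ T)
    (h : 1728 * Z m T x s ≤ lam w s) : -1 ≤ Real.log (R w m T x s) := by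
  have hT0 := h₁.trans hT
  have hs0 := h₁.trans hs.1
  have hsub : Icc s T ⊆ Icc 0 T := Icc_subset_Icc_left hs0
  have hsmall := S.stays_small hlc h₁ hT hx hs h
  have hl := S.lam_pos hs0
  have hcl := cb_pos hl
  set M : ℝ := 6 / cb (lam w s) with hM
  have hM0 : 0 < M := by positivity
  have hmM : ∀ u ∈ Icc s T, m u ≤ M := fun u hu => by
    have h1 := S.m_cb_lam_le (hs0.trans hu.1) (hlc u (hs.1.trans hu.1))
    have h2 := cb_le hl.le (S.lam_mono hs0 hu.1)
    rw [hM, le_div_iff₀ hcl]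
    exact (mul_le_mul_of_nonneg_left h2 (S.rate.pos u).le).trans h1
  have hcZ : ContinuousOn (fun u => cb (Z m T x u)) (Icc s T) :=
    continuous_cb.comp_continuousOn ((Z_continuousOn S.rate hT0 hx).mono hsub)
  have key := le_of_hasDerivAt_nonpos hs.2
    (((S.logR_continuousOn hT0 hx hw).mono hsub).add (hcZ.const_mul (2 * M)))
    (fun u hu => by
      have hu' := hsub (Ioo_subset_Icc_self hu)
      exact (S.logR_hasDerivAt hT0 hx hw ⟨hs0.trans_lt hu.1, hu.2⟩).add
        (((hasDerivAt_cb (Z_pos S.rate hT0 hx hu')).comp u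
          (Z_hasDerivAt_time S.rate hT0 hx hu')).const_mul (2 * M)))
    (fun u hu => by
      have hu1 := Ioo_subset_Icc_self hu
      have hu' := hsub hu1
      have hz := Z_pos S.rate hT0 hx hu'
      have h1 := S.lossRate_le_speedDeriv hu'.1 hz
      have h2 := S.speed_small hu'.1 (hlc u (hs.1.trans hu.1.le)) hz.le (hsmall u hu1)
      have h3 := cb_pos hz
      have h4 : 0 < 1 / (3 * cb (Z m T x u) ^ 2) := by positivity
      have h5 := hmM u hu1
      unfold speedDeriv at h1
      set q := 1 / (3 * cb (Z m T x u) ^ 2)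
      have h6 : m u * q ≤ M * q := mul_le_mul_of_nonneg_right h5 h4.le
      have h7 : M * q * (m u * cb (Z m T x u)) ≤ M * q * (1 / 2) :=
        mul_le_mul_of_nonneg_left h2 (by positivity)
      nlinarith)
  rw [Pi.add_apply, Pi.add_apply, S.R_end hT0 hx hw, Real.log_one, Z_end S.rate hT0 hx] at key
  have h8 : cb (Z m T x s) ≤ cb (lam w s) / 12 := by
    have h3 := cb_pow hl.le
    have h5 := cb_le (Z_pos S.rate hT0 hx ⟨hs0, hs.2⟩).le
      (show Z m T x s ≤ (cb (lam w s) / 12) ^ 3 by rw [div_pow, h3]; norm_num; linarith)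
    rwa [cb_cube (by positivity)] at h5
  have h9 : 2 * M * cb (Z m T x s) ≤ 1 := by
    calc 2 * M * cb (Z m T x s) ≤ 2 * M * (cb (lam w s) / 12) :=
          mul_le_mul_of_nonneg_left h8 (by positivity)
      _ = 1 := by rw [hM]; field_simp; norm_num
  have h10 := mul_pos (mul_pos two_pos hM0) (cb_pos hx)
  linarith

/-- While the cluster is not small compared with `Λ`, the loss rate is integrable thanks to the
exponential bound on `h / w`; once it is small, `Sys.loss_late` costs at most `1`. These are the two
summands of `lossBound`. -/
lemma Sys.loss_slow (S : Sys w m) (hlc : ∀ s, t₁ ≤ s → LogConcaveFrom w s 0)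
    (h₁ : 0 ≤ t₁) (hT' : t₁ ≤ T') (hTT : T' ≤ T) (hx : 0 < x) (hw : 0 < w x T)
    (hxl : 1728 * x ≤ lam w T) (hv : ∀ s ∈ Ioo T' T, Z m T x s ≤ 27 * lam w s)
    (hk : ∀ s ∈ Ioo T' T,
      Real.log (lam w T) - Real.log (lam w s) ≤ remaining w T s / 256 + 1) :
    -lossBound ≤ Real.log (R w m T x T') := by
  have hT := hT'.trans hTT
  have hT'0 := h₁.trans hT'
  have hT0 := h₁.trans hT
  have hsub : Icc T' T ⊆ Icc 0 T := Icc_subset_Icc_left hT'0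
  have hcr : ContinuousOn (remaining w T) (Icc T' T) :=
    continuousOn_integral_left (S.cont_w_zero hT'0)
  have hdr : ∀ s ∈ Ioo T' T, HasDerivAt (remaining w T) (-w 0 s) s := fun s hs =>
    hasDerivAt_integral_left (S.cont_w_zero hT'0) hs
  -- By `Sys.growth`, `log h + remaining / 128` increases along the characteristic. Replacing `Λ(T)`
  -- by `Λ(s)` costs `remaining / 256 + 1`, so half of the decay survives.
  have hgam : ∀ s ∈ Ioo T' T, hh w s (Z m T x s) / w (Z m T x s) s
      ≤ lam w s * (Real.exp 1 * Real.exp (-remaining w T s / 256)) := by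
    intro s hs
    have hs0 : 0 ≤ s := hT'0.trans hs.1.le
    have hsT : Icc s T ⊆ Icc T' T := Icc_subset_Icc_left hs.1.le
    have key := le_of_hasDerivAt_nonneg hs.2.le
      ((ContinuousOn.log ((S.hh_Z_continuousOn hT0 hx).mono (hsT.trans hsub))
        fun u hu => (S.hh_Z_pos hT0 hx hw (hsub (hsT hu))).ne').add
          ((hcr.mono hsT).div_const 128))
      (fun u hu => ((S.hh_Z_hasDerivAt hT0 hx ⟨hs0.trans_lt hu.1, hu.2⟩).log
        (S.hh_Z_pos hT0 hx hw (hsub (hsT (Ioo_subset_Icc_self hu)))).ne').add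
          ((hdr u ⟨hs.1.trans hu.1, hu.2⟩).div_const 128))
      (fun u hu => by
        have hu1 : u ∈ Ioo T' T := ⟨hs.1.trans hu.1, hu.2⟩
        have hu' := hsub (Ioo_subset_Icc_self hu1)
        have := S.growth hu'.1 (hlc u (hT'.trans hu1.1.le)) (Z_pos S.rate hT0 hx hu')
          (S.w_Z_pos hT0 hx hw hu') (hv u hu1)
        linarith)
    have hrT : remaining w T T = 0 := by simp [remaining]
    rw [Pi.add_apply, Pi.add_apply, Z_end S.rate hT0 hx, hrT] at key
    have hs' := hsub (Ioo_subset_Icc_self hs)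
    have hp := S.hh_Z_pos hT0 hx hw hs'
    have hpT := S.hh_pos hT0 hx.le hw
    have hlT := S.lam_pos hT0
    have hls := S.lam_pos hs0
    have h1 := S.gamma_le hT0 (hlc T hT) hx.le hw
    rw [div_le_iff₀ hw] at h1
    have h2 := Real.log_le_log hpT h1
    rw [Real.log_mul hlT.ne' hw.ne'] at h2
    have h3 := hk s hs
    rw [S.w_Z hT0 hx hs', div_le_iff₀ hw, ← Real.log_le_log_iff hp (by positivity),
      Real.log_mul (by positivity) hw.ne', Real.log_mul hls.ne' (by positivity),
      ← Real.exp_add, Real.log_exp]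
    linarith
  -- The loss rate is now at most `331776 * e * w(0,s) * exp (-remaining / 256)`, an exact
  -- derivative because `remaining' = -w(0,s)`.
  have early : ∀ σ ∈ Icc T' T, (∀ s ∈ Ioo T' σ, lam w s ≤ 1728 * Z m T x s) →
      Real.log (R w m T x σ) - 331776 * 256 * Real.exp 1 ≤ Real.log (R w m T x T') := by
    intro σ hσ hbig
    have hsσ : Icc T' σ ⊆ Icc T' T := Icc_subset_Icc_right hσ.2
    have key := le_of_hasDerivAt_nonpos hσ.1
      (((S.logR_continuousOn hT0 hx hw).mono (hsσ.trans hsub)).sub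
        ((Real.continuous_exp.comp_continuousOn
          ((hcr.mono hsσ).neg.div_const 256)).const_mul (331776 * 256 * Real.exp 1)))
      (fun u hu => (S.logR_hasDerivAt hT0 hx hw
        ⟨hT'0.trans_lt hu.1, hu.2.trans_le hσ.2⟩).sub
          (((hdr u ⟨hu.1, hu.2.trans_le hσ.2⟩).neg.div_const 256).exp.const_mul _))
      (fun u hu => by
        have hu1 : u ∈ Ioo T' T := ⟨hu.1, hu.2.trans_le hσ.2⟩
        have hu' := hsub (Ioo_subset_Icc_self hu1)
        have h1 := S.loss_early hu'.1 (hlc u (hT'.trans hu1.1.le)) (Z_pos S.rate hT0 hx hu')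
          (S.w_Z_pos hT0 hx hw hu') (hbig u hu)
        have h2 := hgam u hu1
        have h0 := S.w_zero_pos hu'.1
        have h3 := mul_le_mul_of_nonneg_left h2 (by positivity : 0 ≤ 331776 * w 0 u ^ 2)
        have e : 331776 * w 0 u ^ 2 * (lam w u * (Real.exp 1 * Real.exp (-remaining w T u / 256)))
            = 331776 * w 0 u * Real.exp 1 * Real.exp (-remaining w T u / 256) := by
          unfold lam; field_simp
        rw [e] at h3
        simp only [Pi.neg_apply]
        linarith)
    simp only [Pi.sub_apply, Function.comp_apply] at key
    have e1 : Real.exp (-remaining w T σ / 256) ≤ 1 := Real.exp_le_one_iff.2 (by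
      have := S.remaining_nonneg (hT'0.trans hσ.1) hσ.2
      linarith)
    have e2 := Real.exp_pos (-remaining w T T' / 256)
    have e3 := Real.exp_pos 1
    simp only [Pi.neg_apply] at key
    nlinarith
  -- The first time in `U` separates the two regimes; `T` itself belongs to it by `hxl`.
  set U : Set ℝ := {s ∈ Icc T' T | 1728 * Z m T x s ≤ lam w s} with hU
  have hUc : IsClosed U := isClosed_Icc.isClosed_le
    (((Z_continuousOn S.rate hT0 hx).mono hsub).const_mul 1728)
    (S.lam_continuousOn.mono fun u hu => (hsub hu).1)
  have hTU : T ∈ U := ⟨right_mem_Icc.2 hTT, by rw [Z_end S.rate hT0 hx]; exact hxl⟩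
  have hUb : BddBelow U := ⟨T', fun u hu => hu.1.1⟩
  have hσU := hUc.csInf_mem ⟨T, hTU⟩ hUb
  set σ := sInf U
  have h1 := early σ hσU.1 fun s hs => by
    by_contra! hlt
    exact absurd (csInf_le hUb ⟨⟨hs.1.le, hs.2.le.trans hσU.1.2⟩, hlt.le⟩) (not_le.2 hs.2)
  have h2 := S.loss_late hlc h₁ hT hx hw ⟨hT'.trans hσU.1.1, hσU.1.2⟩ hσU.2
  unfold lossBound
  linarith

end

/-! ### Lower bound for the beta factor and linear growth -/

section

variable {w : ℝ → ℝ → ℝ} {m : ℝ → ℝ} {T T' x y s t z r δ κ t₁ c : ℝ}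

/-- Mean value theorem for `1 / w(·,T)` on `[0, e]`, whose value at `0` is `Λ(T)`. Its derivative `c
/ w ^ 2` is the beta function divided by `h`, and `h` is near `1` close to `0`. -/
lemma Sys.exists_slope (S : Sys w m) (hβ : BetaBounds w r δ) (hT : 0 ≤ T)
    (hr : ∀ x, 0 < x → r < Z m T x 0) {e : ℝ} (he : 0 < e) (hw : 0 < w e T) :
    ∃ x c, 0 < x ∧ x < e ∧ 0 < w x T ∧ 1 / w e T - lam w T = c / w x T ^ 2 * e ∧
      δ * R w m T x 0 * w x T ^ 2 ≤ c * hh w T x ∧ c * hh w T x ≤ R w m T x 0 * w x T ^ 2 := by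
  have hp : ∀ y ∈ Icc 0 e, 0 < w y T := fun y hy => hw.trans_le (S.anti hy.1 hy.2 hT)
  choose! c hc hc1 hc2 using fun y (hy : y ∈ Ioo 0 e) =>
    S.exists_deriv hβ hT hy.1 (hp y (Ioo_subset_Icc_self hy)) (hr y hy.1)
  have hcont : ContinuousOn (fun y => 1 / w y T) (Icc 0 e) :=
    continuousOn_const.div ((S.cont_space hT).mono Icc_subset_Ici_self) fun y hy => (hp y hy).ne'
  obtain ⟨x, hx, hx'⟩ := exists_hasDerivAt_eq_slope (fun y => 1 / w y T)
    (fun y => c y / w y T ^ 2) he hcont (fun y hy => by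
      have := ((hc y hy).fun_inv (hp y (Ioo_subset_Icc_self hy)).ne')
      simp only [one_div]
      refine this.congr_deriv ?_
      ring)
  refine ⟨x, c x, hx.1, hx.2, hp x (Ioo_subset_Icc_self hx), ?_, hc1 x hx, hc2 x hx⟩
  rw [hx', sub_zero, div_mul_cancel₀ _ he.ne']
  rfl

/-- Since `β ≤ R`, growth of `Λ` can only come from a large `R` near `0`; the factor `1/2` comes
from `h ≥ 1/2` there. Monotonicity of `R` in space extends the bound to all `x`, with no reference
to the past. -/
lemma Sys.R_ge_of_growth (S : Sys w m) (hβ : BetaBounds w r δ) (hT : 0 ≤ T)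
    (hr : ∀ x, 0 < x → r < Z m T x 0) {ε : ℝ} (hε : 0 < ε)
    (hg : ∀ᶠ s in 𝓝[>] T, ε * (s - T) ≤ lam w s - lam w T) (hx : 0 < x) (hw : 0 < w x T) :
    ε / 2 ≤ R w m T x 0 := by
  have hcont : ContinuousWithinAt (hh w T) (Ici 0) 0 := continuousOn_tail (S.memE T hT) 0 self_mem_Ici
  have h1 : ∀ᶠ e in 𝓝[>] (0 : ℝ), 1 / 2 < hh w T e :=
    (hcont.mono Ioi_subset_Ici_self).eventually (lt_mem_nhds (by rw [S.hh_zero hT]; norm_num))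
  have h2 : ∀ᶠ s in 𝓝[>] T, 1 / 2 < hh w T (s - T) := by
    have ht : Tendsto (fun s => s - T) (𝓝[>] T) (𝓝[>] 0) := by
      refine tendsto_nhdsWithin_iff.2 ⟨?_, ?_⟩
      · have : ContinuousAt (fun s => s - T) T := by fun_prop
        have h := this.tendsto.mono_left (nhdsWithin_le_nhds (s := Ioi T))
        simpa using h
      · filter_upwards [self_mem_nhdsWithin] with s hs
        exact mem_Ioi.2 (sub_pos.2 (mem_Ioi.1 hs))
    exact ht.eventually h1
  obtain ⟨s, ⟨hs1, hs2⟩, hsT, hsx⟩ := ((hg.and h2).and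
    (Ioo_mem_nhdsGT (show T < T + x by linarith))).exists
  have he : 0 < s - T := sub_pos.2 hsT
  have hwe : 0 < w (s - T) T := hw.trans_le (S.anti he.le (by linarith) hT)
  obtain ⟨y, c, hy, hye, hwy, heq, -, hc⟩ := S.exists_slope hβ hT hr he hwe
  have h3 : lam w s ≤ 1 / w (s - T) T :=
    one_div_le_one_div_of_le hwe (S.w_zero_ge hT hsT.le)
  have h4 : ε ≤ c / w y T ^ 2 := by
    have : ε * (s - T) ≤ c / w y T ^ 2 * (s - T) := by linarith
    exact le_of_mul_le_mul_right this he
  have h5 : hh w T (s - T) ≤ hh w T y := tail_anti (S.memE T hT) hy.le hye.le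
  rw [le_div_iff₀ (by positivity)] at h4
  have h6 : ε / 2 ≤ R w m T y 0 := by
    have h7 : 0 < w y T ^ 2 := by positivity
    have h8 : ε * w y T ^ 2 * (1 / 2) ≤ c * hh w T y :=
      mul_le_mul h4 (hs2.le.trans h5) (by norm_num) (le_trans (by positivity) h4)
    have h9 : ε / 2 * w y T ^ 2 ≤ R w m T y 0 * w y T ^ 2 := by linarith
    exact le_of_mul_le_mul_right h9 h7
  exact h6.trans (S.R_mono hβ hT hy (by linarith) hw (hr y hy))

/-- A lower bound for the growth at times which are not followed by slow growth. -/
lemma Sys.R_ge (S : Sys w m) (hβ : BetaBounds w r δ) (h₁ : 0 ≤ t₁)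
    (hr : ∀ T, t₁ ≤ T → ∀ x, 0 < x → r < Z m T x 0)
    (hκ : ∀ x, 0 < x → 0 < w x t₁ → κ ≤ R w m t₁ x 0) (hT : t₁ ≤ T) (hx : 0 < x)
    (hw : 0 < w x T) (hxl : 1728 * x ≤ lam w T) :
    min κ (1 / 1024) * Real.exp (-lossBound) ≤ R w m T x 0 := by
  have hT0 := h₁.trans hT
  have hlc : ∀ s, t₁ ≤ s → LogConcaveFrom w s 0 := fun s hs =>
    S.logConcaveFrom_zero hβ (h₁.trans hs) (hr s hs)
  have hsub : Icc t₁ T ⊆ Icc 0 T := Icc_subset_Icc_left h₁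
  have hlT := S.lam_pos hT0
  have hcr : ContinuousOn (remaining w T) (Icc t₁ T) :=
    continuousOn_integral_left (S.cont_w_zero h₁)
  have hcl : ContinuousOn (lam w) (Icc t₁ T) := S.lam_continuousOn.mono fun u hu => h₁.trans hu.1
  have hcll : ContinuousOn (fun s => Real.log (lam w s)) (Icc t₁ T) :=
    hcl.log fun u hu => (S.lam_pos (h₁.trans hu.1)).ne'
  have hcZ := (Z_continuousOn S.rate hT0 hx).mono hsub
  -- Outside `B` the two hypotheses of `Sys.loss_slow` hold. As `B` is closed and omits `T`, it is
  -- either empty, and the comparison starts at `t₁`, or has a last element `σ < T`, from which it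
  -- starts.
  set B : Set ℝ := {s ∈ Icc t₁ T | 27 * lam w s ≤ Z m T x s} ∪
    {s ∈ Icc t₁ T | remaining w T s / 256 + 1 ≤ Real.log (lam w T) - Real.log (lam w s)} with hB
  have hBc : IsClosed B := (isClosed_Icc.isClosed_le (hcl.const_mul 27) hcZ).union
    (isClosed_Icc.isClosed_le ((hcr.div_const 256).add continuousOn_const)
      (continuousOn_const.sub hcll))
  have hBI : B ⊆ Icc t₁ T := union_subset (fun s hs => hs.1) (fun s hs => hs.1)
  have hTB : T ∉ B := by
    rintro (h | h)
    · have := h.2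
      rw [Z_end S.rate hT0 hx] at this
      linarith
    · have := h.2
      simp only [remaining, intervalIntegral.integral_same, sub_self, zero_div, zero_add] at this
      linarith
  have hout : ∀ T', t₁ ≤ T' → T' ≤ T → (∀ s ∈ Ioo T' T, s ∉ B) →
      (∀ y, 0 < y → 0 < w y T' → min κ (1 / 1024) ≤ R w m T' y 0) →
      min κ (1 / 1024) * Real.exp (-lossBound) ≤ R w m T x 0 := by
    intro T' hT' hTT hnB hRT'
    have hT'0 := h₁.trans hT'
    have hIcc : ∀ s ∈ Ioo T' T, s ∈ Icc t₁ T := fun s hs => ⟨hT'.trans hs.1.le, hs.2.le⟩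
    have h2 := S.loss_slow hlc h₁ hT' hTT hx hw hxl
      (fun s hs => by
        by_contra! h
        exact hnB s hs (Or.inl ⟨hIcc s hs, h.le⟩))
      (fun s hs => by
        by_contra! h
        exact hnB s hs (Or.inr ⟨hIcc s hs, h.le⟩))
    have hI : T' ∈ Icc 0 T := ⟨hT'0, hTT⟩
    have hz := Z_pos S.rate hT0 hx hI
    have h3 := hRT' _ hz (S.w_Z_pos hT0 hx hw hI)
    rw [S.R_cocycle hT'0 hTT hx hw ⟨le_rfl, hT'0⟩]
    have h4 : Real.exp (-lossBound) ≤ R w m T x T' := by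
      rw [← Real.exp_log (S.R_pos hT0 hx hw hI)]
      exact Real.exp_le_exp.2 h2
    exact mul_le_mul h3 h4 (Real.exp_pos _).le
      (S.R_pos hT'0 hz (S.w_Z_pos hT0 hx hw hI) ⟨le_rfl, hT'0⟩).le
  rcases B.eq_empty_or_nonempty with hBe | hBne
  · refine hout t₁ le_rfl hT (fun s _ => by rw [hBe]; exact notMem_empty s) fun y hy hwy => ?_
    exact (min_le_left _ _).trans (hκ y hy hwy)
  have hBb : BddAbove B := ⟨T, fun u hu => (hBI hu).2⟩
  have hσ := hBc.csSup_mem hBne hBb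
  have hnot : ∀ s, sSup B < s → s ∉ B := fun s hs hsB => absurd (le_csSup hBb hsB) (not_le.2 hs)
  set σ := sSup B
  have hσI := hBI hσ
  have hσ0 : 0 ≤ σ := h₁.trans hσI.1
  have hσT : σ < T := lt_of_le_of_ne hσI.2 fun h => hTB (h ▸ hσ)
  have hlσ := S.lam_pos hσ0
  refine hout σ hσI.1 hσI.2 (fun s hs => hnot s hs.1) fun y hy hwy => ?_
  refine (min_le_right _ _).trans ?_
  have : (1 / 1024 : ℝ) = 1 / 512 / 2 := by norm_num
  rw [this]
  refine S.R_ge_of_growth hβ hσ0 (hr σ hσI.1) (by norm_num) ?_ hy hwy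
  rcases hσ with hσ | hσ
  -- The cluster is at least `27 Λ` at `σ` and grows there at speed more than `1`, yet is at most
  -- `27 Λ` just afterwards; hence `27 Λ` grows at least as fast.
  · have hzσ := Z_pos S.rate hT0 hx (hsub hσI)
    have hd := Z_hasDerivAt_time S.rate hT0 hx (hsub hσI)
    have hspeed : 1 < m σ * cb (Z m T x σ) - 1 := by
      have h1 := S.m_cb_lam_ge hσ0
      have h2 : cb (27 * lam w σ) ≤ cb (Z m T x σ) := cb_le (by positivity) hσ.2
      have h3 : cb (27 * lam w σ) = 3 * cb (lam w σ) := by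
        have e : 27 * lam w σ = (3 * cb (lam w σ)) ^ 3 := by
          rw [mul_pow, cb_pow hlσ.le]; norm_num
        rw [e, cb_cube (by have := cb_pos hlσ; positivity)]
      have h4 := mul_le_mul_of_nonneg_left h2 (S.rate.pos σ).le
      rw [h3] at h4
      linarith
    have hsl : ∀ᶠ s in 𝓝[>] σ, 1 < slope (Z m T x) σ s :=
      ((hasDerivAt_iff_tendsto_slope.1 hd).mono_left
        (nhdsWithin_mono _ fun s hs => ne_of_gt hs)).eventually (lt_mem_nhds hspeed)
    filter_upwards [hsl, Ioo_mem_nhdsGT hσT] with s hs hsI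
    have hpos : 0 < s - σ := sub_pos.2 hsI.1
    rw [slope_def_field, lt_div_iff₀ hpos] at hs
    have h1 : Z m T x s ≤ 27 * lam w s := by
      by_contra! h
      exact hnot s hsI.1 (Or.inl ⟨⟨hσI.1.trans hsI.1.le, hsI.2.le⟩, h.le⟩)
    have h2 := hσ.2
    linarith
  -- The slow-growth inequality is reversed at `σ` and holds afterwards, so `log Λ` increases by at
  -- least `∫ w(0,u) du / 256`. With `Λ(s) < 2 Λ(σ)` this gives the rate `1/512`.
  · have hev : ∀ᶠ s in 𝓝[>] σ, lam w s < 2 * lam w σ :=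
      (((S.lam_continuousOn σ hσ0).mono (fun s (hs : σ < s) => hσ0.trans hs.le)).eventually
        (gt_mem_nhds (by linarith)))
    filter_upwards [hev, Ioo_mem_nhdsGT hσT] with s hs hsI
    have hpos : 0 < s - σ := sub_pos.2 hsI.1
    have hs0 : 0 ≤ s := hσ0.trans hsI.1.le
    have hls := S.lam_pos hs0
    have h1 : Real.log (lam w T) - Real.log (lam w s) ≤ remaining w T s / 256 + 1 := by
      by_contra! h
      exact hnot s hsI.1 (Or.inr ⟨⟨hσI.1.trans hsI.1.le, hsI.2.le⟩, h.le⟩)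
    have h2 := hσ.2
    have h3 : remaining w T σ - remaining w T s = ∫ u in σ..s, w 0 u := by
      unfold remaining
      rw [← intervalIntegral.integral_add_adjacent_intervals (b := s)
        ((S.cont_w_zero hσ0).intervalIntegrable_of_Icc hsI.1.le)
        ((S.cont_w_zero hs0).intervalIntegrable_of_Icc hsI.2.le)]
      ring
    have h4 : (s - σ) * w 0 s ≤ ∫ u in σ..s, w 0 u := by
      have := intervalIntegral.integral_mono_on (f := fun _ => w 0 s) (g := fun u => w 0 u)
        (μ := volume) hsI.1.le intervalIntegrable_const ((S.cont_w_zero hσ0).intervalIntegrable_of_Icc hsI.1.le)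
        (fun u hu => S.w_zero_anti (hσ0.trans hu.1) hu.2)
      simpa using this
    have h5 : (s - σ) * w 0 s / 256 ≤ Real.log (lam w s / lam w σ) := by
      rw [Real.log_div hls.ne' hlσ.ne']
      linarith
    have h6 := Real.log_le_sub_one_of_pos (div_pos hls hlσ)
    have h7 : (s - σ) * w 0 s / 256 * lam w σ ≤ lam w s - lam w σ := by
      calc (s - σ) * w 0 s / 256 * lam w σ ≤ (lam w s / lam w σ - 1) * lam w σ :=
            mul_le_mul_of_nonneg_right (h5.trans h6) hlσ.le
        _ = lam w s - lam w σ := by field_simp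
    have h8 : 1 / 2 ≤ w 0 s * lam w σ := by
      have h9 : w 0 s * lam w s = 1 := by
        unfold lam
        rw [mul_one_div, div_self (S.w_zero_pos hs0).ne']
      have := mul_lt_mul_of_pos_left hs (S.w_zero_pos hs0)
      linarith
    have h9 := mul_le_mul_of_nonneg_left h8 hpos.le
    linarith

/-- Linear growth of the mean volume from time `t₁` on. -/
lemma Sys.lam_linear (S : Sys w m) (hβ : BetaBounds w r δ) (hδ : 0 < δ) (h₁ : 0 ≤ t₁)
    (hr : ∀ T, t₁ ≤ T → ∀ x, 0 < x → r < Z m T x 0) (hκ0 : 0 < κ)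
    (hκ : ∀ x, 0 < x → 0 < w x t₁ → κ ≤ R w m t₁ x 0) (hT : t₁ ≤ T) :
    δ * (min κ (1 / 1024) * Real.exp (-lossBound)) / 4 * (T - t₁) ≤ lam w T - lam w t₁ := by
  set c := min κ (1 / 1024) * Real.exp (-lossBound) with hc
  have hc0 : 0 < c := mul_pos (lt_min hκ0 (by norm_num)) (Real.exp_pos _)
  -- The lower bound for `R`, with `β₀ ≥ δ` and `h ≤ 1`, gives slope at least `δ * c`; half is lost
  -- because only the interval `[0, (s - T) / 2]` is used.
  have hloc : ∀ T, t₁ ≤ T → ∀ᶠ s in 𝓝[>] T, δ * c / 2 * (s - T) ≤ lam w s - lam w T := by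
    intro T hT
    have hT0 := h₁.trans hT
    have hlT := S.lam_pos hT0
    filter_upwards [S.w_zero_le hT0, Ioo_mem_nhdsGT (show T < T + lam w T / 1728 by linarith)]
      with s hs hsI
    have hs0 := hT0.trans hsI.1.le
    have he : 0 < (s - T) / 2 := by linarith [hsI.1]
    have hwe : 0 < w ((s - T) / 2) T := (S.w_zero_pos hs0).trans_le hs
    obtain ⟨x, a, hx, hxe, hwx, heq, ha, -⟩ := S.exists_slope hβ hT0 (hr T hT) he hwe
    have h1 : 1 / w ((s - T) / 2) T ≤ lam w s := one_div_le_one_div_of_le (S.w_zero_pos hs0) hs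
    have h2 := S.R_ge hβ h₁ hr hκ hT hx hwx (by linarith [hsI.2])
    have h3 : hh w T x ≤ 1 := by
      rw [← S.hh_zero hT0]; exact tail_anti (S.memE T hT0) le_rfl hx.le
    have h0 := S.hh_pos hT0 hx.le hwx
    have hw2 : 0 < w x T ^ 2 := by positivity
    have h4 : δ * c * w x T ^ 2 ≤ a * hh w T x :=
      le_trans (by gcongr) ha
    have ha0 : 0 < a := by
      have : 0 < a * hh w T x := lt_of_lt_of_le (by positivity) h4
      exact pos_of_mul_pos_left this h0.le
    have h5 : δ * c ≤ a / w x T ^ 2 := by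
      rw [le_div_iff₀ hw2]
      nlinarith
    have h6 := mul_le_mul_of_nonneg_right h5 he.le
    linarith
  have hcl : ContinuousOn (lam w) (Icc t₁ T) := S.lam_continuousOn.mono fun u hu => h₁.trans hu.1
  -- The comparison needs a strict inequality of slopes, hence `δ * c / 4` instead of `δ * c / 2`.
  have key := image_le_of_liminf_slope_right_lt_deriv_boundary' (f := fun s => -lam w s)
    (f' := fun _ => -(δ * c / 2)) (a := t₁) (b := T)
    (B := fun s => -lam w t₁ - δ * c / 4 * (s - t₁)) (B' := fun _ => -(δ * c / 4)) hcl.neg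
    (fun s hs ρ hρ => by
      refine Eventually.frequently ?_
      filter_upwards [hloc s hs.1, self_mem_nhdsWithin] with u hu hus
      refine lt_of_le_of_lt ?_ hρ
      have hpos : 0 < u - s := sub_pos.2 hus
      rw [slope_def_field, div_le_iff₀ hpos]
      linarith) (by simp) (by fun_prop)
    (fun s _ => by
      have := (((hasDerivAt_id s).sub_const t₁).const_mul (δ * c / 4)).const_sub (-lam w t₁)
      refine (this.congr_deriv ?_).hasDerivWithinAt
      ring)
    (fun s _ _ => by
      have := mul_pos hδ hc0
      linarith) (right_mem_Icc.2 hT)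
  linarith

end

/-! ### The initial phase -/

section

variable {w : ℝ → ℝ → ℝ} {m : ℝ → ℝ} {T T' x y s t z r r₁ δ κ t₁ c : ℝ}

/-- Here `a` stands for `cb Z` and `b` for `m`. The singularity of `speedDeriv` at `a = 0` is
cancelled by the derivative along the flow of `4 M a / (1 + M a)`, which takes values in `[0, 4]`.
-/
lemma lyapunov_bound {a b M : ℝ} (hM : 0 < M) (ha : 0 < a) (hbM : b ≤ M) :
    b * (1 / (3 * a ^ 2)) + 4 * M / (1 + M * a) ^ 2 * (1 / (3 * a ^ 2) * (b * a - 1))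
      ≤ 3 * M ^ 3 := by
  have h1 : 0 < 1 + M * a := by positivity
  have e : b * (1 / (3 * a ^ 2)) + 4 * M / (1 + M * a) ^ 2 * (1 / (3 * a ^ 2) * (b * a - 1))
      = (b * ((1 + M * a) ^ 2 + 4 * M * a) - 4 * M) / (3 * a ^ 2 * (1 + M * a) ^ 2) := by
    field_simp
    ring
  rw [e, div_le_iff₀ (by positivity)]
  have h2 : b * ((1 + M * a) ^ 2 + 4 * M * a) ≤ M * ((1 + M * a) ^ 2 + 4 * M * a) :=
    mul_le_mul_of_nonneg_right hbM (by positivity)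
  set A := M * a with hA
  have hA0 : 0 < A := by positivity
  have h3 : 3 * M ^ 3 * (3 * a ^ 2 * (1 + A) ^ 2) = M * (9 * A ^ 2 * (1 + A) ^ 2) := by
    rw [hA]; ring
  rw [h3]
  have h4 : 4 * M * a = 4 * A := by rw [hA]; ring
  rw [h4] at h2 ⊢
  have h5 : (1 + A) ^ 2 + 4 * A - 4 ≤ 9 * A ^ 2 * (1 + A) ^ 2 := by
    nlinarith [sq_nonneg (A - 3 / 8), pow_pos hA0 3, pow_pos hA0 4]
  nlinarith

/-- Integrates `lyapunov_bound`. The bound is uniform in `x`, even for clusters about to vanish, and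
needs no log-concavity. -/
lemma J_ge (hm : Rate m) (hT : 0 ≤ T) (hx : 0 < x) {M : ℝ} (hM : 0 < M)
    (hmM : ∀ s ∈ Icc 0 T, m s ≤ M) : Real.exp (-(4 + 3 * M ^ 3 * T)) ≤ J m T x 0 := by
  refine Real.exp_le_exp.2 ?_
  have hcb : ContinuousOn (fun s => cb (Z m T x s)) (Icc 0 T) :=
    continuous_cb.comp_continuousOn (Z_continuousOn hm hT hx)
  have hcbp : ∀ s ∈ Icc 0 T, 0 < cb (Z m T x s) := fun s hs => cb_pos (Z_pos hm hT hx hs)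
  have hV : ∀ a : ℝ, 0 < a →
      HasDerivAt (fun a => 4 * (M * a) / (1 + M * a)) (4 * M / (1 + M * a) ^ 2) a := fun a ha => by
    have hne : 1 + M * a ≠ 0 := by positivity
    have h1 : HasDerivAt (fun a => 4 * (M * a)) (4 * (M * 1)) a :=
      ((hasDerivAt_id a).const_mul M).const_mul 4
    have h2 : HasDerivAt (fun a => 1 + M * a) (M * 1) a :=
      ((hasDerivAt_id a).const_mul M).const_add 1
    refine (h1.fun_div h2 hne).congr_deriv ?_
    ring
  have key := le_of_hasDerivAt_nonpos hT
    (f := fun s => (-∫ u in s..T, speedDeriv m u (Z m T x u))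
      + 4 * (M * cb (Z m T x s)) / (1 + M * cb (Z m T x s)) - 3 * M ^ 3 * s)
    (((continuousOn_integral_left (speedDeriv_Z_continuousOn hm hT hx)).neg.add
      ((continuousOn_const.mul (continuousOn_const.mul hcb)).div
        (continuousOn_const.add (continuousOn_const.mul hcb))
        fun s hs => (add_pos one_pos (mul_pos hM (hcbp s hs))).ne')).sub (by fun_prop))
    (fun s hs => by
      have hs' := Ioo_subset_Icc_self hs
      have h1 := (hV _ (hcbp s hs')).comp s ((hasDerivAt_cb (Z_pos hm hT hx hs')).comp s
        (Z_hasDerivAt_time hm hT hx hs'))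
      exact ((hasDerivAt_integral_left (speedDeriv_Z_continuousOn hm hT hx) hs).neg.add h1).sub
        ((hasDerivAt_id s).const_mul (3 * M ^ 3)))
    (fun s hs => by
      have hs' := Ioo_subset_Icc_self hs
      have := lyapunov_bound hM (hcbp s hs') (hmM s hs')
      unfold speedDeriv
      linarith)
  simp only [intervalIntegral.integral_same] at key
  have h1 : 0 ≤ 4 * (M * cb (Z m T x T)) / (1 + M * cb (Z m T x T)) := by
    have := hcbp T (right_mem_Icc.2 hT)
    positivity
  have h2 : 4 * (M * cb (Z m T x 0)) / (1 + M * cb (Z m T x 0)) ≤ 4 := by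
    have := hcbp 0 (left_mem_Icc.2 hT)
    rw [div_le_iff₀ (by positivity)]
    linarith
  linarith

/-- The tail `h` does not decrease along a characteristic, because `J ≤ 1`. -/
lemma Sys.J_le_R (S : Sys w m) (hT : 0 ≤ T) (hx : 0 < x) (hw : 0 < w x T) (hs : s ∈ Icc 0 T) :
    J m T x s ≤ R w m T x s := by
  have h1 : hh w s (Z m T x s) ≤ hh w T x := by
    rw [S.hh_Z hT hx hs]
    refine setIntegral_mono_on ?_ ((S.memE T hT).integrableOn_Ioi hx.le) measurableSet_Ioi
      fun y hy => (le_abs_self _).trans (S.norm_Jw_le hT (hx.trans hy) hs)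
    refine Integrable.mono' ((S.memE T hT).integrableOn_Ioi hx.le) (S.measurable_Jw hT hx hs) ?_
    filter_upwards [ae_restrict_mem measurableSet_Ioi] with y hy
    exact S.norm_Jw_le hT (hx.trans hy) hs
  unfold R
  rw [le_div_iff₀ (S.hh_Z_pos hT hx hw hs)]
  exact mul_le_mul_of_nonneg_left h1 J_pos.le

/-- If a cluster of initial volume at most `r` survives, the rate is bounded. -/
lemma Sys.rate_le_of_survivor (S : Sys w m) (hrr : r < r₁) (hp : 0 < w r₁ 0)
    (hT : 0 ≤ T) (hx : 0 < x) (hZ : Z m T x 0 ≤ r) :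
    m T ≤ 3 * cb (r₁ - r) ^ 2 * w 0 0 / ((r₁ - r) * w r₁ 0) := by
  have hX : 0 < r₁ - r := sub_pos.2 hrr
  have h0 : (0 : ℝ) ∈ Icc 0 T := left_mem_Icc.2 hT
  -- Backward non-expansion, compared with the survivor. It follows that `w(·,T) ≥ w(r₁,0)` on `[0,
  -- r₁ - r]`, so a fixed mass lies there, which bounds the rate.
  have h1 : Z m T (r₁ - r) 0 ≤ r₁ := by
    rcases le_total x (r₁ - r) with h | h
    · have := abs_Z_sub_le S.rate hT hx hX h0
      rw [abs_of_nonneg (sub_nonneg.2 h)] at this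
      have := (le_abs_self _).trans this
      linarith
    · have := Z_le S.rate hT hX h h0
      linarith
  have h2 : w r₁ 0 ≤ w (r₁ - r) T := by
    rw [← S.w_Z hT hX h0]
    exact S.anti (Z_pos S.rate hT hX h0).le h1 le_rfl
  have h3 := mul_le_tail_sub (S.memE T hT) le_rfl hX.le
  change (r₁ - r - 0) * w (r₁ - r) T ≤ hh w T 0 - hh w T (r₁ - r) at h3
  rw [S.hh_zero hT, sub_zero] at h3
  have h4 := S.m_mul_le hT hX
  have h5 := S.w_zero_anti le_rfl hT
  have h6 : (r₁ - r) * w r₁ 0 ≤ 1 - hh w T (r₁ - r) :=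
    (mul_le_mul_of_nonneg_left h2 hX.le).trans h3
  rw [le_div_iff₀ (mul_pos hX hp)]
  refine (mul_le_mul_of_nonneg_left h6 (S.rate.pos T).le).trans (h4.trans ?_)
  exact mul_le_mul_of_nonneg_left h5 (by positivity)

/-- A cluster of initial volume at most `r` does not survive long. -/
lemma Sys.time_le_of_survivor (S : Sys w m) (hrr : r < r₁) (hp : 0 < w r₁ 0)
    (hT : 0 ≤ T) (hx : 0 < x) (hZ : Z m T x 0 ≤ r) :
    T ≤ 4 / (w r₁ 0 ^ 2 * (r₁ - r)) := by
  have hX : 0 < r₁ - r := sub_pos.2 hrr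
  have h0 : (0 : ℝ) ∈ Icc 0 T := left_mem_Icc.2 hT
  set p := w r₁ 0 with hpdef
  -- The survivor is compared with the characteristic starting at `r₁`, which ends at `y`.
  obtain ⟨y, hy, hyr⟩ : r₁ ∈ (fun y => Z m T y 0) '' Ioi x := by
    rw [Z_image S.rate hT hx h0]
    exact mem_Ioi.2 (by linarith)
  have hxy : x < y := hy
  simp only at hyr
  have hy0 : 0 < y := hx.trans hxy
  have hwy : w y T = p := by rw [← S.w_Z hT hy0 h0, hyr]
  -- Unit mass and `w = p` along this characteristic confine it to `[0, 1 / p]`.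
  have hup : ∀ s ∈ Icc 0 T, Z m T y s ≤ 1 / p := fun s hs => by
    have h1 := mul_le_tail_zero (S.memE s hs.1) (Z_pos S.rate hT hy0 hs).le
    change Z m T y s * w (Z m T y s) s ≤ hh w s 0 at h1
    rw [S.w_Z hT hy0 hs, hwy, S.hh_zero hs.1] at h1
    rwa [le_div_iff₀ hp]
  -- The two characteristics separate at relative rate at least `(3/4) p^{1/3} * p^{2/3} / 3 = p /
  -- 4`. Starting at distance at least `r₁ - r`, they would leave `[0, 1 / p]` if `T` were large.
  have hint : p / 4 * T ≤ ∫ s in (0 : ℝ)..T, m s * cbSlope (Z m T y s) (Z m T x s) := by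
    have := intervalIntegral.integral_mono_on (μ := volume) (f := fun _ => p / 4)
      (g := fun s => m s * cbSlope (Z m T y s) (Z m T x s)) hT intervalIntegrable_const
      (((Z_spec S.rate hT hy0).2.continuousOn_slope S.rate
        (Z_spec S.rate hT hx).2).intervalIntegrable_of_Icc hT) fun s hs => by
        have h1 := hup s hs
        have h2 := Z_le S.rate hT hx hxy.le hs
        have h3 := cb_pos (Z_pos S.rate hT hx hs)
        have h4 := cb_le (Z_pos S.rate hT hx hs).le h2
        have h5 := cb_le (Z_pos S.rate hT hy0 hs).le h1
        have h6 : 3 / 4 * cb p ≤ m s := by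
          refine le_trans ?_ (S.m_ge hs.1)
          have : p ≤ w 0 s := by
            rw [← hwy, ← S.w_Z hT hy0 hs]
            exact S.anti le_rfl (Z_pos S.rate hT hy0 hs).le hs.1
          have := cb_le hp.le this
          linarith
        have hcp := cb_pos hp
        rw [cb_inv hp] at h5
        have h7 : cb p ^ 2 / 3 ≤ cbSlope (Z m T y s) (Z m T x s) := by
          unfold cbSlope
          have h8 : cb (Z m T y s) ^ 2 + cb (Z m T y s) * cb (Z m T x s) + cb (Z m T x s) ^ 2
              ≤ 3 * (1 / cb p) ^ 2 := by
            have h9 := h4.trans h5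
            have a1 := pow_le_pow_left₀ (h3.le.trans h4) h5 2
            have a2 := pow_le_pow_left₀ h3.le h9 2
            have a3 := mul_le_mul h5 h9 h3.le (by positivity)
            nlinarith
          have h10 : 0 < cb (Z m T y s) ^ 2 + cb (Z m T y s) * cb (Z m T x s)
              + cb (Z m T x s) ^ 2 := by
            have := h3.trans_le h4
            positivity
          refine le_trans (le_of_eq ?_) (one_div_le_one_div_of_le h10 h8)
          field_simp
        calc p / 4 = 3 / 4 * cb p * (cb p ^ 2 / 3) := by
              nth_rewrite 1 [← cb_pow hp.le]; ring
          _ ≤ _ := mul_le_mul h6 h7 (div_nonneg (sq_nonneg _) (by norm_num)) (S.rate.pos s).le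
    rw [intervalIntegral.integral_const, smul_eq_mul, sub_zero] at this
    linarith
  have h1 := Z_sub S.rate hT hx hy0 h0
  rw [hyr] at h1
  have h2 : r₁ - r ≤ (1 / p) * Real.exp (-(p / 4 * T)) := by
    have h3 : y ≤ 1 / p := by
      have := hup T (right_mem_Icc.2 hT)
      rwa [Z_end S.rate hT hy0] at this
    calc r₁ - r ≤ r₁ - Z m T x 0 := by linarith
      _ = _ := h1
      _ ≤ _ := mul_le_mul (by linarith) (Real.exp_le_exp.2 (neg_le_neg hint))
        (Real.exp_pos _).le (by positivity)
  have h3 := Real.add_one_le_exp (p / 4 * T)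
  rw [Real.exp_neg] at h2
  have h4 := Real.exp_pos (p / 4 * T)
  have h5 : (r₁ - r) * p * Real.exp (p / 4 * T) ≤ 1 := by
    have := mul_le_mul_of_nonneg_right h2 (mul_pos hp h4).le
    have e : 1 / p * (Real.exp (p / 4 * T))⁻¹ * (p * Real.exp (p / 4 * T)) = 1 := by field_simp
    rw [e] at this
    linarith
  have hpos : 0 < (r₁ - r) * p := mul_pos hX hp
  rw [le_div_iff₀ (by positivity)]
  nlinarith

/-- The time `t₁` lies slightly beyond the supremum of the times with a survivor. The survivor bound
on the rate holds up to the supremum by continuity, and the factor `2` leaves room to go beyond it.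
-/
lemma Sys.exists_good_time (S : Sys w m) (hr : 0 < r) (hrr : r < r₁) (hp : 0 < w r₁ 0) :
    ∃ t₁, 0 ≤ t₁ ∧ t₁ ≤ 4 / (w r₁ 0 ^ 2 * (r₁ - r)) + 1 ∧
      (∀ T, t₁ ≤ T → ∀ x, 0 < x → r < Z m T x 0) ∧
      ∀ s ∈ Icc 0 t₁, m s ≤ 2 * (3 * cb (r₁ - r) ^ 2 * w 0 0 / ((r₁ - r) * w r₁ 0)) := by
  set M := 3 * cb (r₁ - r) ^ 2 * w 0 0 / ((r₁ - r) * w r₁ 0) with hM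
  set B : Set ℝ := {s | 0 ≤ s ∧ ∃ x, 0 < x ∧ Z m s x 0 ≤ r} with hB
  have h0B : (0 : ℝ) ∈ B := ⟨le_rfl, r, hr, by rw [Z_end S.rate le_rfl hr]⟩
  have hBle : ∀ s ∈ B, s ≤ 4 / (w r₁ 0 ^ 2 * (r₁ - r)) := by
    rintro s ⟨hs, x, hx, hZ⟩
    exact S.time_le_of_survivor hrr hp hs hx hZ
  have hBb : BddAbove B := ⟨_, hBle⟩
  have hdown : ∀ s ∈ B, ∀ u, 0 ≤ u → u ≤ s → u ∈ B := by
    rintro s ⟨hs, x, hx, hZ⟩ u hu hus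
    exact ⟨hu, Z m s x u, Z_pos S.rate hs hx ⟨hu, hus⟩, by
      rwa [Z_restrict S.rate hu hus hx ⟨le_rfl, hu⟩]⟩
  have hmB : ∀ s ∈ B, m s ≤ M := by
    rintro s ⟨hs, x, hx, hZ⟩
    exact S.rate_le_of_survivor hrr hp hs hx hZ
  have hσ0 : 0 ≤ sSup B := le_csSup hBb h0B
  have hmσ : m (sSup B) ≤ M :=
    closure_minimal hmB (isClosed_le S.rate.cont continuous_const) (csSup_mem_closure ⟨0, h0B⟩ hBb)
  have hM0 : 0 < M := (S.rate.pos _).trans_le hmσ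
  have hev : ∀ᶠ s in 𝓝 (sSup B), m s < 2 * M :=
    S.rate.cont.continuousAt.eventually (gt_mem_nhds (by linarith))
  obtain ⟨ε, hε, hball⟩ := Metric.eventually_nhds_iff.1 hev
  set η := min 1 (ε / 2) with hη
  have hη0 : 0 < η := lt_min one_pos (half_pos hε)
  refine ⟨sSup B + η, by linarith, ?_, fun T hT x hx => ?_, fun s hs => ?_⟩
  · have := csSup_le ⟨0, h0B⟩ hBle
    linarith [min_le_left 1 (ε / 2)]
  · by_contra! h
    have := le_csSup hBb (show T ∈ B from ⟨by linarith, x, hx, h⟩)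
    linarith
  · rcases lt_or_ge s (sSup B) with h | h
    · obtain ⟨u, hu, hsu⟩ := exists_lt_of_lt_csSup ⟨0, h0B⟩ h
      have := hmB s (hdown u hu s hs.1 hsu.le)
      linarith
    · refine (hball ?_).le
      rw [Real.dist_eq, abs_of_nonneg (sub_nonneg.2 h)]
      linarith [hs.2, min_le_right 1 (ε / 2)]

/-- Linear growth of the mean volume, with constants depending on the initial data only. -/
lemma exists_linear_growth (u : ℝ → ℝ) (hδ : 0 < δ) (hr : 0 < r) (hrr : r < r₁) (hp : 0 < u r₁)
    (hu0 : 0 < u 0) : ∃ C, 0 < C ∧ ∀ w m, Sys w m → BetaBounds w r δ →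
      (∀ x, 0 ≤ x → w x 0 = u x) → ∀ T, 1 ≤ T → C * T ≤ lam w T := by
  set τ := 4 / (u r₁ ^ 2 * (r₁ - r)) + 1 with hτ
  set M := 2 * (3 * cb (r₁ - r) ^ 2 * u 0 / ((r₁ - r) * u r₁)) with hM
  have hX : 0 < r₁ - r := sub_pos.2 hrr
  have hcX := cb_pos hX
  have hτ0 : 0 < τ := by positivity
  have hM0 : 0 < M := by positivity
  set κ := Real.exp (-(4 + 3 * M ^ 3 * τ)) with hκ
  set c := δ * (min κ (1 / 1024) * Real.exp (-lossBound)) / 4 with hc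
  have hc0 : 0 < c := by
    have : 0 < min κ (1 / 1024) := lt_min (Real.exp_pos _) (by norm_num)
    positivity
  -- The second term serves the times up to `t₁ ≤ τ`, where `Λ ≥ Λ(0) = 1 / u 0` suffices.
  refine ⟨min c (1 / (u 0 * τ)), lt_min hc0 (by positivity), fun w m S hβ hw T hT => ?_⟩
  have hp' : 0 < w r₁ 0 := by rwa [hw r₁ (hr.trans hrr).le]
  obtain ⟨t₁, ht₁, ht₁τ, hgood, hmt⟩ := S.exists_good_time hr hrr hp'
  rw [hw r₁ (hr.trans hrr).le, hw 0 le_rfl] at hmt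
  rw [hw r₁ (hr.trans hrr).le] at ht₁τ
  have hT0 : 0 ≤ T := by linarith
  have hlam0 : ∀ s, 0 ≤ s → 1 / u 0 ≤ lam w s := fun s hs => by
    have := S.lam_mono le_rfl hs
    rwa [lam, hw 0 le_rfl] at this
  have hκR : ∀ x, 0 < x → 0 < w x t₁ → κ ≤ R w m t₁ x 0 := fun x hx hwx => by
    refine le_trans ?_ (S.J_le_R ht₁ hx hwx (left_mem_Icc.2 ht₁))
    refine le_trans ?_ (J_ge S.rate ht₁ hx hM0 hmt)
    refine Real.exp_le_exp.2 (neg_le_neg ?_)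
    have := mul_le_mul_of_nonneg_left ht₁τ (by positivity : 0 ≤ 3 * M ^ 3)
    linarith
  set C := min c (1 / (u 0 * τ))
  have hC0 : 0 < C := lt_min hc0 (by positivity)
  have hCτ : C * τ ≤ 1 / u 0 := by
    calc C * τ ≤ 1 / (u 0 * τ) * τ := mul_le_mul_of_nonneg_right (min_le_right _ _) hτ0.le
      _ = 1 / u 0 := by field_simp
  rcases le_total T t₁ with h | h
  · have h1 := mul_le_mul_of_nonneg_left (h.trans ht₁τ) hC0.le
    exact h1.trans (hCτ.trans (hlam0 T hT0))
  · have h1 := S.lam_linear hβ hδ ht₁ hgood (Real.exp_pos _) hκR h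
    have h2 := hlam0 t₁ ht₁
    have h3 := mul_le_mul_of_nonneg_right (min_le_left c (1 / (u 0 * τ))) (sub_nonneg.2 h)
    have h4 := mul_le_mul_of_nonneg_left ht₁τ hC0.le
    have h5 : C * T = C * (T - t₁) + C * t₁ := by ring
    rw [h5]
    change _ ≤ C * τ at h4
    change C * (T - t₁) ≤ _ at h3
    change c * (T - t₁) ≤ _ at h1
    linarith

end

section

/-! ### The rate of a solution -/

section Moment

variable {u : ℝ → ℝ}

/-- The moment of order `-2/3` of `u`. -/
def moment (u : ℝ → ℝ) : ℝ := ∫ x in Ioi (0 : ℝ), x ^ (-(2 / 3) : ℝ) * u x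

lemma moment_pos (hu : MemE u) (hm : tail u 0 = 1) : 0 < moment u := by
  obtain ⟨X, hX, hX0⟩ := (((tendsto_tail_atTop hu).eventually (gt_mem_nhds one_pos)).and
    (eventually_gt_atTop 0)).exists
  refine lt_of_lt_of_le ?_ (rpow_integral_ge hu hX0)
  rw [hm]
  exact mul_pos (Real.rpow_pos_of_pos hX0 _) (sub_pos.2 hX)

/-- A dominating function for the moments of all `u` of mass one with `u 0 ≤ M`; beyond `1` it uses
`x u(x) ≤ 1`. -/
lemma integrableOn_moment_bound (M : ℝ) : IntegrableOn
    (fun x : ℝ => if x ≤ 1 then x ^ (-(2 / 3) : ℝ) * M else x ^ (-(5 / 3) : ℝ)) (Ioi 0) := by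
  rw [← Ioc_union_Ioi_eq_Ioi (zero_le_one' ℝ)]
  refine IntegrableOn.union ?_ ?_
  · have hi : IntegrableOn (fun x : ℝ => x ^ (-(2 / 3) : ℝ) * M) (Ioc 0 1) :=
      ((intervalIntegrable_iff_integrableOn_Ioc_of_le zero_le_one).1
        (intervalIntegral.intervalIntegrable_rpow' (by norm_num))).mul_const M
    exact hi.congr_fun (fun x hx => by simp [hx.2]) measurableSet_Ioc
  · have hi : IntegrableOn (fun x : ℝ => x ^ (-(5 / 3) : ℝ)) (Ioi 1) :=
      integrableOn_Ioi_rpow_of_lt (by norm_num) one_pos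
    exact hi.congr_fun (fun x hx => by simp [not_le.2 (mem_Ioi.1 hx)]) measurableSet_Ioi

lemma rpow_mul_le_bound (hu : MemE u) (hm : tail u 0 = 1) {M x : ℝ} (hM : u 0 ≤ M) (hx : 0 < x) :
    x ^ (-(2 / 3) : ℝ) * u x
      ≤ if x ≤ 1 then x ^ (-(2 / 3) : ℝ) * M else x ^ (-(5 / 3) : ℝ) := by
  have hp := Real.rpow_pos_of_pos hx (-(2 / 3) : ℝ)
  split_ifs
  · exact mul_le_mul_of_nonneg_left ((hu.antitone self_mem_Ici hx.le hx.le).trans hM) hp.le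
  · have h1 := mul_le_tail_zero hu hx.le
    rw [hm] at h1
    have e : x ^ (-(5 / 3) : ℝ) = x ^ (-(2 / 3) : ℝ) * (1 / x) := by
      rw [show (-(5 / 3) : ℝ) = -(2 / 3) - 1 by norm_num, Real.rpow_sub_one hx.ne']
      ring
    rw [e]
    refine mul_le_mul_of_nonneg_left ?_ hp.le
    rw [le_div_iff₀ hx]
    linarith

end Moment

section Solution

variable {w₀ : ℝ → ℝ} {w : ℝ → ℝ → ℝ} {t x : ℝ}

lemma IsSolution.cont_space (S : IsSolution w₀ w) (ht : 0 ≤ t) :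
    ContinuousOn (fun x => w x t) (Ici 0) :=
  S.continuousOn.comp (f := fun x => (x, t)) (by fun_prop) fun _ hx => ⟨hx, ht⟩

lemma IsSolution.cont_time (S : IsSolution w₀ w) (hx : 0 ≤ x) :
    ContinuousOn (fun t => w x t) (Ici 0) :=
  S.continuousOn.comp (f := fun t => (x, t)) (by fun_prop) fun _ ht => ⟨hx, ht⟩

lemma IsSolution.continuousOn_moment (S : IsSolution w₀ w) :
    ContinuousOn (fun t => moment fun x => w x t) (Ici 0) := by
  intro t₀ ht₀
  have hev : ∀ᶠ t in 𝓝[Ici 0] t₀, w 0 t ≤ w 0 t₀ + 1 :=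
    ((S.cont_time le_rfl) t₀ ht₀).eventually (ge_mem_nhds (lt_add_one _))
  refine continuousWithinAt_of_dominated ?_ ?_ (integrableOn_moment_bound (w 0 t₀ + 1)) ?_
  · filter_upwards [self_mem_nhdsWithin] with t ht
    exact (integrableOn_rpow_mul (S.memE t ht)).aestronglyMeasurable
  · filter_upwards [self_mem_nhdsWithin, hev] with t ht htM
    filter_upwards [ae_restrict_mem measurableSet_Ioi] with x hx
    have hx : 0 < x := hx
    rw [Real.norm_of_nonneg (mul_nonneg (Real.rpow_nonneg hx.le _)
      ((S.memE t ht).nonneg x hx.le))]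
    exact rpow_mul_le_bound (S.memE t ht) (S.mass t ht) htM hx
  · filter_upwards [ae_restrict_mem measurableSet_Ioi] with x hx
    exact continuousWithinAt_const.mul ((S.cont_time (le_of_lt hx)) t₀ ht₀)

lemma IsSolution.w_zero_pos (S : IsSolution w₀ w) (ht : 0 ≤ t) : 0 < w 0 t :=
  pos_of_tail_pos (u := fun x => w x t) (S.memE t ht) le_rfl
    (by rw [tail, S.mass t ht]; exact one_pos)

lemma IsSolution.exists_sys (S : IsSolution w₀ w) : ∃ m, Sys w m := by
  have hI : ∀ t, 0 ≤ t → 0 < moment fun x => w x t := fun t ht =>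
    moment_pos (S.memE t ht) (S.mass t ht)
  have hmax : ∀ t : ℝ, max t 0 ∈ Ici (0 : ℝ) := fun t => le_max_right t 0
  -- `max t 0` extends the rate continuously to negative times, as `Rate` requires.
  refine ⟨fun t => 3 * w 0 (max t 0) / moment fun x => w x (max t 0),
    ⟨⟨?_, fun t => ?_⟩, S.continuousOn, S.memE, S.mass, fun t ht => ?_, S.differentiableAt,
      fun x t hx ht hp => ?_⟩⟩
  · have h1 : Continuous fun t : ℝ => w 0 (max t 0) :=
      (S.cont_time le_rfl).comp_continuous (by fun_prop) hmax
    have h2 : Continuous fun t : ℝ => moment fun x => w x (max t 0) :=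
      S.continuousOn_moment.comp_continuous (f := fun t : ℝ => max t 0) (by fun_prop) hmax
    exact (continuous_const.mul h1).div h2 fun t => (hI _ (hmax t)).ne'
  · exact div_pos (mul_pos three_pos (S.w_zero_pos (hmax t))) (hI _ (hmax t))
  · change _ * moment (fun x => w x t) = _
    simp only [max_eq_left ht]
    exact div_mul_cancel₀ _ (hI t ht).ne'
  · have h0 := S.w_zero_pos ht.le
    have h1 := hI t ht.le
    rw [S.equation x t hx ht hp]
    congr 2
    have e : typicalVolume (fun z => w z t) = (1 / 3 * moment (fun x => w x t) / w 0 t) ^ 3 := rfl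
    have hq : 0 < 1 / 3 * moment (fun x => w x t) / w 0 t := by positivity
    rw [e, Real.div_rpow hx.le (by positivity)]
    change cb x / cb _ = _
    rw [cb_cube hq.le]
    simp only [max_eq_left ht.le]
    field_simp

end Solution

/-! ### The mean volume -/

/-- The exceptional point `e` is meant for the end of the support, where `w(·,t)` need not be
differentiable. -/
lemma integral_deriv_Ioi {g g' : ℝ → ℝ} {l e : ℝ} (he : 0 < e) (hc : ContinuousOn g (Ici 0))
    (hd : ∀ x, 0 < x → x ≠ e → HasDerivAt g (g' x) x) (hn : ∀ x, 0 < x → 0 ≤ g' x)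
    (hl : Tendsto g atTop (𝓝 l)) : ∫ x in Ioi 0, g' x = l - g 0 := by
  have hc1 : ContinuousOn g (Icc 0 e) := hc.mono Icc_subset_Ici_self
  have hd1 : ∀ x ∈ Ioo 0 e, HasDerivAt g (g' x) x := fun x hx => hd x hx.1 hx.2.ne
  have hi1 : IntegrableOn g' (Ioc 0 e) :=
    intervalIntegral.integrableOn_deriv_of_nonneg hc1 hd1 fun x hx => hn x hx.1
  have hc2 : ContinuousWithinAt g (Ici e) e := (hc e he.le).mono (Ici_subset_Ici.2 he.le)
  have hd2 : ∀ x ∈ Ioi e, HasDerivAt g (g' x) x := fun x hx => hd x (he.trans hx) (ne_of_gt hx)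
  have hn2 : ∀ x ∈ Ioi e, 0 ≤ g' x := fun x hx => hn x (he.trans hx)
  rw [← Ioc_union_Ioi_eq_Ioi he.le, setIntegral_union (Ioc_disjoint_Ioi le_rfl) measurableSet_Ioi
    hi1 (integrableOn_Ioi_deriv_of_nonneg hc2 hd2 hn2 hl),
    integral_Ioi_of_hasDerivAt_of_nonneg hc2 hd2 hn2 hl, ← intervalIntegral.integral_of_le he.le,
    intervalIntegral.integral_eq_sub_of_hasDerivAt_of_le he.le hc1 hd1
      ((intervalIntegrable_iff_integrableOn_Ioc_of_le he.le).2 hi1)]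
  ring

variable {u : ℝ → ℝ}

lemma MemE.deriv_nonpos (hu : MemE u) {x : ℝ} (hx : 0 < x) : deriv u x ≤ 0 := by
  rw [← derivWithin_of_mem_nhds (Ici_mem_nhds hx)]
  exact hu.antitone.derivWithin_nonpos

lemma MemE.exists_differentiableAt (hu : MemE u) (hc : ContinuousOn u (Ici 0))
    (hd : ∀ x, 0 < x → 0 < u x → DifferentiableAt ℝ u x) (h0 : 0 < u 0) :
    ∃ e, 0 < e ∧ ∀ x, 0 < x → x ≠ e → DifferentiableAt ℝ u x := by
  by_cases h : BddAbove {x | 0 ≤ x ∧ 0 < u x}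
  · obtain ⟨y, hy, hy'⟩ := exists_gt_pos hc le_rfl h0
    refine ⟨sSup {x | 0 ≤ x ∧ 0 < u x}, hy.trans_le (le_csSup h ⟨hy.le, hy'⟩),
      fun x hx hne => ?_⟩
    rcases lt_or_gt_of_ne hne with hlt | hgt
    · obtain ⟨z, hz, hxz⟩ := exists_lt_of_lt_csSup (s := {x | 0 ≤ x ∧ 0 < u x})
        ⟨0, le_rfl, h0⟩ hlt
      exact hd x hx (hz.2.trans_le (hu.antitone hx.le hz.1 hxz.le))
    · have hev : u =ᶠ[𝓝 x] fun _ => 0 := by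
        filter_upwards [lt_mem_nhds hgt, lt_mem_nhds hx] with z hz hz0
        by_contra hne
        exact hz.not_ge (le_csSup h ⟨hz0.le, (hu.nonneg z hz0.le).lt_of_ne' hne⟩)
      exact (differentiableAt_const 0).congr_of_eventuallyEq hev
  · refine ⟨1, one_pos, fun x hx _ => ?_⟩
    obtain ⟨z, hz, hxz⟩ := not_bddAbove_iff.1 h x
    exact hd x hx (hz.2.trans_le (hu.antitone hx.le hz.1 hxz.le))

lemma tendsto_atTop_zero (hu : MemE u) : Tendsto u atTop (𝓝 0) := by
  refine squeeze_zero' ?_ ?_ (tendsto_mul_atTop hu)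
  · filter_upwards [eventually_ge_atTop 0] with x hx using hu.nonneg x hx
  · filter_upwards [eventually_ge_atTop 1] with x hx
    exact le_mul_of_one_le_left (hu.nonneg x (zero_le_one.trans hx)) hx

lemma meanVolume_eq (hu : MemE u) (hc : ContinuousOn u (Ici 0))
    (hd : ∀ x, 0 < x → 0 < u x → DifferentiableAt ℝ u x) (hm : tail u 0 = 1) :
    meanVolume u = 1 / u 0 := by
  have h0 : 0 < u 0 := pos_of_tail_pos hu le_rfl (by rw [hm]; exact one_pos)
  obtain ⟨e, he, hde⟩ := hu.exists_differentiableAt hc hd h0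
  have hn : ∀ x, 0 < x → 0 ≤ -deriv u x := fun x hx => neg_nonneg.2 (hu.deriv_nonpos hx)
  have h1 : ∫ x in Ioi 0, -deriv u x = u 0 := by
    have hl : Tendsto (fun x => -u x) atTop (𝓝 0) := by simpa using (tendsto_atTop_zero hu).neg
    rw [integral_deriv_Ioi (g := fun x => -u x) he hc.neg (fun x hx hxe => (hde x hx hxe).hasDerivAt.neg) hn hl]
    ring
  have h2 : ∫ x in Ioi 0, x * (-deriv u x) = 1 := by
    -- `-(x u) - h` is an antiderivative of `-x u'`; it increases from `-1` to `0`.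
    have hl : Tendsto (fun x => -(x * u x) - tail u x) atTop (𝓝 0) := by
      simpa using (tendsto_mul_atTop hu).neg.sub (tendsto_tail_atTop hu)
    rw [integral_deriv_Ioi (g := fun x => -(x * u x) - tail u x) he
      ((continuousOn_id.mul hc).neg.sub (continuousOn_tail hu)) (fun x hx hxe => ?_)
      (fun x hx => mul_nonneg hx.le (hn x hx)) hl, hm]
    · ring
    · refine (((hasDerivAt_id x).mul (hde x hx hxe).hasDerivAt).neg.sub
        (hasDerivAt_tail hu hc hx)).congr_deriv ?_
      simp only [id]
      ring
  rw [meanVolume, h1, h2]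

end

section

/-! ### The beta function -/

section Beta

variable {u : ℝ → ℝ} {x a : ℝ}

lemma mem_interval_iff (hu : MemE u) (hc : ContinuousOn u (Ici 0)) :
    x ∈ interval (supportEnd u) ↔ 0 ≤ x ∧ 0 < u x := by
  refine and_congr_right fun hx => ⟨fun h => ?_, fun h => ?_⟩
  · obtain ⟨y, hy⟩ := lt_iSup_iff.1 h
    obtain ⟨hy', hxy⟩ := lt_iSup_iff.1 hy
    exact hy'.2.trans_le (hu.antitone hx hy'.1 (EReal.coe_lt_coe_iff.1 hxy).le)
  · obtain ⟨y, hxy, hy⟩ := exists_gt_pos hc hx h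
    exact (EReal.coe_lt_coe_iff.2 hxy).trans_le
      (le_iSup₂ (f := fun (z : ℝ) (_ : z ∈ {z : ℝ | 0 ≤ z ∧ 0 < u z}) => (z : EReal)) y
        ⟨hx.trans hxy.le, hy⟩)

lemma interval_mem_nhds (hu : MemE u) (hc : ContinuousOn u (Ici 0)) (ha : 0 < a) (hp : 0 < u a) :
    interval (supportEnd u) ∈ 𝓝 a := by
  filter_upwards [lt_mem_nhds ha,
    (hc.continuousAt (Ici_mem_nhds ha)).eventually (lt_mem_nhds hp)] with y hy hy'
  exact (mem_interval_iff hu hc).2 ⟨hy.le, hy'⟩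

lemma derivWithin_tail_eventuallyEq (hu : MemE u) (hc : ContinuousOn u (Ici 0)) (ha : 0 < a)
    (hp : 0 < u a) : derivWithin (tail u) (interval (supportEnd u)) =ᶠ[𝓝 a] -u := by
  filter_upwards [lt_mem_nhds ha,
    (hc.continuousAt (Ici_mem_nhds ha)).eventually (lt_mem_nhds hp)] with y hy hy'
  rw [derivWithin_of_mem_nhds (interval_mem_nhds hu hc hy hy'), (hasDerivAt_tail hu hc hy).deriv,
    Pi.neg_apply]

lemma HasBeta.differentiableAt (hb : HasBeta u) (hc : ContinuousOn u (Ici 0)) (ha : 0 < a)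
    (hp : 0 < u a) : DifferentiableAt ℝ u a := by
  have h1 : ContDiffOn ℝ 1 (deriv (tail u)) (interior (interval (supportEnd u))) :=
    (hb.contDiffOn.mono interior_subset).deriv_of_isOpen isOpen_interior (by norm_num)
  have hI := interval_mem_nhds hb.memE hc ha hp
  have h2 : DifferentiableAt ℝ (deriv (tail u)) a :=
    (h1.differentiableOn (by norm_num)).differentiableAt (interior_mem_nhds.2 hI)
  have h3 : u =ᶠ[𝓝 a] fun x => -deriv (tail u) x := by
    filter_upwards [lt_mem_nhds ha] with y hy
    rw [(hasDerivAt_tail hb.memE hc hy).deriv, neg_neg]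
  exact h2.neg.congr_of_eventuallyEq h3

lemma beta_mul_sq (hu : MemE u) (hc : ContinuousOn u (Ici 0)) (ha : 0 < a) (hp : 0 < u a) :
    beta u a * u a ^ 2 = -deriv u a * tail u a := by
  have hev := derivWithin_tail_eventuallyEq hu hc ha hp
  rw [beta, hev.eq_of_nhds, derivWithin_of_mem_nhds (interval_mem_nhds hu hc ha hp), hev.deriv_eq,
    deriv.neg, Pi.neg_apply, neg_sq, div_mul_cancel₀ _ (pow_pos hp 2).ne']

end Beta

/-! ### Uniqueness of the initial data with a given beta function -/

section Unique

variable {u v : ℝ → ℝ} {x : ℝ}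

/-- The data of a probability distribution with a continuous tail function and a beta function. -/
structure Datum (u : ℝ → ℝ) : Prop where
  hasBeta : HasBeta u
  cont : ContinuousOn u (Ici 0)
  mass : tail u 0 = 1

lemma Datum.zero_pos (U : Datum u) : 0 < u 0 :=
  pos_of_tail_pos U.hasBeta.memE le_rfl (by rw [U.mass]; exact one_pos)

/-- So the beta function determines `h / u` up to its value at `0`, which is `1 / u 0` by unit mass.
-/
lemma Datum.hasDerivAt_ratio (U : Datum u) (hx : 0 < x) (hp : 0 < u x) :
    HasDerivAt (fun x => tail u x / u x) (beta u x - 1) x := by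
  have hd := (U.hasBeta.differentiableAt U.cont hx hp).hasDerivAt
  have hb := beta_mul_sq U.hasBeta.memE U.cont hx hp
  refine ((hasDerivAt_tail U.hasBeta.memE U.cont hx).div hd hp.ne').congr_deriv ?_
  rw [div_eq_iff (pow_pos hp 2).ne']
  linarith

/-- Equal beta functions and `u 0 ≤ v 0` give `h_u / u ≥ h_v / v` everywhere. As `-u' / u = β u /
h_u` with `β ≥ 0`, `u` then decays at a smaller relative rate than `v`, so `u / v` increases. -/
lemma Datum.le_of_le (U : Datum u) (V : Datum v) (hs : ∀ x, 0 ≤ x → (0 < u x ↔ 0 < v x))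
    (hβ : ∀ x, 0 ≤ x → 0 < u x → beta u x = beta v x) (h0 : u 0 ≤ v 0) (hx : 0 ≤ x) :
    v x * u 0 ≤ u x * v 0 := by
  have hu := U.hasBeta.memE
  have hv := V.hasBeta.memE
  have hu0 := U.zero_pos
  have hv0 := V.zero_pos
  rcases (hu.nonneg x hx).eq_or_lt with hp | hp
  · have : v x = 0 := (hv.nonneg x hx).antisymm' (not_lt.1 fun h => by
      have := (hs x hx).2 h
      rw [← hp] at this
      exact lt_irrefl _ this)
    rw [this, ← hp, zero_mul, zero_mul]
  have hup : ∀ y ∈ Icc 0 x, 0 < u y := fun y hy => hp.trans_le (hu.antitone hy.1 hx hy.2)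
  have hvp : ∀ y ∈ Icc 0 x, 0 < v y := fun y hy => (hs y hy.1).1 (hup y hy)
  have hsub : Icc 0 x ⊆ Ici 0 := Icc_subset_Ici_self
  have hcu := U.cont.mono hsub
  have hcv := V.cont.mono hsub
  have hg : ∀ y ∈ Icc 0 x, tail v y / v y ≤ tail u y / u y := by
    intro y hy
    have hss : Icc 0 y ⊆ Icc 0 x := Icc_subset_Icc_right hy.2
    have h := le_of_hasDerivAt_nonneg (f := fun z => tail u z / u z - tail v z / v z)
      (f' := fun z => beta u z - 1 - (beta v z - 1)) hy.1
      ((((continuousOn_tail hu).mono hsub).div hcu fun z hz => (hup z hz).ne').sub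
        (((continuousOn_tail hv).mono hsub).div hcv fun z hz => (hvp z hz).ne') |>.mono hss)
      (fun z hz => (U.hasDerivAt_ratio hz.1 (hup z (hss (Ioo_subset_Icc_self hz)))).sub
        (V.hasDerivAt_ratio hz.1 (hvp z (hss (Ioo_subset_Icc_self hz)))))
      (fun z hz => by
        rw [hβ z hz.1.le (hup z (hss (Ioo_subset_Icc_self hz))), sub_self])
    simp only [U.mass, V.mass] at h
    have := one_div_le_one_div_of_le hu0 h0
    linarith
  have hmono := le_of_hasDerivAt_nonneg (f := fun z => u z / v z)
    (f' := fun z => (deriv u z * v z - u z * deriv v z) / v z ^ 2) hx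
    (hcu.div hcv fun z hz => (hvp z hz).ne')
    (fun z hz => ((U.hasBeta.differentiableAt U.cont hz.1
      (hup z (Ioo_subset_Icc_self hz))).hasDerivAt.div (V.hasBeta.differentiableAt V.cont hz.1
      (hvp z (Ioo_subset_Icc_self hz))).hasDerivAt (hvp z (Ioo_subset_Icc_self hz)).ne'))
    (fun z hz => by
      have hz' := Ioo_subset_Icc_self hz
      have h1 := hup z hz'
      have h2 := hvp z hz'
      have e1 := beta_mul_sq hu U.cont hz.1 h1
      have e2 := beta_mul_sq hv V.cont hz.1 h2
      rw [← hβ z hz.1.le h1] at e2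
      have t1 := tail_pos hu U.cont hz.1.le h1
      have t2 := tail_pos hv V.cont hz.1.le h2
      have hd := hu.deriv_nonpos hz.1
      have hb : 0 ≤ beta u z := by
        by_contra! hlt
        have a1 := mul_neg_of_neg_of_pos hlt (pow_pos h1 2)
        have a2 := mul_nonneg (neg_nonneg.2 hd) t1.le
        linarith
      have hr := hg z hz'
      rw [div_le_div_iff₀ h2 h1] at hr
      refine div_nonneg ?_ (sq_nonneg _)
      have k : (deriv u z * v z - u z * deriv v z) * (tail u z * tail v z)
          = beta u z * (u z * v z) * (tail u z * v z - tail v z * u z) := by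
        linear_combination v z * tail v z * e1 - u z * tail u z * e2
      have k2 : 0 ≤ beta u z * (u z * v z) * (tail u z * v z - tail v z * u z) :=
        mul_nonneg (mul_nonneg hb (mul_pos h1 h2).le) (sub_nonneg.2 hr)
      rw [← k] at k2
      exact nonneg_of_mul_nonneg_left k2 (mul_pos t1 t2))
  rw [div_le_div_iff₀ hv0 (hvp x (right_mem_Icc.2 hx))] at hmono
  linarith

lemma typicalVolume_eq_one (hu : MemE u) (h0 : 0 < u 0) (h : typicalVolume u = 1) :
    moment u = 3 * u 0 := by
  have hI : 0 ≤ moment u := setIntegral_nonneg measurableSet_Ioi fun x hx =>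
    mul_nonneg (Real.rpow_nonneg (le_of_lt hx) _) (hu.nonneg x (le_of_lt hx))
  have h1 : (1 / 3 * moment u / u 0) ^ 3 = 1 := h
  rw [pow_eq_one_iff_of_nonneg (by positivity) (by norm_num), div_eq_one_iff_eq h0.ne'] at h1
  linarith

/-- `L = 1` makes the moment `3 u(0)`, so the nonnegative difference in the hypothesis has weighted
integral zero and vanishes almost everywhere; equal masses then give equal values at `0`. -/
lemma Datum.zero_eq_of_le (U : Datum u) (V : Datum v) (hU : typicalVolume u = 1)
    (hV : typicalVolume v = 1) (h : ∀ x, 0 ≤ x → v x * u 0 ≤ u x * v 0) : u 0 = v 0 := by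
  have hu := U.hasBeta.memE
  have hv := V.hasBeta.memE
  have iu := integrableOn_rpow_mul hu
  have iv := integrableOn_rpow_mul hv
  have hint : ∫ x in Ioi (0 : ℝ), (x ^ (-(2 / 3) : ℝ) * u x * v 0 - x ^ (-(2 / 3) : ℝ) * v x * u 0)
      = 0 := by
    rw [integral_sub (iu.mul_const _) (iv.mul_const _), integral_mul_const, integral_mul_const]
    change moment u * _ - moment v * _ = 0
    rw [typicalVolume_eq_one hu U.zero_pos hU, typicalVolume_eq_one hv V.zero_pos hV]
    ring
  have hnn : 0 ≤ᵐ[volume.restrict (Ioi 0)]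
      fun x => x ^ (-(2 / 3) : ℝ) * u x * v 0 - x ^ (-(2 / 3) : ℝ) * v x * u 0 := by
    filter_upwards [ae_restrict_mem measurableSet_Ioi] with x hx
    have hp := Real.rpow_pos_of_pos (mem_Ioi.1 hx) (-(2 / 3) : ℝ)
    have := mul_nonneg hp.le (sub_nonneg.2 (h x (le_of_lt hx)))
    simp only [Pi.zero_apply]
    linarith
  rw [setIntegral_eq_zero_iff_of_nonneg_ae hnn ((iu.mul_const _).sub (iv.mul_const _))] at hint
  have h1 : (fun x => u x * v 0) =ᵐ[volume.restrict (Ioi 0)] fun x => v x * u 0 := by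
    filter_upwards [hint, ae_restrict_mem measurableSet_Ioi] with x hx hx0
    have hp := Real.rpow_pos_of_pos (mem_Ioi.1 hx0) (-(2 / 3) : ℝ)
    rw [Pi.zero_apply] at hx
    have : x ^ (-(2 / 3) : ℝ) * (u x * v 0 - v x * u 0) = 0 := by
      linear_combination hx
    exact sub_eq_zero.1 ((mul_eq_zero.1 this).resolve_left hp.ne')
  have h2 := integral_congr_ae h1
  rw [integral_mul_const, integral_mul_const] at h2
  change tail u 0 * _ = tail v 0 * _ at h2
  rw [U.mass, V.mass] at h2
  linarith

/-- This uniqueness is what lets constants built from the initial data depend on the beta function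
only. -/
lemma Datum.eqOn (U : Datum u) (V : Datum v) (hs : ∀ x, 0 ≤ x → (0 < u x ↔ 0 < v x))
    (hβ : ∀ x, 0 ≤ x → 0 < u x → beta u x = beta v x) (hU : typicalVolume u = 1)
    (hV : typicalVolume v = 1) : EqOn u v (Ici 0) := by
  have hs' : ∀ x, 0 ≤ x → (0 < v x ↔ 0 < u x) := fun x hx => (hs x hx).symm
  have hβ' : ∀ x, 0 ≤ x → 0 < v x → beta v x = beta u x := fun x hx hp =>
    (hβ x hx ((hs x hx).2 hp)).symm
  have h0 : u 0 = v 0 := by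
    rcases le_total (u 0) (v 0) with h | h
    · exact U.zero_eq_of_le V hU hV fun x hx => U.le_of_le V hs hβ h hx
    · exact (V.zero_eq_of_le U hV hU fun x hx => V.le_of_le U hs' hβ' h hx).symm
  intro x hx
  have h1 := U.le_of_le V hs hβ h0.le hx
  have h2 := V.le_of_le U hs' hβ' h0.ge hx
  rw [h0] at h1 h2
  exact le_antisymm (le_of_mul_le_mul_right h2 V.zero_pos) (le_of_mul_le_mul_right h1 V.zero_pos)

end Unique

/-! ### Bounds near the end of the support -/

lemma exists_of_eventually_towardsEnd {ℓ : EReal} (hℓ : 0 < ℓ) {P : ℝ → Prop}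
    (h : ∀ᶠ z in towardsEnd ℓ, P z) :
    ∃ r : ℝ, 0 < r ∧ (r : EReal) < ℓ ∧ ∀ a : ℝ, r < a → (a : EReal) < ℓ → P a := by
  obtain ⟨l, hl, hsub⟩ := (mem_nhdsLT_iff_exists_Ioo_subset' hℓ).1 (eventually_comap.1 h)
  obtain ⟨r, hr, hrℓ⟩ := EReal.lt_iff_exists_real_btwn.1 (max_lt hl hℓ)
  refine ⟨r, EReal.coe_lt_coe_iff.1 ((le_max_right _ _).trans_lt hr), hrℓ, fun a hra ha => ?_⟩
  exact hsub ⟨((le_max_left _ _).trans_lt hr).trans (EReal.coe_lt_coe_iff.2 hra), ha⟩ a rfl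

lemma exists_pos_eventually_lt {ℓ : EReal} {β : ℝ → ℝ}
    (h : 0 < liminf (fun z => (β z : EReal)) (towardsEnd ℓ)) :
    ∃ δ : ℝ, 0 < δ ∧ ∀ᶠ z in towardsEnd ℓ, δ < β z := by
  obtain ⟨δ, hδ, hδ'⟩ := EReal.lt_iff_exists_real_btwn.1 h
  exact ⟨δ, EReal.coe_pos.1 hδ,
    (eventually_lt_of_lt_liminf hδ').mono fun z hz => EReal.coe_lt_coe_iff.1 hz⟩

section Initial

variable {w₀ : ℝ → ℝ} {w : ℝ → ℝ → ℝ} {r δ : ℝ}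

lemma IsSolution.tail_initial (S : IsSolution w₀ w) {x : ℝ} (hx : 0 ≤ x) :
    hh w 0 x = tail w₀ x :=
  setIntegral_congr_fun measurableSet_Ioi fun y hy => S.initial y (hx.trans (le_of_lt hy))

lemma IsSolution.datum (S : IsSolution w₀ w) (hb : HasBeta w₀) : Datum w₀ where
  hasBeta := hb
  cont := (S.cont_space le_rfl).congr fun x hx => (S.initial x hx).symm
  mass := by rw [← S.tail_initial le_rfl]; exact S.mass 0 le_rfl

lemma IsSolution.betaBounds (S : IsSolution w₀ w) (hb : HasBeta w₀) (hr : 0 < r)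
    (h : ∀ a, r < a → 0 < w₀ a → δ < beta w₀ a ∧ beta w₀ a ≤ 1) : BetaBounds w r δ := by
  intro a ha hp
  have ha0 := hr.trans ha
  have hc := (S.datum hb).cont
  rw [S.tail_initial ha0.le]
  rw [S.initial a ha0.le] at hp ⊢
  obtain ⟨h1, h2⟩ := h a ha hp
  have e := beta_mul_sq hb.memE hc ha0 hp
  have hsq := sq_nonneg (w₀ a)
  refine ⟨-deriv w₀ a, ?_, ?_, ?_⟩
  · rw [neg_neg]
    refine (hb.differentiableAt hc ha0 hp).hasDerivAt.congr_of_eventuallyEq ?_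
    filter_upwards [lt_mem_nhds ha0] with x hx using S.initial x hx.le
  · rw [← e]; exact mul_le_mul_of_nonneg_right h1.le hsq
  · rw [← e]; exact mul_le_of_le_one_left hsq h2

lemma IsSolution.meanVolume_eq (S : IsSolution w₀ w) {T : ℝ} (hT : 0 < T) :
    meanVolume (fun x => w x T) = lam w T :=
  LSW.meanVolume_eq (S.memE T hT.le) (S.cont_space hT.le)
    (fun x hx hp => (S.differentiableAt x T hx hT hp).comp x
      (f := fun x => (x, T)) (g := fun p : ℝ × ℝ => w p.1 p.2)
      (differentiableAt_id.prodMk (differentiableAt_const T))) (S.mass T hT.le)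

end Initial

end

end LSW

end

theorem proposition5p1 (ℓ : EReal) (β₀ : ℝ → ℝ)
    (hle : ∀ᶠ z in LSW.towardsEnd ℓ, β₀ z ≤ 1)
    (hpos : 0 < liminf (fun z => (β₀ z : EReal)) (LSW.towardsEnd ℓ)) :
    ∃ C : ℝ, 0 < C ∧
      ∀ (w₀ : ℝ → ℝ) (w : ℝ → ℝ → ℝ),
        LSW.HasBeta w₀ →
        LSW.supportEnd w₀ = ℓ →
        EqOn (LSW.beta w₀) β₀ (LSW.interval ℓ) →
        LSW.typicalVolume w₀ = 1 →
        LSW.IsSolution w₀ w →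
        ∀ T : ℝ, 1 ≤ T → C * T ≤ LSW.meanVolume (fun x => w x T) := by
  -- If some admissible datum `u` exists, `C` is built from it, and every other admissible datum
  -- equals `u` on `[0, ∞)`. Otherwise the claim is vacuous.
  by_cases hex : ∃ (u : ℝ → ℝ) (v : ℝ → ℝ → ℝ), LSW.HasBeta u ∧ LSW.supportEnd u = ℓ ∧
      EqOn (LSW.beta u) β₀ (LSW.interval ℓ) ∧ LSW.typicalVolume u = 1 ∧ LSW.IsSolution u v
  · obtain ⟨u, v, hb, hend, hβ, hL, S⟩ := hex
    have U := S.datum hb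
    have hiff : ∀ x, x ∈ LSW.interval ℓ ↔ 0 ≤ x ∧ 0 < u x := fun x => by
      rw [← hend]; exact LSW.mem_interval_iff hb.memE U.cont
    have hℓ : 0 < ℓ := ((hiff 0).2 ⟨le_rfl, U.zero_pos⟩).2
    obtain ⟨δ, hδ, hlt⟩ := LSW.exists_pos_eventually_lt hpos
    obtain ⟨r, hr, hrℓ, hP⟩ := LSW.exists_of_eventually_towardsEnd hℓ (hlt.and hle)
    obtain ⟨r₁, hrr, hr₁⟩ := EReal.lt_iff_exists_real_btwn.1 hrℓ
    have hrr := EReal.coe_lt_coe_iff.1 hrr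
    obtain ⟨C, hC, hgrow⟩ := LSW.exists_linear_growth u hδ hr hrr
      ((hiff r₁).1 ⟨(hr.trans hrr).le, hr₁⟩).2 U.zero_pos
    refine ⟨C, hC, fun w₀ w hb' hend' hβ' hL' S' T hT => ?_⟩
    have W := S'.datum hb'
    have hiff' : ∀ x, x ∈ LSW.interval ℓ ↔ 0 ≤ x ∧ 0 < w₀ x := fun x => by
      rw [← hend']; exact LSW.mem_interval_iff hb'.memE W.cont
    have heq : EqOn w₀ u (Ici 0) := W.eqOn U
      (fun x hx => ⟨fun h => ((hiff x).1 ((hiff' x).2 ⟨hx, h⟩)).2,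
        fun h => ((hiff' x).1 ((hiff x).2 ⟨hx, h⟩)).2⟩)
      (fun x hx h => (hβ' ((hiff' x).2 ⟨hx, h⟩)).trans (hβ ((hiff' x).2 ⟨hx, h⟩)).symm) hL' hL
    obtain ⟨m, Sm⟩ := S'.exists_sys
    rw [S'.meanVolume_eq (one_pos.trans_le hT)]
    refine hgrow w m Sm (S'.betaBounds hb' hr fun a ha hp => ?_)
      (fun x hx => (S'.initial x hx).trans (heq hx)) T hT
    have hmem := (hiff' a).2 ⟨(hr.trans ha).le, hp⟩
    rw [hβ' hmem]
    exact hP a ha hmem.2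
  · exact ⟨1, one_pos, fun w₀ w h1 h2 h3 h4 h5 => absurd ⟨w₀, w, h1, h2, h3, h4, h5⟩ hex⟩
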